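/- Consider the asymmetric random access machine: a symmetric small memory of $M\ge 1$ words, an unbounded asymmetric large memory, and an integer write cost $\omega\ge 1$. Programs are fixed finite programs of standard RAM instructions operating on words of these memories; for inputs of total length $N$, words have $\Theta(\log N)$ bits, with a sufficiently large constant. The strings are given in large memory, together with their lengths, $M$, and $\omega$ (replaced by the largest word if it does not fit into a word). The I/O cost $Q$ of a computation is the number of reads from large memory plus $\omega$ times the number of writes to large memory; the work $T$ is $Q$ plus the number of reads from and writes to small memory. Let $m\le n$ be the lengths of the two strings, with $m\ge M$, and let $h=\Theta(m/M)$. 1. Let $k_T=\min\{(\omega/M)^{1/3},\sqrt M\}$ and $k_T'=\min\{\sqrt{\omega/(hM)},\,M/h\}$, and suppose that $h\le k_T$ and $n=\Omega(k_T'M)$. Then the length of the longest common subsequence, and likewise the edit distance, of the two strings can be computed with work $$T(m,n)=O\!\left(mn+\frac{mn\,\omega}{k_T'M}\right).$$ 2. Let $k_Q=\min\{\omega^{1/3},\sqrt M\}$ and $k_Q'=\min\{\sqrt{\omega/h},\,M/h\}$, and suppose that $h\le k_Q$ and $n=\Omega(k_Q'M)$. Then the length of the longest common subsequence, and likewise the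 edit distance, of the two strings can be computed with I/O cost $$Q(m,n)=O\!\left(\frac{mn\,\omega}{k_Q'M}\right).$$ In both parts one program serves all values of the parameters, and the constant hidden in the $O$ depends only on the constants hidden in $h=\Theta(m/M)$ and in $n=\Omega(\cdot)$. 3. These bounds improve on $O(mn+mn\omega/(k_TM))$ and $O(mn\omega/(k_QM))$, which are the bounds for long strings: for $h>0$, $h\le k_T$ implies $k_T\le k_T'$ and $h\le k_Q$ implies $k_Q\le k_Q'$, with strict inequality in the conclusion if it is strict in the hypothesis. -/

import Mathlib

/-! ## The asymmetric random access machine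

Words are natural numbers below `2 ^ w`.  There are two memories: a symmetric small memory with `M`
cells, and an asymmetric large memory addressed by words. -/

/-- The two memories of the machine. -/
inductive Bank where
  | small
  | large

/-- Contents of all memory cells. -/
abbrev Memory := Bank → ℕ → ℕ

/-- How an instruction names a cell: by a fixed address, or by the address held in a fixed cell. -/
inductive Addr where
  | direct (a : ℕ)
  | indirect (b : Bank) (a : ℕ)

/-- A memory reference in an instruction. -/
structure Loc where
  bank : Bank
  addr : Addr

/-- An operand of an instruction: a constant of the program or the contents of a cell. -/
inductive Operand where
  | const (c : ℕ)
  | cell (l : Loc)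

inductive BinOp where
  | add
  | sub
  | mul
  | div
  | mod

inductive Test where
  | eq (x y : Operand)
  | lt (x y : Operand)

/-- Programs: memory-to-memory instructions `d := x ∘ y`, combined by sequencing, branching on a
comparison and looping.  There is no storage apart from the two memories. -/
inductive Program where
  | skip
  | assign (d : Loc) (f : BinOp) (x y : Operand)
  | seq (p q : Program)
  | ite (t : Test) (p q : Program)
  | while (t : Test) (p : Program)

/-- Numbers of memory accesses made by a computation. -/
structure Cost where
  smallReads : ℕ
  smallWrites : ℕ
  largeReads : ℕ
  largeWrites : ℕ

instance : Zero Cost := ⟨⟨0, 0, 0, 0⟩⟩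

instance : Add Cost :=
  ⟨fun c d => ⟨c.smallReads + d.smallReads, c.smallWrites + d.smallWrites,
    c.largeReads + d.largeReads, c.largeWrites + d.largeWrites⟩⟩

/-- The asymmetric I/O cost `Q`: reads from large memory plus `ω` times the writes to it. -/
def Cost.io (ω : ℕ) (c : Cost) : ℕ := c.largeReads + ω * c.largeWrites

/-- The asymmetric work: the I/O cost plus the reads from and writes to small memory. -/
def Cost.work (ω : ℕ) (c : Cost) : ℕ := c.io ω + (c.smallReads + c.smallWrites)

def Bank.readCost : Bank → Cost
  | .small => ⟨1, 0, 0, 0⟩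
  | .large => ⟨0, 0, 1, 0⟩

def Bank.writeCost : Bank → Cost
  | .small => ⟨0, 1, 0, 0⟩
  | .large => ⟨0, 0, 0, 1⟩

/-- The cell with address `a` exists: small memory has exactly `M` cells, and addresses are
words. -/
def Bank.HasCell (M w : ℕ) (b : Bank) (a : ℕ) : Prop :=
  a < 2 ^ w ∧ match b with
    | .small => a < M
    | .large => True

/-- The address that an address expression denotes. -/
def Addr.val (s : Memory) : Addr → ℕ
  | .direct a => a
  | .indirect b a => s b a

/-- An indirect address has to be read from memory. -/
def Addr.cost : Addr → Cost
  | .direct _ => 0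
  | .indirect b _ => b.readCost

def Addr.Valid (M w : ℕ) : Addr → Prop
  | .direct _ => True
  | .indirect b a => b.HasCell M w a

def Loc.Valid (M w : ℕ) (s : Memory) (l : Loc) : Prop :=
  l.addr.Valid M w ∧ l.bank.HasCell M w (l.addr.val s)

def Operand.Valid (M w : ℕ) (s : Memory) : Operand → Prop
  | .const _ => True
  | .cell l => l.Valid M w s

def Operand.val (w : ℕ) (s : Memory) : Operand → ℕ
  | .const c => c % 2 ^ w
  | .cell l => s l.bank (l.addr.val s)

def Operand.cost : Operand → Cost
  | .const _ => 0
  | .cell l => l.addr.cost + l.bank.readCost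

/-- Arithmetic on `w`-bit words, modulo `2 ^ w`; `div` and `mod` are the quotient and the remainder
of unsigned integers. -/
def BinOp.eval (w : ℕ) : BinOp → ℕ → ℕ → ℕ
  | .add, a, b => (a + b) % 2 ^ w
  | .sub, a, b => (a + (2 ^ w - b)) % 2 ^ w
  | .mul, a, b => (a * b) % 2 ^ w
  | .div, a, b => (a / b) % 2 ^ w
  | .mod, a, b => (a % b) % 2 ^ w

def Test.Valid (M w : ℕ) (s : Memory) : Test → Prop
  | .eq x y => x.Valid M w s ∧ y.Valid M w s
  | .lt x y => x.Valid M w s ∧ y.Valid M w s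

def Test.Holds (w : ℕ) (s : Memory) : Test → Prop
  | .eq x y => x.val w s = y.val w s
  | .lt x y => x.val w s < y.val w s

def Test.cost : Test → Cost
  | .eq x y => x.cost + y.cost
  | .lt x y => x.cost + y.cost

open Classical in
/-- Overwrite one cell. -/
noncomputable def Memory.write (s : Memory) (b : Bank) (a v : ℕ) : Memory :=
  fun b' a' => if b' = b ∧ a' = a then v else s b' a'

/-- `Exec M w p s c s'`: on the machine with `M` cells of small memory and `w`-bit words, the program
`p` started in `s` halts in `s'`, making the memory accesses counted by `c`.  A computation that
refers to a cell that does not exist has no outcome. -/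
inductive Exec (M w : ℕ) : Program → Memory → Cost → Memory → Prop where
  | skip (s : Memory) : Exec M w .skip s 0 s
  | assign (d : Loc) (f : BinOp) (x y : Operand) (s : Memory)
      (hd : d.Valid M w s) (hx : x.Valid M w s) (hy : y.Valid M w s) :
      Exec M w (.assign d f x y) s (x.cost + y.cost + (d.addr.cost + d.bank.writeCost))
        (s.write d.bank (d.addr.val s) (f.eval w (x.val w s) (y.val w s)))
  | seq {p q : Program} {s s' s'' : Memory} {c c' : Cost}
      (hp : Exec M w p s c s') (hq : Exec M w q s' c' s'') :
      Exec M w (.seq p q) s (c + c') s''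
  | iteTrue {t : Test} {p q : Program} {s s' : Memory} {c : Cost}
      (hv : t.Valid M w s) (ht : t.Holds w s) (hp : Exec M w p s c s') :
      Exec M w (.ite t p q) s (t.cost + c) s'
  | iteFalse {t : Test} {p q : Program} {s s' : Memory} {c : Cost}
      (hv : t.Valid M w s) (ht : ¬ t.Holds w s) (hq : Exec M w q s c s') :
      Exec M w (.ite t p q) s (t.cost + c) s'
  | whileFalse {t : Test} {p : Program} {s : Memory}
      (hv : t.Valid M w s) (ht : ¬ t.Holds w s) :
      Exec M w (.while t p) s t.cost s
  | whileTrue {t : Test} {p : Program} {s s' s'' : Memory} {c c' : Cost}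
      (hv : t.Valid M w s) (ht : t.Holds w s) (hp : Exec M w p s c s')
      (hw : Exec M w (.while t p) s' c' s'') :
      Exec M w (.while t p) s (t.cost + c + c') s''

/-- Initial memory: large memory holds the two lengths, the machine parameters `M` and `ω` (the
latter replaced by the largest word if it does not fit into a word), and then the two strings;
all other cells are `0`. -/
def inputMemory (M ω w : ℕ) (x y : List ℕ) : Memory
  | .small, _ => 0
  | .large, i => ([x.length, y.length, M, min ω (2 ^ w - 1)] ++ x ++ y).getD i 0

/-- On input `x, y` the program `P` halts with the value `f x y` in cell `0` of large memory, making
the memory accesses counted by `c`. -/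
def Computes (M ω w : ℕ) (P : Program) (f : List ℕ → List ℕ → ℕ) (x y : List ℕ) (c : Cost) : Prop :=
  ∃ s, Exec M w P (inputMemory M ω w x y) c s ∧ s .large 0 = f x y

/-! ## The two problems -/

/-- Length of a longest common subsequence. -/
noncomputable def lcsLength (x y : List ℕ) : ℕ :=
  sSup {k | ∃ z : List ℕ, z.Sublist x ∧ z.Sublist y ∧ z.length = k}

/-- The supremum in the definition of `lcsLength` is attained. -/
theorem isGreatest_lcsLength (x y : List ℕ) :
    IsGreatest {k | ∃ z : List ℕ, z.Sublist x ∧ z.Sublist y ∧ z.length = k} (lcsLength x y) := by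
  have hb : BddAbove {k | ∃ z : List ℕ, z.Sublist x ∧ z.Sublist y ∧ z.length = k} :=
    ⟨x.length, by rintro k ⟨z, hz, -, rfl⟩; exact hz.length_le⟩
  exact ⟨Nat.sSup_mem ⟨0, [], List.nil_sublist _, List.nil_sublist _, rfl⟩ hb,
    fun k hk => le_csSup hb hk⟩

/-- One edit operation: insertion, deletion or substitution of a single character. -/
inductive EditStep : List ℕ → List ℕ → Prop where
  | insert (u : List ℕ) (c : ℕ) (v : List ℕ) : EditStep (u ++ v) (u ++ c :: v)
  | delete (u : List ℕ) (c : ℕ) (v : List ℕ) : EditStep (u ++ c :: v) (u ++ v)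
  | substitute (u : List ℕ) (c d : ℕ) (v : List ℕ) : EditStep (u ++ c :: v) (u ++ d :: v)

/-- `y` arises from `x` by exactly `k` edit operations. -/
inductive EditSteps : ℕ → List ℕ → List ℕ → Prop where
  | refl (x : List ℕ) : EditSteps 0 x x
  | step {k : ℕ} {x y z : List ℕ} (h : EditStep x y) (hs : EditSteps k y z) : EditSteps (k + 1) x z

/-- Edit distance: the least number of edit operations that turn `x` into `y`. -/
noncomputable def editDistance (x y : List ℕ) : ℕ := sInf {k | EditSteps k x y}

/-- The infimum in the definition of `editDistance` is attained. -/
theorem isLeast_editDistance (x y : List ℕ) :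
    IsLeast {k | EditSteps k x y} (editDistance x y) := by
  have hins : ∀ r u : List ℕ, EditSteps r.length u (u ++ r) := by
    intro r
    induction r with
    | nil => intro u; simpa using EditSteps.refl u
    | cons c r ih =>
      intro u
      have h1 : EditStep u (u ++ [c]) := by simpa using EditStep.insert u c []
      have h2 := ih (u ++ [c])
      rw [List.append_assoc] at h2
      exact EditSteps.step h1 h2
  have hdel : ∀ r : List ℕ, EditSteps (r.length + y.length) r y := by
    intro r
    induction r with
    | nil => simpa using hins y []
    | cons c r ih =>
      have h1 : EditStep (c :: r) r := by simpa using EditStep.delete [] c r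
      have h2 := EditSteps.step h1 ih
      rwa [show r.length + y.length + 1 = (c :: r).length + y.length by
        simp only [List.length_cons]; omega] at h2
  exact ⟨Nat.sInf_mem ⟨_, hdel x⟩, fun k hk => Nat.sInf_le hk⟩

/-! ## The parameters in the bounds -/

noncomputable def kT (ω M : ℝ) : ℝ := min ((ω / M) ^ (1 / 3 : ℝ)) (Real.sqrt M)

noncomputable def kQ (ω M : ℝ) : ℝ := min (ω ^ (1 / 3 : ℝ)) (Real.sqrt M)

noncomputable def kT' (ω M h : ℝ) : ℝ := min (Real.sqrt (ω / (h * M))) (M / h)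

noncomputable def kQ' (ω M h : ℝ) : ℝ := min (Real.sqrt (ω / h)) (M / h)

/-! Both problems are distances in the `(m + 1) × (n + 1)` grid with unit horizontal and vertical
steps and free diagonal steps at matches. A mismatched diagonal costs 1 for the edit distance and 2
for common subsequences, where the distance is `m + n - 2 * lcsLength` (`editDistance_eq`,
`gridDist_add_lcsLength`). The grid is cut into `nb = Θ(h)` bands of `B = Θ(M)` rows and into
full-height rectangles of `k * B` columns, so that a rectangle and a band meet in about `k` tiles of
size `B × B`. For each rectangle only its right boundary and a small table are written to large
memory, which makes about `m n / (k M)` writes in total. The values on the lines between bands are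
never stored. They are recomputed whenever they are needed.

Recomputation is cheap because of a perturbation. A value is encoded as `d * big + φ`, where `d` is
the distance and `φ < big` is the sum of the numbers of the tiles in which the chosen path crosses
the lines of the rectangle. A cell inherits `φ` from one of its neighbours, and this local rule
forces `φ` to increase to the right and to decrease downwards in a band (`phi_band_mono`), as for
paths that do not cross. Since every crossing adds the tile number, `φ` grows along each line at
least as fast as the tile number (`Fits.top_mono`). Hence the counts that occur in different tiles
of a line lie in disjoint intervals, whose end points form the table. A line and a count therefore
determine the tile of the crossing. Subtracting its number gives the count on the preceding line,
and so on: the sequence of tiles is recovered from one number, without knowledge of the path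
(`Rect.Tiles`).

For a fixed count `τ` the dynamic program is run only in the corridor between consecutive tiles of
this sequence, and everything outside is replaced by an upper bound. The results are upper bounds
everywhere and are exact where the count is `τ`, because exactness propagates between cells of equal
count (`step_exact`). Consecutive tiles step back by at most one (`Fits.tile_le_succ`), so a
corridor has at most `k + nb` tiles (`sum_tiles`). Taking the minimum over all counts of a tile
reconstructs a line exactly (`tileLine_spec`). One more sweep of the band below yields the table of
the next line and a piece of the right boundary (`tileSweep_spec`, `stage_spec`).

A line has at most `nb * k + 1` counts (`sum_tab`, `Fits.tab_last`). So a rectangle takes about `nb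
* (nb * k) * (k + nb)` tile evaluations, each with `O(B ^ 2)` work but only `O(B)` reads of large
memory (`mainCost_le`). Over the `n / (k * B)` rectangles this is `m n * nb * (k + nb)` work and `m
n * nb * (k + nb) / M` reads, against a write cost of `m n ω / (k M)`. With `nb = O(k)`, which
follows from `h ≤ kT` or `h ≤ kQ`, balancing requires `h * k ^ 2 * M ≤ ω` for work and `h * k ^ 2 ≤
ω` for I/O. The program finds the largest such `k` with `k * nb ≤ M` by search, and this is `kT'` or
`kQ'` up to constants (`Tiling.le_kk`, `Tiling.kk_le`).

The corridor is described by one number per line in small memory, so `nb ≤ B` is needed. If this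
fails or `M < 256`, then `h ≤ √M` bounds `M` and `m` by a constant (`Sizes.bounded`), and a variant
that keeps everything in large memory suffices. The programs are written in a small language with a
cost-annotated program logic, and one compilation theorem (`Big.exec`) transfers results and costs
to the machine. -/

namespace AsymDP

/-! ## A small structured language on top of the machine -/

/-- The scalar variables of the program; they live in fixed cells of the scratch bank. -/
inductive Var where
  | vm | vn | vM | vo | vB | vnb | vkk | vK | vxb | vyb | vN0 | vbig | ve2 | vinf | vst
  | vrho | vnr | vcol | vkt | vtl | vj | vbl | vr0 | vt | vtau | vtauhi | vchi | vc | vct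
  | ve | vl | vq | vu | vv | va | vd | vr2 | vchi2 | vc2 | vi
  | si | sdiag | sup | sold | sx | sy | sw | sp | sc | stp | snr | sr | t0 | t1 | vres
  deriving DecidableEq

/-- The arrays of the program: eight scratch arrays, the input, and three arrays in large memory. -/
inductive Arr where
  | F1 | X1 | F2 | X2 | W | W2 | acc | sq | inp | la | ra | tb
  deriving DecidableEq

open Var Arr

def Var.idx (x : Var) : ℕ := x.ctorIdx

theorem Var.idx_injective : Function.Injective Var.idx := fun x y h => by
  have := congrArg Var.ofNat h
  simpa [Var.idx, Var.ofNat_ctorIdx] using this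

theorem Var.idx_lt (x : Var) : x.idx < 60 := by cases x <;> decide

def Arr.large : Arr → Bool
  | inp | la | ra | tb => true
  | _ => false

/-- Arrays of one kind are interleaved, with distinct residues of the offsets modulo the stride.
Disjointness then does not depend on array lengths and is linear arithmetic. Entries of `la`, `ra`
and `tb` are used only from the end of the input on, so their addresses lie beyond the input. -/
def Arr.stride : Arr → ℕ
  | inp => 1
  | la | ra | tb => 4
  | _ => 8

def Arr.off : Arr → ℕ
  | F1 => 64 | X1 => 65 | F2 => 66 | X2 => 67 | W => 68 | W2 => 69 | acc => 70 | sq => 71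
  | inp => 0 | la => 0 | ra => 1 | tb => 2

def Arr.addr (k : Arr) (i : ℕ) : ℕ := i * k.stride + k.off

/-- Contents of the variables and of the arrays. -/
structure St where
  v : Var → ℕ
  a : Arr → ℕ → ℕ

namespace St

def setV (s : St) (x : Var) (n : ℕ) : St := ⟨fun y => if y = x then n else s.v y, s.a⟩

def setA (s : St) (k : Arr) (i n : ℕ) : St :=
  ⟨s.v, fun k' i' => if k' = k ∧ i' = i then n else s.a k' i'⟩

@[simp] theorem setV_v (s : St) (x : Var) (n : ℕ) (y : Var) :
    (s.setV x n).v y = if y = x then n else s.v y := rfl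
@[simp] theorem setV_a (s : St) (x : Var) (n : ℕ) : (s.setV x n).a = s.a := rfl
@[simp] theorem setA_v (s : St) (k : Arr) (i n : ℕ) : (s.setA k i n).v = s.v := rfl
@[simp] theorem setA_a (s : St) (k : Arr) (i n : ℕ) (k' : Arr) (i' : ℕ) :
    (s.setA k i n).a k' i' = if k' = k ∧ i' = i then n else s.a k' i' := rfl

end St

inductive Opd where
  | lit (c : ℕ)
  | var (x : Var)

instance : Coe Var Opd := ⟨Opd.var⟩

def Opd.val (s : St) : Opd → ℕ
  | .lit c => c
  | .var x => s.v x

@[simp] theorem Opd.val_lit (s : St) (c : ℕ) : (Opd.lit c).val s = c := rfl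
@[simp] theorem Opd.val_var (s : St) (x : Var) : (Opd.var x).val s = s.v x := rfl

inductive Cnd where
  | eq (x y : Opd)
  | lt (x y : Opd)

def Cnd.holds (s : St) : Cnd → Prop
  | .eq x y => x.val s = y.val s
  | .lt x y => x.val s < y.val s

@[simp] theorem Cnd.holds_eq (s : St) (x y : Opd) : (Cnd.eq x y).holds s ↔ x.val s = y.val s :=
  Iff.rfl
@[simp] theorem Cnd.holds_lt (s : St) (x y : Opd) : (Cnd.lt x y).holds s ↔ x.val s < y.val s :=
  Iff.rfl

inductive Cmd where
  | skip
  | op (d : Var) (f : BinOp) (x y : Opd)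
  | load (d : Var) (k : Arr) (x : Opd)
  | store (k : Arr) (x y : Opd)
  | seq (p q : Cmd)
  | ite (t : Cnd) (p q : Cmd)
  | loop (i : Var) (hi : Opd) (p : Cmd)

infixr:60 " ;; " => Cmd.seq

/-- Arithmetic on natural numbers, without overflow. -/
def opNat : BinOp → ℕ → ℕ → ℕ
  | .add, a, b => a + b
  | .sub, a, b => a - b
  | .mul, a, b => a * b
  | .div, a, b => a / b
  | .mod, a, b => a % b

/-- The operation can be performed on words below `W` without overflow. -/
def opOk (W : ℕ) : BinOp → ℕ → ℕ → Prop
  | .add, a, b => a + b < W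
  | .sub, a, b => b ≤ a
  | .mul, a, b => a * b < W
  | .div, _, _ => True
  | .mod, _, _ => True

/-- The machine on which the language runs: `b` is the bank used as scratch memory, `ok k i` says
that entry `i` of array `k` may be used, and the other three numbers weigh memory accesses. -/
structure Env where
  M : ℕ
  w : ℕ
  b : Bank
  ok : Arr → ℕ → Prop
  wS : ℕ
  wR : ℕ
  wW : ℕ

namespace Env
variable (E : Env)

/-- The weighted cost. -/
def μ (c : Cost) : ℕ :=
  E.wS * (c.smallReads + c.smallWrites) + E.wR * c.largeReads + E.wW * c.largeWrites

/-- Cost of a step that uses scratch memory only. -/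
def cs : ℕ := 8 * (E.μ E.b.readCost + E.μ E.b.writeCost)

/-- Cost of a step that reads large memory. -/
def cr : ℕ := E.cs + E.wR

/-- Cost of a step that writes large memory. -/
def cw : ℕ := E.cs + E.wW

def loadCost (k : Arr) : ℕ := if k.large then E.cr else E.cs

def storeCost (k : Arr) : ℕ := if k.large then E.cw else E.cs

def bank (k : Arr) : Bank := if k.large then .large else E.b

/-- All variables and array entries have their own cells. -/
structure Wf : Prop where
  word : 1024 ≤ 2 ^ E.w
  cell : ∀ i < 64, E.b.HasCell E.M E.w i
  arr : ∀ k i, E.ok k i → (E.bank k).HasCell E.M E.w (k.addr i)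
  sep : ∀ k i, E.ok k i → E.bank k = E.b → 64 ≤ k.addr i
  inj : ∀ k i k' i', E.ok k i → E.ok k' i' → E.bank k = E.bank k' → k.addr i = k'.addr i' →
    k = k' ∧ i = i'

end Env

/-- Big-step semantics with costs. -/
inductive Big (E : Env) : Cmd → St → ℕ → St → Prop where
  | skip (s : St) : Big E .skip s 0 s
  | op (d : Var) (f : BinOp) (x y : Opd) (s : St) (h : opOk (2 ^ E.w) f (x.val s) (y.val s)) :
      Big E (.op d f x y) s E.cs (s.setV d (opNat f (x.val s) (y.val s)))
  | load (d : Var) (k : Arr) (x : Opd) (s : St) (h : E.ok k (x.val s)) :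
      Big E (.load d k x) s (E.loadCost k) (s.setV d (s.a k (x.val s)))
  | store (k : Arr) (x y : Opd) (s : St) (h : E.ok k (x.val s)) :
      Big E (.store k x y) s (E.storeCost k) (s.setA k (x.val s) (y.val s))
  | seq {p q : Cmd} {s s' s'' : St} {n n' : ℕ} (hp : Big E p s n s') (hq : Big E q s' n' s'') :
      Big E (.seq p q) s (n + n') s''
  | iteTrue {t : Cnd} {p q : Cmd} {s s' : St} {n : ℕ} (ht : t.holds s) (hp : Big E p s n s') :
      Big E (.ite t p q) s (E.cs + n) s'
  | iteFalse {t : Cnd} {p q : Cmd} {s s' : St} {n : ℕ} (ht : ¬ t.holds s) (hq : Big E q s n s') :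
      Big E (.ite t p q) s (E.cs + n) s'
  | loopStop {i : Var} {hi : Opd} {p : Cmd} {s : St} (ht : ¬ s.v i < hi.val s) :
      Big E (.loop i hi p) s E.cs s
  | loopStep {i : Var} {hi : Opd} {p : Cmd} {s s' s'' : St} {n n' : ℕ} (ht : s.v i < hi.val s)
      (hp : Big E p s n s') (hw : s'.v i + 1 < 2 ^ E.w)
      (hl : Big E (.loop i hi p) (s'.setV i (s'.v i + 1)) n' s'') :
      Big E (.loop i hi p) s (E.cs + n + (E.cs + n')) s''

/-! ### Compilation -/

def Opd.comp (b : Bank) : Opd → Operand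
  | .lit c => .const c
  | .var x => .cell ⟨b, .direct x.idx⟩

def Cnd.comp (b : Bank) : Cnd → Test
  | .eq x y => .eq (x.comp b) (y.comp b)
  | .lt x y => .lt (x.comp b) (y.comp b)

/-- Put the address of entry `x` of array `k` into cell `63`. -/
def compAddr (b : Bank) (k : Arr) (x : Opd) : Program :=
  .seq (.assign ⟨b, .direct 63⟩ .mul (x.comp b) (.const k.stride))
    (.assign ⟨b, .direct 63⟩ .add (.cell ⟨b, .direct 63⟩) (.const k.off))

def Arr.loc (b : Bank) (k : Arr) : Loc := ⟨if k.large then .large else b, .indirect b 63⟩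

def Cmd.comp (b : Bank) : Cmd → Program
  | .skip => .skip
  | .op d f x y => .assign ⟨b, .direct d.idx⟩ f (x.comp b) (y.comp b)
  | .load d k x => .seq (compAddr b k x)
      (.assign ⟨b, .direct d.idx⟩ .add (.cell (k.loc b)) (.const 0))
  | .store k x y => .seq (compAddr b k x) (.assign (k.loc b) .add (y.comp b) (.const 0))
  | .seq p q => .seq (p.comp b) (q.comp b)
  | .ite t p q => .ite (t.comp b) (p.comp b) (q.comp b)
  | .loop i hi p => .while ((Cnd.lt (.var i) hi).comp b)
      (.seq (p.comp b) (.assign ⟨b, .direct i.idx⟩ .add (.cell ⟨b, .direct i.idx⟩) (.const 1)))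

/-- All constants are small enough to be words. -/
def Opd.small : Opd → Bool
  | .lit c => c < 1024
  | .var _ => true

def Cnd.small : Cnd → Bool
  | .eq x y | .lt x y => x.small && y.small

def Cmd.small : Cmd → Bool
  | .skip => true
  | .op _ _ x y => x.small && y.small
  | .load _ _ x => x.small
  | .store _ x y => x.small && y.small
  | .seq p q => p.small && q.small
  | .ite t p q => t.small && (p.small && q.small)
  | .loop _ hi p => hi.small && p.small

/-- The memory `s` represents the state `t`. -/
structure Rep (E : Env) (t : St) (s : Memory) : Prop where
  v : ∀ x, s E.b x.idx = t.v x
  a : ∀ k i, E.ok k i → s (E.bank k) (k.addr i) = t.a k i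
  vlt : ∀ x, t.v x < 2 ^ E.w
  alt : ∀ k i, E.ok k i → t.a k i < 2 ^ E.w

section compile
variable {E : Env}

theorem Env.μ_add (c d : Cost) : E.μ (c + d) = E.μ c + E.μ d := by
  change E.wS * ((c.smallReads + d.smallReads) + (c.smallWrites + d.smallWrites)) +
    E.wR * (c.largeReads + d.largeReads) + E.wW * (c.largeWrites + d.largeWrites) = _
  unfold Env.μ; ring

theorem Env.μ_zero : E.μ 0 = 0 := by
  change E.wS * (0 + 0) + E.wR * 0 + E.wW * 0 = 0
  simp

theorem eval_eq_opNat {w : ℕ} {f : BinOp} {a b : ℕ} (ha : a < 2 ^ w) (hb : b < 2 ^ w)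
    (h : opOk (2 ^ w) f a b) : f.eval w a b = opNat f a b ∧ opNat f a b < 2 ^ w := by
  cases f
  · exact ⟨Nat.mod_eq_of_lt h, h⟩
  · simp only [opOk] at h
    refine ⟨?_, lt_of_le_of_lt (Nat.sub_le _ _) ha⟩
    simp only [BinOp.eval, opNat]
    rw [show a + (2 ^ w - b) = (a - b) + 2 ^ w by omega, Nat.add_mod_right]
    exact Nat.mod_eq_of_lt (by omega)
  · exact ⟨Nat.mod_eq_of_lt h, h⟩
  · have : a / b < 2 ^ w := lt_of_le_of_lt (Nat.div_le_self _ _) ha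
    exact ⟨Nat.mod_eq_of_lt this, this⟩
  · have : a % b < 2 ^ w := lt_of_le_of_lt (Nat.mod_le _ _) ha
    exact ⟨Nat.mod_eq_of_lt this, this⟩

theorem Operand.val_const (w : ℕ) (s : Memory) (c : ℕ) :
    (Operand.const c).val w s = c % 2 ^ w := rfl

theorem Operand.cost_const (c : ℕ) : (Operand.const c).cost = 0 := rfl

theorem Operand.cost_cell (l : Loc) : (Operand.cell l).cost = l.addr.cost + l.bank.readCost := rfl

theorem Rep.opd {t : St} {s : Memory} (hE : E.Wf) (h : Rep E t s) {x : Opd} (hx : x.small = true) :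
    (x.comp E.b).Valid E.M E.w s ∧ (x.comp E.b).val E.w s = x.val t ∧ x.val t < 2 ^ E.w ∧
      E.μ (x.comp E.b).cost ≤ E.μ E.b.readCost := by
  cases x with
  | lit c =>
    have hc : c < 2 ^ E.w := lt_of_lt_of_le (by simpa [Opd.small] using hx) hE.word
    refine ⟨trivial, Nat.mod_eq_of_lt hc, hc, ?_⟩
    simp [Opd.comp, Operand.cost, Env.μ_zero]
  | var x =>
    refine ⟨⟨trivial, hE.cell _ (by have := x.idx_lt; simp only [Addr.val]; omega)⟩, h.v x, h.vlt x,
      ?_⟩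
    simp [Opd.comp, Operand.cost, Env.μ_zero, Env.μ_add, Addr.cost]

theorem Rep.cnd {t : St} {s : Memory} (hE : E.Wf) (h : Rep E t s) {x : Cnd} (hx : x.small = true) :
    (x.comp E.b).Valid E.M E.w s ∧ ((x.comp E.b).Holds E.w s ↔ x.holds t) ∧
      E.μ (x.comp E.b).cost ≤ E.cs := by
  cases x with
  | eq x y =>
    obtain ⟨h1, h2⟩ := Bool.and_eq_true_iff.1 hx
    obtain ⟨a1, a2, a3, a4⟩ := h.opd hE h1
    obtain ⟨b1, b2, b3, b4⟩ := h.opd hE h2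
    refine ⟨⟨a1, b1⟩, ?_, ?_⟩
    · simp only [Cnd.comp, Test.Holds, a2, b2]; rfl
    · simp only [Cnd.comp, Test.cost, Env.μ_add, Env.cs]; omega
  | lt x y =>
    obtain ⟨h1, h2⟩ := Bool.and_eq_true_iff.1 hx
    obtain ⟨a1, a2, a3, a4⟩ := h.opd hE h1
    obtain ⟨b1, b2, b3, b4⟩ := h.opd hE h2
    refine ⟨⟨a1, b1⟩, ?_, ?_⟩
    · simp only [Cnd.comp, Test.Holds, a2, b2]; rfl
    · simp only [Cnd.comp, Test.cost, Env.μ_add, Env.cs]; omega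

theorem Rep.setV {t : St} {s : Memory} (hE : E.Wf) (h : Rep E t s) (d : Var) {n : ℕ}
    (hn : n < 2 ^ E.w) : Rep E (t.setV d n) (s.write E.b d.idx n) where
  v x := by
    by_cases hx : x = d
    · simp [Memory.write, hx]
    · have : x.idx ≠ d.idx := fun h => hx (Var.idx_injective h)
      simp [Memory.write, hx, this, h.v]
  a k i hk := by
    have := d.idx_lt
    have h2 : ¬ (E.bank k = E.b ∧ k.addr i = d.idx) := fun ⟨h1, h2⟩ => by
      have := hE.sep k i hk h1; omega
    simp [Memory.write, h2, h.a k i hk]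
  vlt x := by
    by_cases hx : x = d
    · simp [hx, hn]
    · simp [hx, h.vlt]
  alt := h.alt

theorem Rep.tmp {t : St} {s : Memory} (hE : E.Wf) (h : Rep E t s) (n : ℕ) :
    Rep E t (s.write E.b 63 n) where
  v x := by
    have := x.idx_lt
    have : x.idx ≠ 63 := by omega
    simp [Memory.write, this, h.v]
  a k i hk := by
    have h2 : ¬ (E.bank k = E.b ∧ k.addr i = 63) := fun ⟨h1, h2⟩ => by
      have := hE.sep k i hk h1; omega
    simp [Memory.write, h2, h.a k i hk]
  vlt := h.vlt
  alt := h.alt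

theorem Rep.setA {t : St} {s : Memory} (hE : E.Wf) (h : Rep E t s) {k : Arr} {i n : ℕ}
    (hk : E.ok k i) (hn : n < 2 ^ E.w) :
    Rep E (t.setA k i n) (s.write (E.bank k) (k.addr i) n) where
  v x := by
    have := x.idx_lt
    have h2 : ¬ (E.b = E.bank k ∧ x.idx = k.addr i) := fun ⟨h1, h2⟩ => by
      have := hE.sep k i hk h1.symm; omega
    simp [Memory.write, h2, h.v]
  a k' i' hk' := by
    by_cases h1 : k' = k ∧ i' = i
    · obtain ⟨rfl, rfl⟩ := h1
      simp [Memory.write]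
    · have h2 : ¬ (E.bank k' = E.bank k ∧ k'.addr i' = k.addr i) := fun ⟨h2, h3⟩ =>
        h1 (hE.inj _ _ _ _ hk' hk h2 h3)
      simp only [Memory.write, h2, if_false, St.setA_a, h1, h.a k' i' hk']
  vlt := h.vlt
  alt k' i' hk' := by
    simp only [St.setA_a]
    split
    · exact hn
    · exact h.alt k' i' hk'

theorem exec_compAddr {t : St} {s : Memory} (hE : E.Wf) (h : Rep E t s) {k : Arr} {x : Opd}
    (hx : x.small = true) (hk : E.ok k (x.val t)) : ∃ c s', Exec E.M E.w (compAddr E.b k x) s c s' ∧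
      E.μ c ≤ 2 * (E.μ E.b.readCost + E.μ E.b.writeCost) ∧ Rep E t s' ∧
      s' E.b 63 = k.addr (x.val t) := by
  obtain ⟨a1, a2, a3, a4⟩ := h.opd hE hx
  have hadr : k.addr (x.val t) < 2 ^ E.w := (hE.arr _ _ hk).1
  have h63 : E.b.HasCell E.M E.w 63 := hE.cell 63 (by norm_num)
  have e1 := Exec.assign (M := E.M) (w := E.w) ⟨E.b, .direct 63⟩ .mul (x.comp E.b) (.const k.stride)
    s ⟨trivial, h63⟩ a1 trivial
  have hst : k.stride % 2 ^ E.w = k.stride :=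
    Nat.mod_eq_of_lt (lt_of_lt_of_le (by cases k <;> decide) hE.word)
  have hof : k.off % 2 ^ E.w = k.off :=
    Nat.mod_eq_of_lt (lt_of_lt_of_le (by cases k <;> decide) hE.word)
  have hm : x.val t * k.stride % 2 ^ E.w = x.val t * k.stride :=
    Nat.mod_eq_of_lt (lt_of_le_of_lt (Nat.le_add_right _ _) hadr)
  have e2 := Exec.assign (M := E.M) (w := E.w) ⟨E.b, .direct 63⟩ .add (.cell ⟨E.b, .direct 63⟩)
    (.const k.off) (s.write E.b 63 (x.val t * k.stride)) ⟨trivial, h63⟩ ⟨trivial, h63⟩ trivial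
  simp only [Addr.val, BinOp.eval, Operand.val_const, a2, hst, hm] at e1
  refine ⟨_, _, Exec.seq e1 e2, ?_, (h.tmp hE _).tmp hE _, ?_⟩
  · simp only [Env.μ_add, Operand.cost_const, Operand.cost_cell, Addr.cost, Env.μ_zero]; omega
  · simp only [Memory.write, Addr.val, Operand.val, BinOp.eval, hof, and_self, if_true]
    exact Nat.mod_eq_of_lt hadr

theorem bank_readCost_le (k : Arr) : E.μ (E.bank k).readCost + 7 * (E.μ E.b.readCost +
    E.μ E.b.writeCost) ≤ E.loadCost k := by
  unfold Env.bank Env.loadCost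
  split
  · simp [Env.cr, Env.cs, Bank.readCost, Env.μ]; omega
  · simp [Env.cs]; omega

theorem bank_writeCost_le (k : Arr) : E.μ (E.bank k).writeCost + 7 * (E.μ E.b.readCost +
    E.μ E.b.writeCost) ≤ E.storeCost k := by
  unfold Env.bank Env.storeCost
  split
  · simp [Env.cw, Env.cs, Bank.writeCost, Env.μ]; omega
  · simp [Env.cs]; omega

/-- The compiled program simulates the big-step semantics. -/
theorem Big.exec (hE : E.Wf) {p : Cmd} {t t' : St} {n : ℕ} (h : Big E p t n t')
    (hp : p.small = true) : ∀ s, Rep E t s → ∃ c s', Exec E.M E.w (p.comp E.b) s c s' ∧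
      E.μ c ≤ n ∧ Rep E t' s' := by
  have h63 : E.b.HasCell E.M E.w 63 := hE.cell 63 (by norm_num)
  have hvar : ∀ x : Var, E.b.HasCell E.M E.w x.idx := fun x =>
    hE.cell _ (by have := x.idx_lt; omega)
  have h0 : (0 : ℕ) % 2 ^ E.w = 0 := Nat.zero_mod _
  have h1 : (1 : ℕ) % 2 ^ E.w = 1 := Nat.mod_eq_of_lt (by have := hE.word; omega)
  induction h with
  | skip t => exact fun s hs => ⟨0, s, .skip s, by simp [Env.μ_zero], hs⟩
  | op d f x y t h =>
    intro s hs
    obtain ⟨h1, h2⟩ := Bool.and_eq_true_iff.1 hp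
    obtain ⟨a1, a2, a3, a4⟩ := hs.opd hE h1
    obtain ⟨b1, b2, b3, b4⟩ := hs.opd hE h2
    obtain ⟨e1, e2⟩ := eval_eq_opNat a3 b3 h
    have ex := Exec.assign (M := E.M) (w := E.w) ⟨E.b, .direct d.idx⟩ f _ _ s ⟨trivial, hvar d⟩ a1 b1
    simp only [a2, b2, e1, Addr.val] at ex
    refine ⟨_, _, ex, ?_, hs.setV hE d e2⟩
    simp only [Env.μ_add, Addr.cost, Env.μ_zero, Env.cs]; omega
  | load d k x t h =>
    intro s hs
    obtain ⟨c1, s1, e1, m1, r1, q1⟩ := exec_compAddr hE hs hp h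
    have ex := Exec.assign (M := E.M) (w := E.w) ⟨E.b, .direct d.idx⟩ .add (.cell (k.loc E.b))
      (.const 0) s1 ⟨trivial, hvar d⟩ ⟨h63, by
        simp only [Arr.loc, Addr.val, q1]; exact hE.arr k _ h⟩ trivial
    have hv : (Operand.cell (k.loc E.b)).val E.w s1 = t.a k (x.val t) := by
      simp only [Operand.val, Arr.loc, Addr.val, q1]; exact r1.a k _ h
    have hlt := r1.alt k _ h
    simp only [hv, BinOp.eval, Operand.val_const, Addr.val, h0, add_zero, Nat.mod_eq_of_lt hlt] at ex
    refine ⟨_, _, .seq e1 ex, ?_, r1.setV hE d hlt⟩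
    have := bank_readCost_le (E := E) k
    simp only [Env.μ_add, Operand.cost_const, Operand.cost_cell, Addr.cost, Env.μ_zero, Arr.loc] at *
    unfold Env.bank at this
    omega
  | store k x y t h =>
    intro s hs
    obtain ⟨hh1, hh2⟩ := Bool.and_eq_true_iff.1 hp
    obtain ⟨c1, s1, e1, m1, r1, q1⟩ := exec_compAddr hE hs hh1 h
    obtain ⟨b1, b2, b3, b4⟩ := r1.opd hE hh2
    have ex := Exec.assign (M := E.M) (w := E.w) (k.loc E.b) .add (y.comp E.b) (.const 0) s1 ⟨h63, by
        simp only [Arr.loc, Addr.val, q1]; exact hE.arr k _ h⟩ b1 trivial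
    have hv : (k.loc E.b).addr.val s1 = k.addr (x.val t) := by
      simp only [Arr.loc, Addr.val, q1]
    have hz : (Operand.const 0).val E.w s1 = 0 := h0
    simp only [hv, hz, BinOp.eval, b2, add_zero, Nat.mod_eq_of_lt b3] at ex
    refine ⟨_, _, .seq e1 ex, ?_, r1.setA hE h b3⟩
    have := bank_writeCost_le (E := E) k
    simp only [Env.μ_add, Operand.cost_const, Addr.cost, Env.μ_zero, Arr.loc] at *
    unfold Env.bank at this
    omega
  | seq _ _ ih1 ih2 =>
    intro s hs
    obtain ⟨hh1, hh2⟩ := Bool.and_eq_true_iff.1 hp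
    obtain ⟨c1, s1, e1, m1, r1⟩ := ih1 hh1 s hs
    obtain ⟨c2, s2, e2, m2, r2⟩ := ih2 hh2 s1 r1
    exact ⟨_, _, .seq e1 e2, by rw [Env.μ_add]; omega, r2⟩
  | iteTrue ht _ ih =>
    intro s hs
    obtain ⟨hh1, hh2⟩ := Bool.and_eq_true_iff.1 hp
    obtain ⟨hh2, hh3⟩ := Bool.and_eq_true_iff.1 hh2
    obtain ⟨a1, a2, a3⟩ := hs.cnd hE hh1
    obtain ⟨c1, s1, e1, m1, r1⟩ := ih hh2 s hs
    exact ⟨_, _, .iteTrue a1 (a2.2 ht) e1, by rw [Env.μ_add]; omega, r1⟩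
  | iteFalse ht _ ih =>
    intro s hs
    obtain ⟨hh1, hh2⟩ := Bool.and_eq_true_iff.1 hp
    obtain ⟨hh2, hh3⟩ := Bool.and_eq_true_iff.1 hh2
    obtain ⟨a1, a2, a3⟩ := hs.cnd hE hh1
    obtain ⟨c1, s1, e1, m1, r1⟩ := ih hh3 s hs
    exact ⟨_, _, .iteFalse a1 (fun h => ht (a2.1 h)) e1, by rw [Env.μ_add]; omega, r1⟩
  | @loopStop i hi p t ht =>
    intro s hs
    obtain ⟨hh1, hh2⟩ := Bool.and_eq_true_iff.1 hp
    obtain ⟨a1, a2, a3⟩ := hs.cnd hE (x := Cnd.lt (.var i) hi) (by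
      simpa [Cnd.small, Opd.small.eq_2] using hh1)
    exact ⟨_, _, .whileFalse a1 (fun h => ht (a2.1 h)), a3, hs⟩
  | @loopStep i hi p t t1 t2 n n' ht _ hw _ ih1 ih2 =>
    intro s hs
    obtain ⟨hh1, hh2⟩ := Bool.and_eq_true_iff.1 hp
    obtain ⟨a1, a2, a3⟩ := hs.cnd hE (x := Cnd.lt (.var i) hi) (by
      simpa [Cnd.small, Opd.small.eq_2] using hh1)
    obtain ⟨c1, s1, e1, m1, r1⟩ := ih1 hh2 s hs
    have ex := Exec.assign (M := E.M) (w := E.w) ⟨E.b, .direct i.idx⟩ .add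
      (.cell ⟨E.b, .direct i.idx⟩) (.const 1) s1 ⟨trivial, hvar i⟩ ⟨trivial, hvar i⟩ trivial
    simp only [BinOp.eval, Operand.val, Addr.val, h1, r1.v, Nat.mod_eq_of_lt hw] at ex
    obtain ⟨c2, s2, e2, m2, r2⟩ := ih2 hp _ (r1.setV hE i hw)
    refine ⟨_, _, .whileTrue a1 (a2.2 ht) (.seq e1 ex) e2, ?_, r2⟩
    simp only [Env.μ_add, Operand.cost_const, Operand.cost_cell, Addr.cost, Env.μ_zero] at *
    have : E.cs = 8 * (E.μ E.b.readCost + E.μ E.b.writeCost) := rfl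
    omega

end compile

/-! ### Program logic -/

def Cmd.modV : Cmd → Var → Bool
  | .skip, _ => false
  | .op d _ _ _, x => x = d
  | .load d _ _, x => x = d
  | .store _ _ _, _ => false
  | .seq p q, x => p.modV x || q.modV x
  | .ite _ p q, x => p.modV x || q.modV x
  | .loop i _ p, x => x = i || p.modV x

def Cmd.modA : Cmd → Arr → Bool
  | .skip, _ => false
  | .op _ _ _ _, _ => false
  | .load _ _ _, _ => false
  | .store k _ _, x => x = k
  | .seq p q, x => p.modA x || q.modA x
  | .ite _ p q, x => p.modA x || q.modA x
  | .loop _ _ p, x => p.modA x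

/-- The states agree on everything that the command `p` does not modify. -/
structure Agree (p : Cmd) (s t : St) : Prop where
  v : ∀ x, p.modV x = false → t.v x = s.v x
  a : ∀ k, p.modA k = false → t.a k = s.a k

/-- The frame rule. `modV` and `modA` are computed from the syntax, so in the specifications of
concrete commands the side condition that something is untouched holds by `rfl`. -/
theorem Big.agree {E : Env} {p : Cmd} {s t : St} {n : ℕ} (h : Big E p s n t) : Agree p s t := by
  induction h with
  | skip s => exact ⟨fun _ _ => rfl, fun _ _ => rfl⟩
  | op d f x y s h =>
    exact ⟨fun z hz => by simp [Cmd.modV] at hz; simp [hz], fun _ _ => rfl⟩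
  | load d k x s h =>
    exact ⟨fun z hz => by simp [Cmd.modV] at hz; simp [hz], fun _ _ => rfl⟩
  | store k x y s h =>
    exact ⟨fun _ _ => rfl, fun z hz => by simp [Cmd.modA] at hz; ext i; simp [hz]⟩
  | seq _ _ ih1 ih2 =>
    constructor
    · intro z hz
      simp only [Cmd.modV, Bool.or_eq_false_iff] at hz
      rw [ih2.v z hz.2, ih1.v z hz.1]
    · intro z hz
      simp only [Cmd.modA, Bool.or_eq_false_iff] at hz
      rw [ih2.a z hz.2, ih1.a z hz.1]
  | iteTrue _ _ ih =>
    constructor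
    · intro z hz
      simp only [Cmd.modV, Bool.or_eq_false_iff] at hz
      exact ih.v z hz.1
    · intro z hz
      simp only [Cmd.modA, Bool.or_eq_false_iff] at hz
      exact ih.a z hz.1
  | iteFalse _ _ ih =>
    constructor
    · intro z hz
      simp only [Cmd.modV, Bool.or_eq_false_iff] at hz
      exact ih.v z hz.2
    · intro z hz
      simp only [Cmd.modA, Bool.or_eq_false_iff] at hz
      exact ih.a z hz.2
  | loopStop _ => exact ⟨fun _ _ => rfl, fun _ _ => rfl⟩
  | loopStep _ _ _ _ ih1 ih2 =>
    constructor
    · intro z hz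
      rw [ih2.v z hz]
      simp only [Cmd.modV, Bool.or_eq_false_iff, decide_eq_false_iff_not] at hz
      rw [St.setV_v, if_neg hz.1, ih1.v z hz.2]
    · intro z hz
      rw [ih2.a z hz]
      simp only [Cmd.modA] at hz
      exact ih1.a z hz

/-- `p` started in `s` halts with cost at most `N` in a state that satisfies `Q`. -/
def Tri (E : Env) (p : Cmd) (s : St) (N : ℕ) (Q : St → Prop) : Prop :=
  ∃ n t, Big E p s n t ∧ n ≤ N ∧ Q t

section logic
variable {E : Env}

theorem Tri.mono {p : Cmd} {s : St} {N N' : ℕ} {Q Q' : St → Prop} (h : Tri E p s N Q) (hN : N ≤ N')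
    (hQ : ∀ t, Agree p s t → Q t → Q' t) : Tri E p s N' Q' := by
  obtain ⟨n, t, hb, hn, hq⟩ := h
  exact ⟨n, t, hb, hn.trans hN, hQ t hb.agree hq⟩

theorem Tri.seq {p q : Cmd} {s : St} {N N' : ℕ} {Q Q' : St → Prop} (hp : Tri E p s N Q)
    (hq : ∀ t, Agree p s t → Q t → Tri E q t N' Q') : Tri E (p ;; q) s (N + N') Q' := by
  obtain ⟨n, t, hb, hn, hQ⟩ := hp
  obtain ⟨n', t', hb', hn', hQ'⟩ := hq t hb.agree hQ
  exact ⟨_, t', hb.seq hb', Nat.add_le_add hn hn', hQ'⟩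

theorem Tri.ite {c : Cnd} {p q : Cmd} {s : St} {N : ℕ} {Q : St → Prop}
    (hp : c.holds s → Tri E p s N Q) (hq : ¬ c.holds s → Tri E q s N Q) :
    Tri E (.ite c p q) s (E.cs + N) Q := by
  by_cases h : c.holds s
  · obtain ⟨n, t, hb, hn, hQ⟩ := hp h
    exact ⟨_, t, .iteTrue h hb, by omega, hQ⟩
  · obtain ⟨n, t, hb, hn, hQ⟩ := hq h
    exact ⟨_, t, .iteFalse h hb, by omega, hQ⟩

/-- Static cost bound of a loop-free command. -/
def Cmd.scost (E : Env) : Cmd → ℕ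
  | .skip => 0
  | .op _ _ _ _ => E.cs
  | .load _ k _ => if k.large then E.cr else E.cs
  | .store k _ _ => if k.large then E.cw else E.cs
  | .seq p q => p.scost E + q.scost E
  | .ite _ p q => E.cs + (p.scost E + q.scost E)
  | .loop _ _ _ => 0

/-- Weakest precondition of a loop-free command. -/
def wp (E : Env) : Cmd → (St → Prop) → St → Prop
  | .skip, Q, s => Q s
  | .op d f x y, Q, s => opOk (2 ^ E.w) f (x.val s) (y.val s) ∧
      Q (s.setV d (opNat f (x.val s) (y.val s)))
  | .load d k x, Q, s => E.ok k (x.val s) ∧ Q (s.setV d (s.a k (x.val s)))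
  | .store k x y, Q, s => E.ok k (x.val s) ∧ Q (s.setA k (x.val s) (y.val s))
  | .seq p q, Q, s => wp E p (wp E q Q) s
  | .ite t p q, Q, s => (t.holds s → wp E p Q s) ∧ (¬ t.holds s → wp E q Q s)
  | .loop _ _ _, _, _ => False

theorem Tri.of_wp {p : Cmd} : ∀ {s : St} {Q : St → Prop}, wp E p Q s → Tri E p s (p.scost E) Q := by
  induction p with
  | skip => exact fun h => ⟨_, _, .skip _, le_rfl, h⟩
  | op d f x y => exact fun h => ⟨_, _, .op d f x y _ h.1, le_rfl, h.2⟩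
  | load d k x => exact fun h => ⟨_, _, .load d k x _ h.1, le_rfl, h.2⟩
  | store k x y => exact fun h => ⟨_, _, .store k x y _ h.1, le_rfl, h.2⟩
  | seq p q ih1 ih2 => exact fun h => (ih1 h).seq fun t _ ht => ih2 ht
  | ite t p q ih1 ih2 =>
    exact fun h => Tri.ite (fun ht => (ih1 (h.1 ht)).mono (by omega) fun _ _ h => h)
      (fun ht => (ih2 (h.2 ht)).mono (by omega) fun _ _ h => h)
  | loop i hi p _ => exact fun h => h.elim

/-- `for i := lo, …, hi - 1 do p` -/
def Cmd.for (i : Var) (lo hi : Opd) (p : Cmd) : Cmd := .op i .add lo (.lit 0) ;; .loop i hi p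

/-- The operand is not changed by the loop with counter `i` and body `p`. -/
def Opd.fixed (p : Cmd) (i : Var) : Opd → Bool
  | .lit _ => true
  | .var x => !(x = i) && !p.modV x

/-- The invariant is stated after the counter has been set, and the body may assume agreement with
the initial state on everything that the loop leaves alone. The cost is a sum because column `0` of
a rectangle is more expensive than the others. -/
theorem Tri.for {i : Var} {lo hi : Opd} {p : Cmd} {s : St} (Inv : ℕ → St → Prop) (N : ℕ → ℕ)
    (a b : ℕ) (ha : lo.val s = a) (hb : hi.val s = b) (haW : a < 2 ^ E.w) (hbW : b < 2 ^ E.w)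
    (hfix : hi.fixed p i = true) (hi' : p.modV i = false) (h0 : Inv a (s.setV i a))
    (hstep : ∀ k t, a ≤ k → k < b → t.v i = k → Agree (.for i lo hi p) s t → Inv k t →
      Tri E p t (N k) fun t' => Inv (k + 1) (t'.setV i (k + 1))) :
    Tri E (.for i lo hi p) s (∑ k ∈ Finset.Ico a b, (N k + 2 * E.cs) + 2 * E.cs) fun t =>
      Inv (max a b) t ∧ t.v i = max a b := by
  have hhi : ∀ t, Agree (.for i lo hi p) s t → hi.val t = b := by
    intro t ht
    cases hi with
    | lit c => exact hb
    | var x =>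
      simp only [Opd.fixed, Bool.and_eq_true, Bool.not_eq_true', decide_eq_false_iff_not] at hfix
      rw [← hb, Opd.val_var, Opd.val_var, ht.v x (by simp [Cmd.for, Cmd.modV, hfix])]
  -- Induction on the number `b - k` of remaining iterations. An empty range is allowed, which is
  -- why the final value is `max k b`.
  have key : ∀ d k t, a ≤ k → d = b - k → t.v i = k → Agree (.for i lo hi p) s t → Inv k t →
      Tri E (.loop i hi p) t (∑ k ∈ Finset.Ico k b, (N k + 2 * E.cs) + E.cs) fun t =>
        Inv (max k b) t ∧ t.v i = max k b := by
    intro d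
    induction d with
    | zero =>
      intro k t hk hd hti hag hinv
      have hkb : b ≤ k := by omega
      refine ⟨_, t, .loopStop (by rw [hti, hhi t hag]; omega), by omega, ?_⟩
      rw [max_eq_left hkb]
      exact ⟨hinv, hti⟩
    | succ d ih =>
      intro k t hk hd hti hag hinv
      have hkb : k < b := by omega
      obtain ⟨n, t', hbig, hn, hinv'⟩ := hstep k t hk hkb hti hag hinv
      have hti' : t'.v i = k := by rw [hbig.agree.v i hi', hti]
      have hag' : Agree (.for i lo hi p) s (t'.setV i (k + 1)) := by
        constructor
        · intro x hx
          have hx' := hx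
          simp only [Cmd.for, Cmd.modV, Bool.or_eq_false_iff, decide_eq_false_iff_not] at hx
          rw [St.setV_v, if_neg hx.1, hbig.agree.v x hx.2.2, hag.v x hx']
        · intro x hx
          have hx' := hx
          simp only [Cmd.for, Cmd.modA, Bool.or_eq_false_iff] at hx
          rw [St.setV_a, hbig.agree.a x hx.2, hag.a x hx']
      obtain ⟨n', t'', hbig', hn', hfin⟩ := ih (k + 1) _ (by omega) (by omega) (by simp) hag' hinv'
      have hmax : max k b = max (k + 1) b := by omega
      refine ⟨_, t'', .loopStep (by rw [hti, hhi t hag]; exact hkb) hbig (by omega) (by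
        rw [hti']; exact hbig'), ?_, by rw [hmax]; exact hfin⟩
      rw [Finset.sum_eq_sum_Ico_succ_bot hkb]
      omega
  have hag0 : Agree (.for i lo hi p) s (s.setV i a) := by
    constructor
    · intro x hx
      simp only [Cmd.for, Cmd.modV, Bool.or_eq_false_iff, decide_eq_false_iff_not] at hx
      rw [St.setV_v, if_neg hx.1]
    · intro x _; rfl
  obtain ⟨n, t, hbig, hn, hfin⟩ := key _ a _ le_rfl rfl (by simp) hag0 h0
  have h1 := Big.op (E := E) i .add lo (.lit 0) s (by simp [opOk, ha, haW])
  simp only [opNat, ha, Opd.val_lit, add_zero] at h1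
  exact ⟨_, t, h1.seq hbig, by omega, hfin⟩

/-- A loop whose iterations all have the same cost bound. -/
theorem Tri.for_const {i : Var} {lo hi : Opd} {p : Cmd} {s : St} (Inv : ℕ → St → Prop) (N : ℕ)
    (a b : ℕ) (ha : lo.val s = a) (hb : hi.val s = b) (haW : a < 2 ^ E.w) (hbW : b < 2 ^ E.w)
    (hfix : hi.fixed p i = true) (hi' : p.modV i = false) (h0 : Inv a (s.setV i a))
    (hstep : ∀ k t, a ≤ k → k < b → t.v i = k → Agree (.for i lo hi p) s t → Inv k t →
      Tri E p t N fun t' => Inv (k + 1) (t'.setV i (k + 1))) :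
    Tri E (.for i lo hi p) s ((b - a) * (N + 2 * E.cs) + 2 * E.cs) fun t =>
      Inv (max a b) t ∧ t.v i = max a b := by
  have := Tri.for (E := E) Inv (fun _ => N) a b ha hb haW hbW hfix hi' h0 hstep
  simpa using this

end logic
end AsymDP

namespace AsymDP

/-! ## Dynamic programming in a band -/

/-- Values in a band of the grid with given values on the left and top boundary: horizontal and
vertical steps cost `g`, diagonal steps cost `e` unless the characters match. -/
def bandCell (g e : ℕ) (x y left top : ℕ → ℕ) : ℕ → ℕ → ℕ
  | 0, c => top c
  | r + 1, 0 => left (r + 1)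
  | r + 1, c + 1 =>
    min (min (bandCell g e x y left top r (c + 1) + g) (bandCell g e x y left top (r + 1) c + g))
      (bandCell g e x y left top r c + if x r = y c then 0 else e)

theorem mul_add_mod_lt {a b d : ℕ} (h : d < b) : (a * b + d) % b = d := by
  rw [Nat.mul_add_mod']; exact Nat.mod_eq_of_lt h

/-- Distance in the grid from the origin to `(i, j)`. -/
def gridDist (sg : ℕ) (x y : ℕ → ℕ) : ℕ → ℕ → ℕ := bandCell 1 sg x y id id

theorem gridDist_zero_left (sg : ℕ) (x y : ℕ → ℕ) (j : ℕ) : gridDist sg x y 0 j = j := by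
  simp [gridDist, bandCell]

theorem gridDist_zero_right (sg : ℕ) (x y : ℕ → ℕ) (i : ℕ) : gridDist sg x y i 0 = i := by
  cases i <;> simp [gridDist, bandCell]

theorem gridDist_succ (sg : ℕ) (x y : ℕ → ℕ) (i j : ℕ) : gridDist sg x y (i + 1) (j + 1) =
    min (min (gridDist sg x y i (j + 1) + 1) (gridDist sg x y (i + 1) j + 1))
      (gridDist sg x y i j + if x i = y j then 0 else sg) := by
  simp only [gridDist]
  rw [bandCell]

theorem gridDist_le (sg : ℕ) (x y : ℕ → ℕ) (i j : ℕ) : gridDist sg x y i j ≤ i + j := by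
  induction i with
  | zero => rw [gridDist_zero_left, Nat.zero_add]
  | succ i ih =>
    cases j with
    | zero => rw [gridDist_zero_right, Nat.add_zero]
    | succ j => rw [gridDist_succ]; omega

/-- A rectangle of the grid: the columns from `col` on, in bands of `B` rows and tiles of `B`
columns. -/
structure Rect where
  B : ℕ
  big : ℕ
  sg : ℕ
  col : ℕ
  x : ℕ → ℕ
  y : ℕ → ℕ

namespace Rect
variable (R : Rect)

def dist (i j : ℕ) : ℕ := gridDist R.sg R.x R.y i j

/-- Values on the left boundary. -/
def left (r : ℕ) : ℕ := R.dist r R.col * R.big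

/-- One band, with the given values on its top boundary. -/
def band (l : ℕ) (top : ℕ → ℕ) : ℕ → ℕ → ℕ :=
  bandCell R.big (R.sg * R.big) (fun r => R.x (l * R.B + r)) (fun c => R.y (R.col + c))
    (fun r => R.left (l * R.B + r)) top

/-- Values on the top boundary of band `l`.  They encode the distance and, modulo `big`, the sum of
the numbers of the tiles in which the chosen path crosses the lines up to this one. -/
def top : ℕ → ℕ → ℕ
  | 0, c => (R.col + c) * R.big + c / R.B
  | l + 1, c => R.band l (top l) R.B c + c / R.B

def cell (l r c : ℕ) : ℕ := R.band l (R.top l) r c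

/-- The tile count encoded in a value. -/
def phi (v : ℕ) : ℕ := v % R.big

theorem cell_zero (l c : ℕ) : R.cell l 0 c = R.top l c := by simp [cell, band, bandCell]

theorem cell_left (l r : ℕ) : R.cell l (r + 1) 0 = R.left (l * R.B + (r + 1)) := by
  simp [cell, band, bandCell]

theorem cell_succ (l r c : ℕ) : R.cell l (r + 1) (c + 1) =
    min (min (R.cell l r (c + 1) + R.big) (R.cell l (r + 1) c + R.big))
      (R.cell l r c + if R.x (l * R.B + r) = R.y (R.col + c) then 0 else R.sg * R.big) := by
  simp only [cell, band]
  rw [bandCell]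

theorem top_zero (c : ℕ) : R.top 0 c = (R.col + c) * R.big + c / R.B := by rw [top]

theorem top_succ (l c : ℕ) : R.top (l + 1) c = R.cell l R.B c + c / R.B := by rw [top, cell]

/-- Multiplied by `big`, the recursion for grid distances is the recursion for cells. A step into
column `c` comes from a column at most `c`, where the allowed excess `(l + 1) * (c / B)` is no
larger, so the excess survives the minimum. The excess vanishes on the left boundary. -/
theorem cell_bounds_of_top (l : ℕ)
    (h : ∀ c, R.dist (l * R.B) (R.col + c) * R.big ≤ R.top l c ∧
      R.top l c ≤ R.dist (l * R.B) (R.col + c) * R.big + (l + 1) * (c / R.B)) (r c : ℕ) :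
    R.dist (l * R.B + r) (R.col + c) * R.big ≤ R.cell l r c ∧
      R.cell l r c ≤ R.dist (l * R.B + r) (R.col + c) * R.big + (l + 1) * (c / R.B) := by
  induction r generalizing c with
  | zero => rw [cell_zero]; exact h c
  | succ r ihr =>
    induction c with
    | zero => rw [cell_left, left, add_zero]; omega
    | succ c ihc =>
      rw [cell_succ]
      have e : R.dist (l * R.B + (r + 1)) (R.col + (c + 1)) * R.big =
          min (min (R.dist (l * R.B + r) (R.col + (c + 1)) * R.big + R.big)
            (R.dist (l * R.B + (r + 1)) (R.col + c) * R.big + R.big))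
            (R.dist (l * R.B + r) (R.col + c) * R.big +
              if R.x (l * R.B + r) = R.y (R.col + c) then 0 else R.sg * R.big) := by
        simp only [dist]
        rw [← Nat.add_assoc, ← Nat.add_assoc R.col, gridDist_succ, min_mul_of_nonneg _ _ (Nat.zero_le _),
          min_mul_of_nonneg _ _ (Nat.zero_le _)]
        simp only [Nat.add_mul, Nat.one_mul, ite_mul, Nat.zero_mul]
      have h1 := ihr (c + 1)
      have h2 := ihr c
      have hm : (l + 1) * (c / R.B) ≤ (l + 1) * ((c + 1) / R.B) :=
        Nat.mul_le_mul_left _ (Nat.div_le_div_right (Nat.le_succ c))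
      rw [e]
      omega

theorem top_bounds (l c : ℕ) : R.dist (l * R.B) (R.col + c) * R.big ≤ R.top l c ∧
      R.top l c ≤ R.dist (l * R.B) (R.col + c) * R.big + (l + 1) * (c / R.B) := by
  induction l generalizing c with
  | zero => simp [top_zero, dist, gridDist_zero_left]
  | succ l ih =>
    have := R.cell_bounds_of_top l ih R.B c
    rw [top_succ, Nat.succ_mul l R.B, Nat.succ_mul (l + 1)]
    generalize c / R.B = q at *
    omega

theorem cell_bounds (l r c : ℕ) : R.dist (l * R.B + r) (R.col + c) * R.big ≤ R.cell l r c ∧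
      R.cell l r c ≤ R.dist (l * R.B + r) (R.col + c) * R.big + (l + 1) * (c / R.B) :=
  R.cell_bounds_of_top l (R.top_bounds l) r c

/-- The width `kt` and the number `nb` of bands for which `big` is large enough. -/
structure Fits (kt nb : ℕ) : Prop where
  pos : 0 < R.B
  lt : (nb + 1) * (kt / R.B) < R.big

variable {R} {kt nb : ℕ}

/-- By `Fits.lt` the excess over `dist * big` stays below `big`, so it is the remainder and no carry
into the distance occurs. -/
theorem Fits.phi_cell (h : R.Fits kt nb) {l r c : ℕ} (hl : l ≤ nb) (hc : c ≤ kt) :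
    R.cell l r c = R.dist (l * R.B + r) (R.col + c) * R.big + R.phi (R.cell l r c) ∧
      R.phi (R.cell l r c) ≤ (l + 1) * (c / R.B) := by
  have h1 := R.cell_bounds l r c
  have h2 : (l + 1) * (c / R.B) ≤ (nb + 1) * (kt / R.B) :=
    Nat.mul_le_mul (by omega) (Nat.div_le_div_right hc)
  have h3 := h.lt
  obtain ⟨d, hd⟩ := Nat.exists_eq_add_of_le h1.1
  have : R.phi (R.cell l r c) = d := by
    rw [phi, hd, mul_add_mod_lt (by omega)]
  omega

theorem Fits.phi_lt (h : R.Fits kt nb) (v : ℕ) : R.phi v < R.big := Nat.mod_lt _ (by have := h.lt; omega)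

theorem Fits.phi_top_succ (h : R.Fits kt nb) {l c : ℕ} (hl : l + 1 ≤ nb) (hc : c ≤ kt) :
    R.phi (R.top (l + 1) c) = R.phi (R.cell l R.B c) + c / R.B := by
  have h1 := (h.phi_cell (l := l) (r := R.B) (by omega) hc)
  have h2 : (l + 1 + 1) * (c / R.B) ≤ (nb + 1) * (kt / R.B) :=
    Nat.mul_le_mul (by omega) (Nat.div_le_div_right hc)
  have h3 := h.lt
  rw [Nat.succ_mul (l + 1)] at h2
  rw [top_succ]
  generalize c / R.B = q at *
  nth_rewrite 1 [h1.1]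
  rw [phi, Nat.add_assoc, mul_add_mod_lt (by omega)]

theorem Fits.phi_top_zero (h : R.Fits kt nb) {c : ℕ} (hc : c ≤ kt) :
    R.phi (R.top 0 c) = c / R.B := by
  have h2 : 1 * (c / R.B) ≤ (nb + 1) * (kt / R.B) :=
    Nat.mul_le_mul (by omega) (Nat.div_le_div_right hc)
  have h3 := h.lt
  rw [top_zero]
  generalize c / R.B = q at *
  rw [phi, mul_add_mod_lt (by omega)]

theorem phi_left (l r : ℕ) : R.phi (R.cell l (r + 1) 0) = 0 := by
  rw [cell_left, left, phi, Nat.mul_mod_left]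

theorem phi_add_big (v : ℕ) : R.phi (v + R.big) = R.phi v := Nat.add_mod_right _ _

theorem phi_add_diag (v : ℕ) (p : Prop) [Decidable p] :
    R.phi (v + if p then 0 else R.sg * R.big) = R.phi v := by
  split
  · rfl
  · exact Nat.add_mul_mod_self_right _ _ _

/-- The value of a cell comes from a neighbouring cell with the same tile count. -/
theorem phi_cell_succ (l r c : ℕ) :
    R.phi (R.cell l (r + 1) (c + 1)) = R.phi (R.cell l r (c + 1)) ∨
    R.phi (R.cell l (r + 1) (c + 1)) = R.phi (R.cell l (r + 1) c) ∨
    R.phi (R.cell l (r + 1) (c + 1)) = R.phi (R.cell l r c) := by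
  rw [cell_succ]
  rcases min_choice (min (R.cell l r (c + 1) + R.big) (R.cell l (r + 1) c + R.big))
    (R.cell l r c + if R.x (l * R.B + r) = R.y (R.col + c) then 0 else R.sg * R.big) with h | h
  · rw [h]
    rcases min_choice (R.cell l r (c + 1) + R.big) (R.cell l (r + 1) c + R.big) with h | h <;>
      rw [h, phi_add_big] <;> simp
  · rw [h, phi_add_diag]; simp

/-- A local form of the fact that chosen paths do not cross. Each cell takes its count from the cell
above, to the left or diagonally, whichever attains the minimum. If a row is increasing, then in all
three cases the cell has at most the count above it, and with this the next row is increasing too.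
-/
theorem phi_band_mono {l : ℕ} (h : ∀ c, c < kt → R.phi (R.top l c) ≤ R.phi (R.top l (c + 1))) :
    ∀ r c, c < kt → R.phi (R.cell l r c) ≤ R.phi (R.cell l r (c + 1)) ∧
      ∀ c ≤ kt, R.phi (R.cell l (r + 1) c) ≤ R.phi (R.cell l r c) := by
  have down : ∀ r, (∀ c, c < kt → R.phi (R.cell l r c) ≤ R.phi (R.cell l r (c + 1))) →
      ∀ c ≤ kt, R.phi (R.cell l (r + 1) c) ≤ R.phi (R.cell l r c) := by
    intro r hr c
    induction c with
    | zero => intro _; rw [phi_left]; omega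
    | succ c ih =>
      intro hc
      have h1 := ih (by omega)
      have h2 := hr c (by omega)
      rcases R.phi_cell_succ l r c with h3 | h3 | h3 <;> omega
  have main : ∀ r, ∀ c, c < kt → R.phi (R.cell l r c) ≤ R.phi (R.cell l r (c + 1)) := by
    intro r
    induction r with
    | zero => simpa only [cell_zero] using h
    | succ r ih =>
      intro c hc
      have h1 := down r ih c (by omega)
      have h2 := ih c hc
      rcases R.phi_cell_succ l r c with h3 | h3 | h3 <;> omega
  exact fun r c hc => ⟨main r c hc, down r (main r)⟩

/-- On every line the tile count grows at least as fast as the tile number. -/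
theorem Fits.top_mono (h : R.Fits kt nb) {l : ℕ} (hl : l ≤ nb) {c c' : ℕ} (hcc : c ≤ c')
    (hc : c' ≤ kt) :
    R.phi (R.top l c) + (c' / R.B - c / R.B) ≤ R.phi (R.top l c') := by
  -- Induction on the line: monotonicity on line `l` makes the last row of the band monotone, and
  -- the summand `c / R.B` added at the crossing contributes the growth of the tile number.
  have step : ∀ l ≤ nb, ∀ c, c < kt →
      R.phi (R.top l c) + ((c + 1) / R.B - c / R.B) ≤ R.phi (R.top l (c + 1)) := by
    intro l
    induction l with
    | zero =>
      intro _ c hc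
      have : c / R.B ≤ (c + 1) / R.B := Nat.div_le_div_right (Nat.le_succ c)
      rw [h.phi_top_zero (by omega), h.phi_top_zero (by omega)]; omega
    | succ l ih =>
      intro hl c hc
      have : c / R.B ≤ (c + 1) / R.B := Nat.div_le_div_right (Nat.le_succ c)
      rw [h.phi_top_succ hl (by omega), h.phi_top_succ hl (by omega)]
      have := (R.phi_band_mono (l := l) (kt := kt)
        (fun c hc => by have := ih (by omega) c hc; omega) R.B c hc).1
      omega
  induction c', hcc using Nat.le_induction with
  | base => omega
  | succ c' hcc ih =>
    have h1 := ih (by omega)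
    have h2 := step l hl c' (by omega)
    have : c' / R.B ≤ (c' + 1) / R.B := Nat.div_le_div_right (Nat.le_succ c')
    have : c / R.B ≤ c' / R.B := Nat.div_le_div_right hcc
    omega

/-- Inside a band the tile count decreases downwards. -/
theorem Fits.phi_cell_le_top (h : R.Fits kt nb) {l : ℕ} (hl : l ≤ nb) (r : ℕ) {c : ℕ}
    (hc : c ≤ kt) : R.phi (R.cell l r c) ≤ R.phi (R.top l c) := by
  rcases Nat.eq_zero_or_pos kt with h0 | h0
  · have : c = 0 := by omega
    subst this
    cases r with
    | zero => rw [cell_zero]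
    | succ r => rw [phi_left]; omega
  induction r with
  | zero => rw [cell_zero]
  | succ r ih =>
    have := (R.phi_band_mono (l := l) (kt := kt)
      (fun c hc => by have := h.top_mono hl (Nat.le_add_right c 1) hc; omega) r 0 h0).2 c hc
    omega

/-! ### Tiles -/

variable (R kt) in
/-- Tile count at the first column of tile `t` of line `l`; one more entry at the end bounds all
tile counts. -/
def tab (l t : ℕ) : ℕ :=
  if t ≤ kt / R.B then R.phi (R.top l (t * R.B)) else R.phi (R.top l kt) + 1

theorem Fits.tab_lt_tab (h : R.Fits kt nb) {l t t' : ℕ} (hl : l ≤ nb) (ht : t < t')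
    (ht' : t' ≤ kt / R.B) : R.tab kt l t + (t' - t) ≤ R.tab kt l t' := by
  have hB := h.pos
  have h1 : t' * R.B ≤ kt := (Nat.le_div_iff_mul_le hB).1 ht'
  have := h.top_mono hl (Nat.mul_le_mul_right R.B ht.le) h1
  rw [Nat.mul_div_cancel _ hB, Nat.mul_div_cancel _ hB] at this
  rwa [tab, tab, if_pos (by omega), if_pos ht']

theorem Fits.tab_mono_succ (h : R.Fits kt nb) {l t : ℕ} (hl : l ≤ nb) (ht : t ≤ kt / R.B) :
    R.tab kt l t ≤ R.tab kt l (t + 1) := by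
  by_cases h1 : t + 1 ≤ kt / R.B
  · have := h.tab_lt_tab hl (Nat.lt_add_one t) h1; omega
  · have h2 : t * R.B ≤ kt := (Nat.le_div_iff_mul_le h.pos).1 ht
    have := h.top_mono hl h2 le_rfl
    rw [tab, tab, if_pos ht, if_neg h1]; omega

theorem Fits.le_tab (h : R.Fits kt nb) {l t : ℕ} (hl : l ≤ nb) (ht : t ≤ kt / R.B) :
    t ≤ R.tab kt l t := by
  rcases Nat.eq_zero_or_pos t with h0 | h0
  · omega
  · have := h.tab_lt_tab hl h0 ht; omega

theorem tab_zero_right (l : ℕ) : R.tab kt l 0 = 0 := by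
  rw [tab, if_pos (Nat.zero_le _), Nat.zero_mul]
  cases l with
  | zero =>
    rw [top_zero, add_zero, Nat.zero_div, add_zero, phi, Nat.mul_mod_left]
  | succ l =>
    rw [top_succ, Nat.zero_div, add_zero]
    cases hB : R.B with
    | zero =>
      rw [cell_zero]
      induction l with
      | zero => rw [top_zero, add_zero, Nat.zero_div, add_zero, phi, Nat.mul_mod_left]
      | succ l ih => rw [top_succ, Nat.zero_div, add_zero, hB, cell_zero, ih]
    | succ b => rw [phi_left]

theorem Fits.tab_zero_left (h : R.Fits kt nb) {t : ℕ} (ht : t ≤ kt / R.B + 1) :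
    R.tab kt 0 t = t := by
  rw [tab]
  split
  next h1 =>
    rw [h.phi_top_zero ((Nat.le_div_iff_mul_le h.pos).1 h1), Nat.mul_div_cancel _ h.pos]
  next h1 => rw [h.phi_top_zero le_rfl]; omega

/-- This bounds the number of counts for which a line has to be evaluated. -/
theorem Fits.tab_last (h : R.Fits kt nb) {l : ℕ} (hl : l ≤ nb) :
    R.tab kt l (kt / R.B + 1) ≤ (l + 1) * (kt / R.B) + 1 := by
  rw [tab, if_neg (by omega), ← cell_zero]
  have := (h.phi_cell (r := 0) hl le_rfl).2
  omega

variable (R kt) in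
/-- `q` is the tile in which paths with tile count `τ` cross line `l`. -/
structure IsTile (l τ q : ℕ) : Prop where
  le : q ≤ kt / R.B
  tab_le : R.tab kt l q ≤ τ
  lt_tab : ∀ u, q < u → u ≤ kt / R.B → τ < R.tab kt l u

theorem Fits.isTile_of_mem (h : R.Fits kt nb) {l t τ : ℕ} (hl : l ≤ nb) (ht : t ≤ kt / R.B)
    (h1 : R.tab kt l t ≤ τ) (h2 : τ < R.tab kt l (t + 1)) : R.IsTile kt l τ t := by
  refine ⟨ht, h1, fun u hu hu' => ?_⟩
  rcases Nat.lt_or_ge (t + 1) u with h3 | h3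
  · have := h.tab_lt_tab hl h3 hu'; omega
  · rwa [show u = t + 1 by omega]

theorem IsTile.unique {l τ q q' : ℕ} (h : R.IsTile kt l τ q) (h' : R.IsTile kt l τ q') :
    q = q' := by
  rcases Nat.lt_trichotomy q q' with h1 | h1 | h1
  · have := h.lt_tab _ h1 h'.le; have := h'.tab_le; omega
  · exact h1
  · have := h'.lt_tab _ h1 h.le; have := h.tab_le; omega

/-- The count of a column lies in the table interval of its own tile, as the count increases and
jumps at the start of the next tile. For the last tile the extra entry `phi + 1` at column `kt`
closes the interval. -/
theorem Fits.tab_div (h : R.Fits kt nb) {l c : ℕ} (hl : l ≤ nb) (hc : c ≤ kt) :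
    R.tab kt l (c / R.B) ≤ R.phi (R.top l c) ∧ R.phi (R.top l c) < R.tab kt l (c / R.B + 1) := by
  have hB := h.pos
  have ht : c / R.B ≤ kt / R.B := Nat.div_le_div_right hc
  constructor
  · have := h.top_mono hl (Nat.div_mul_le_self c R.B) hc
    rw [tab, if_pos ht]; omega
  · rw [tab]
    split
    next h1 =>
      have h2 : c ≤ (c / R.B + 1) * R.B := by
        have := Nat.lt_div_mul_add (a := c) hB
        rw [Nat.succ_mul]; omega
      have := h.top_mono hl h2 ((Nat.le_div_iff_mul_le hB).1 h1)
      rw [Nat.mul_div_cancel _ hB] at this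
      omega
    next h1 =>
      have := h.top_mono hl hc le_rfl
      omega

theorem Fits.isTile_div (h : R.Fits kt nb) {l c : ℕ} (hl : l ≤ nb) (hc : c ≤ kt) :
    R.IsTile kt l (R.phi (R.top l c)) (c / R.B) :=
  h.isTile_of_mem hl (Nat.div_le_div_right hc) (h.tab_div hl hc).1 (h.tab_div hl hc).2

/-- Left of tile `q` the tile counts are smaller. -/
theorem Fits.phi_lt_of_isTile (h : R.Fits kt nb) {l τ q : ℕ} (hl : l ≤ nb)
    (hq : R.IsTile kt l τ q) (r : ℕ) {c : ℕ} (hc : c < q * R.B) : R.phi (R.cell l r c) < τ := by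
  have h1 : q * R.B ≤ kt := (Nat.le_div_iff_mul_le h.pos).1 hq.le
  have h2 := h.phi_cell_le_top hl r (show c ≤ kt by omega)
  -- Between column `c` and the start of tile `q` the count on the line rises by `q - c / R.B ≥ 1`,
  -- which gives the strict inequality.
  have h3 := h.top_mono hl hc.le h1
  have h4 := hq.tab_le
  rw [tab, if_pos hq.le] at h4
  rw [Nat.mul_div_cancel _ h.pos] at h3
  have h5 : c / R.B < q := (Nat.div_lt_iff_lt_mul h.pos).2 hc
  omega

/-- Consecutive tiles of a path are not far apart in the wrong direction. -/
theorem Fits.tile_le_succ (h : R.Fits kt nb) {l τ q q' : ℕ} (hl : l + 1 ≤ nb)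
    (hq : R.IsTile kt (l + 1) τ q) (hq' : R.IsTile kt l (τ - q) q') : q' ≤ q + 1 := by
  rcases Nat.lt_or_ge q (kt / R.B) with h1 | h1
  · have h2 := hq.lt_tab (q + 1) (Nat.lt_add_one q) h1
    have h1' : q + 1 ≤ kt / R.B := h1
    have h3 : (q + 1) * R.B ≤ kt := (Nat.le_div_iff_mul_le h.pos).1 h1
    rw [tab, if_pos h1', h.phi_top_succ hl h3, Nat.mul_div_cancel _ h.pos] at h2
    have h4 := h.phi_cell_le_top (l := l) (by omega) R.B h3
    -- So far `τ < tab l (q + 1) + (q + 1)`, that is, `τ - q ≤ tab l (q + 1)`. A tile `q' > q + 1`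
    -- would have a strictly larger table entry, although that entry is at most `τ - q`.
    by_contra h5
    have h6 := h.tab_lt_tab (l := l) (by omega) (show q + 1 < q' by omega) hq'.le
    rw [tab, if_pos h1'] at h6
    have := hq'.tab_le
    omega
  · have := hq'.le; have := hq.le; omega

end Rect

/-! ### Partial columns -/

namespace Rect
variable {R : Rect} {kt nb : ℕ}

variable (R) in
/-- The values `F` bound those of column `c` of band `l` in rows `≤ n` from above, with equality
where the tile count satisfies `p`. -/
def Col (p : ℕ → Prop) (l n c : ℕ) (F : ℕ → ℕ) : Prop :=
  ∀ i ≤ n, R.cell l i c ≤ F i ∧ (p (R.phi (R.cell l i c)) → F i = R.cell l i c)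

/-- One step of the dynamic program preserves exactness on the paths with given tile count. -/
theorem step_exact (p : ℕ → Prop) {l r c u v d : ℕ} {inf : ℕ} (hinf : R.cell l (r + 1) (c + 1) ≤ inf)
    (hu : R.cell l r (c + 1) ≤ u ∧ (p (R.phi (R.cell l r (c + 1))) → u = R.cell l r (c + 1)))
    (hv : R.cell l (r + 1) c ≤ v ∧ (p (R.phi (R.cell l (r + 1) c)) → v = R.cell l (r + 1) c))
    (hd : R.cell l r c ≤ d ∧ (p (R.phi (R.cell l r c)) → d = R.cell l r c)) {z : ℕ}
    (hz : z = min inf (min (min (u + R.big) (v + R.big))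
      (d + if R.x (l * R.B + r) = R.y (R.col + c) then 0 else R.sg * R.big))) :
    R.cell l (r + 1) (c + 1) ≤ z ∧
      (p (R.phi (R.cell l (r + 1) (c + 1))) → z = R.cell l (r + 1) (c + 1)) := by
  have e := R.cell_succ l r c
  generalize hw : (if R.x (l * R.B + r) = R.y (R.col + c) then 0 else R.sg * R.big) = w at *
  refine ⟨by omega, fun hp => ?_⟩
  have hle : R.cell l (r + 1) (c + 1) ≤ z := by omega
  rcases min_choice (min (R.cell l r (c + 1) + R.big) (R.cell l (r + 1) c + R.big))
    (R.cell l r c + w) with h | h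
  · rcases min_choice (R.cell l r (c + 1) + R.big) (R.cell l (r + 1) c + R.big) with h' | h'
    · have : R.phi (R.cell l (r + 1) (c + 1)) = R.phi (R.cell l r (c + 1)) := by
        rw [e, h, h', phi_add_big]
      have := hu.2 (this ▸ hp)
      omega
    · have : R.phi (R.cell l (r + 1) (c + 1)) = R.phi (R.cell l (r + 1) c) := by
        rw [e, h, h', phi_add_big]
      have := hv.2 (this ▸ hp)
      omega
  · have : R.phi (R.cell l (r + 1) (c + 1)) = R.phi (R.cell l r c) := by
      rw [e, h, ← hw, phi_add_diag]
    have := hd.2 (this ▸ hp)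
    omega

end Rect
end AsymDP

namespace AsymDP

/-! ## Edit distance and longest common subsequences as grid distances -/

/-- Alignment cost of two lists. -/
def listDist (sg : ℕ) : List ℕ → List ℕ → ℕ
  | [], y => y.length
  | a :: x, [] => x.length + 1
  | a :: x, b :: y => min (min (listDist sg x (b :: y) + 1) (listDist sg (a :: x) y + 1))
      (listDist sg x y + if a = b then 0 else sg)
termination_by x y => x.length + y.length

theorem listDist_nil_right (sg : ℕ) (x : List ℕ) : listDist sg x [] = x.length := by
  cases x <;> simp [listDist]

theorem bandCell_congr {g e : ℕ} {x x' y y' left top : ℕ → ℕ} :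
    ∀ {r c : ℕ}, (∀ i < r, x i = x' i) → (∀ j < c, y j = y' j) →
      bandCell g e x y left top r c = bandCell g e x' y' left top r c := by
  intro r
  induction r with
  | zero => intro c _ _; simp [bandCell]
  | succ r ihr =>
    intro c
    induction c with
    | zero => intro _ _; simp [bandCell]
    | succ c ihc =>
      intro hx hy
      rw [bandCell, bandCell, ihr (fun i hi => hx i (by omega)) hy,
        ihc hx (fun j hj => hy j (by omega)),
        ihr (fun i hi => hx i (by omega)) (fun j hj => hy j (by omega)), hx r (by omega),
        hy c (by omega)]

/-- The grid recursion removes last characters and the recursion on lists removes first ones, hence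
the reversal. -/
theorem gridDist_eq_listDist (sg : ℕ) (x y : List ℕ) :
    gridDist sg (fun i => x.getD i 0) (fun i => y.getD i 0) x.length y.length =
      listDist sg x.reverse y.reverse := by
  induction x using List.reverseRecOn generalizing y with
  | nil => rw [List.length_nil, gridDist_zero_left]; simp [listDist]
  | append_singleton x a ihx =>
    induction y using List.reverseRecOn with
    | nil => rw [List.length_nil, gridDist_zero_right]; simp [listDist_nil_right]
    | append_singleton y b ihy =>
      have hx : ∀ i < x.length, (x ++ [a]).getD i 0 = x.getD i 0 := fun i hi => by
        simp [List.getD, List.getElem?_append_left hi]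
      have hy : ∀ i < y.length, (y ++ [b]).getD i 0 = y.getD i 0 := fun i hi => by
        simp [List.getD, List.getElem?_append_left hi]
      have hxa : (x ++ [a]).getD x.length 0 = a := by simp [List.getD]
      have hyb : (y ++ [b]).getD y.length 0 = b := by simp [List.getD]
      have h1 := ihx (y ++ [b])
      have h2 := ihx y
      rw [List.length_append, List.length_singleton] at ihy h1
      rw [List.length_append, List.length_append, List.length_singleton, List.length_singleton,
        gridDist_succ, List.reverse_append, List.reverse_append, hxa, hyb]
      simp only [gridDist] at h1 h2 ihy ⊢
      rw [bandCell_congr hx (fun _ _ => rfl), h1, bandCell_congr (fun _ _ => rfl) hy, ihy,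
        bandCell_congr hx hy, h2]
      simp [listDist]

/-! ### Edit distance -/

theorem listDist_le_cons_right (x y : List ℕ) (b : ℕ) :
    listDist 1 x (b :: y) ≤ listDist 1 x y + 1 := by
  cases x with
  | nil => simp [listDist]
  | cons a x => rw [listDist]; omega

theorem listDist_cons_left_le (x y : List ℕ) (a : ℕ) :
    listDist 1 (a :: x) y ≤ listDist 1 x y + 1 := by
  cases y with
  | nil => simp [listDist_nil_right]
  | cons b y => rw [listDist]; omega

theorem listDist_le_cons_left (x y : List ℕ) (c : ℕ) :
    listDist 1 x y ≤ listDist 1 (c :: x) y + 1 := by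
  induction y with
  | nil => simp [listDist_nil_right]; omega
  | cons b y ih =>
    have := listDist_le_cons_right x y b
    rw [listDist]; omega

theorem listDist_cons_le_cons (x y : List ℕ) (c d : ℕ) :
    listDist 1 (c :: x) y ≤ listDist 1 (d :: x) y + 1 := by
  induction y with
  | nil => simp [listDist_nil_right]
  | cons b y ih =>
    rw [listDist, listDist]
    split <;> split <;> omega

theorem listDist_cons_congr {x x' : List ℕ} (a : ℕ)
    (h : ∀ y, listDist 1 x y ≤ listDist 1 x' y + 1) (y : List ℕ) :
    listDist 1 (a :: x) y ≤ listDist 1 (a :: x') y + 1 := by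
  induction y with
  | nil => have := h []; simp [listDist_nil_right] at this ⊢; omega
  | cons b y ih =>
    have h1 := h (b :: y)
    have h2 := h y
    rw [listDist, listDist]; omega

/-- An edit at the head is covered by the preceding lemmas, and a common prefix is put in front with
`listDist_cons_congr`. This makes the alignment cost a lower bound for the number of operations,
although operations may be applied anywhere and repeatedly at one place. -/
theorem listDist_le_of_editStep {x x' : List ℕ} (h : EditStep x x') (y : List ℕ) :
    listDist 1 x y ≤ listDist 1 x' y + 1 := by
  cases h with
  | insert u c v =>
    induction u generalizing y with
    | nil => exact listDist_le_cons_left v y c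
    | cons a u ih => exact listDist_cons_congr a (fun y => ih y) y
  | delete u c v =>
    induction u generalizing y with
    | nil => exact listDist_cons_left_le v y c
    | cons a u ih => exact listDist_cons_congr a (fun y => ih y) y
  | substitute u c d v =>
    induction u generalizing y with
    | nil => exact listDist_cons_le_cons v y c d
    | cons a u ih => exact listDist_cons_congr a (fun y => ih y) y

theorem listDist_self (sg : ℕ) (x : List ℕ) : listDist sg x x = 0 := by
  induction x with
  | nil => simp [listDist]
  | cons a x ih => rw [listDist]; simp [ih]

theorem listDist_le_of_editSteps {k : ℕ} {x y : List ℕ} (h : EditSteps k x y) :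
    listDist 1 x y ≤ k := by
  induction h with
  | refl x => rw [listDist_self]
  | step h _ ih => exact (listDist_le_of_editStep h _).trans (Nat.succ_le_succ ih)

theorem _root_.EditStep.cons {x y : List ℕ} (h : EditStep x y) (a : ℕ) : EditStep (a :: x) (a :: y) := by
  cases h with
  | insert u c v => exact .insert (a :: u) c v
  | delete u c v => exact .delete (a :: u) c v
  | substitute u c d v => exact .substitute (a :: u) c d v

theorem _root_.EditSteps.cons {k : ℕ} {x y : List ℕ} (h : EditSteps k x y) (a : ℕ) :
    EditSteps k (a :: x) (a :: y) := by
  induction h with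
  | refl x => exact .refl _
  | step h _ ih => exact .step (h.cons a) ih

/-- An optimal alignment, read from left to right, is a sequence of edit operations, whichever
argument attains the minimum. -/
theorem editSteps_listDist (x y : List ℕ) : EditSteps (listDist 1 x y) x y := by
  induction x generalizing y with
  | nil =>
    induction y with
    | nil => simpa [listDist] using EditSteps.refl []
    | cons b y ih =>
      have := EditSteps.step (.insert [] b []) (ih.cons b)
      simpa [listDist] using this
  | cons a x ihx =>
    induction y with
    | nil =>
      have := EditSteps.step (.delete [] a x) (ihx [])
      simpa [listDist_nil_right] using this
    | cons b y ihy =>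
      have h1 := EditSteps.step (.delete [] a x) (ihx (b :: y))
      have h2 := EditSteps.step (.insert [] b (a :: x)) (ihy.cons b)
      rw [listDist]
      rcases min_choice (min (listDist 1 x (b :: y) + 1) (listDist 1 (a :: x) y + 1))
        (listDist 1 x y + if a = b then 0 else 1) with h | h
      · rw [h]
        rcases min_choice (listDist 1 x (b :: y) + 1) (listDist 1 (a :: x) y + 1) with h | h
        · rw [h]; exact h1
        · rw [h]; exact h2
      · rw [h]
        split
        next hab => subst hab; exact (ihx y).cons a
        next => exact EditSteps.step (.substitute [] a b x) ((ihx y).cons b)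

theorem _root_.EditStep.reverse {x y : List ℕ} (h : EditStep x y) : EditStep x.reverse y.reverse := by
  cases h with
  | insert u c v => simpa using EditStep.insert v.reverse c u.reverse
  | delete u c v => simpa using EditStep.delete v.reverse c u.reverse
  | substitute u c d v => simpa using EditStep.substitute v.reverse c d u.reverse

theorem _root_.EditSteps.reverse {k : ℕ} {x y : List ℕ} (h : EditSteps k x y) :
    EditSteps k x.reverse y.reverse := by
  induction h with
  | refl x => exact .refl _
  | step h _ ih => exact .step h.reverse ih

theorem editDistance_eq (x y : List ℕ) : editDistance x y =
    gridDist 1 (fun i => x.getD i 0) (fun i => y.getD i 0) x.length y.length := by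
  rw [gridDist_eq_listDist]
  have h := isLeast_editDistance x y
  apply le_antisymm
  · apply h.2
    have := (editSteps_listDist x.reverse y.reverse).reverse
    simpa using this
  · exact listDist_le_of_editSteps (EditSteps.reverse h.1)

/-! ### Longest common subsequences -/

theorem listDist_add_le {x y z : List ℕ} (hx : z.Sublist x) (hy : z.Sublist y) :
    listDist 2 x y + 2 * z.length ≤ x.length + y.length := by
  induction x generalizing y z with
  | nil => simp [listDist, List.sublist_nil.1 hx]
  | cons a x ihx =>
    induction y generalizing z with
    | nil => simp [listDist, List.sublist_nil.1 hy]
    | cons b y ihy =>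
      rw [listDist]
      cases hx with
      | cons _ hx => have := ihx hx hy; simp only [List.length_cons] at *; omega
      | @cons_cons z _ _ hx =>
        cases hy with
        | cons _ hy =>
          have := ihy (List.Sublist.cons_cons a hx) hy; simp only [List.length_cons] at *; omega
        | cons_cons _ hy => have := ihx hx hy; simp only [List.length_cons, if_true] at *; omega

theorem exists_sublist_listDist (x y : List ℕ) : ∃ z : List ℕ, z.Sublist x ∧ z.Sublist y ∧
    listDist 2 x y + 2 * z.length = x.length + y.length := by
  induction x generalizing y with
  | nil => exact ⟨[], by simp, by simp, by simp [listDist]⟩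
  | cons a x ihx =>
    induction y with
    | nil => exact ⟨[], by simp, by simp, by simp [listDist]⟩
    | cons b y ihy =>
      obtain ⟨z1, h1, h2, h3⟩ := ihx (b :: y)
      obtain ⟨z2, k1, k2, k3⟩ := ihy
      obtain ⟨z3, l1, l2, l3⟩ := ihx y
      simp only [List.length_cons] at *
      rw [listDist]
      rcases min_choice (min (listDist 2 x (b :: y) + 1) (listDist 2 (a :: x) y + 1))
        (listDist 2 x y + if a = b then 0 else 2) with h | h
      · rw [h]
        rcases min_choice (listDist 2 x (b :: y) + 1) (listDist 2 (a :: x) y + 1) with h | h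
        · rw [h]; exact ⟨z1, h1.cons a, h2, by omega⟩
        · rw [h]; exact ⟨z2, k1, k2.cons b, by omega⟩
      · rw [h]
        split
        next hab =>
          subst hab
          exact ⟨a :: z3, l1.cons_cons a, l2.cons_cons a, by simp only [List.length_cons]; omega⟩
        next => exact ⟨z3, l1.cons a, l2.cons b, by omega⟩

/-- With mismatches at cost 2 an alignment is paid for exactly by the characters that it leaves
unmatched. The matched ones form a common subsequence, and every common subsequence arises in this
way. -/
theorem gridDist_add_lcsLength (x y : List ℕ) :
    gridDist 2 (fun i => x.getD i 0) (fun i => y.getD i 0) x.length y.length +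
      2 * lcsLength x y = x.length + y.length := by
  rw [gridDist_eq_listDist]
  obtain ⟨⟨z, h1, h2, h3⟩, hmax⟩ := isGreatest_lcsLength x y
  obtain ⟨u, k1, k2, k3⟩ := exists_sublist_listDist x.reverse y.reverse
  have h4 := hmax ⟨u.reverse, by simpa using k1.reverse, by simpa using k2.reverse, rfl⟩
  have h5 := listDist_add_le h1.reverse h2.reverse
  simp only [List.length_reverse] at *
  omega

end AsymDP

namespace AsymDP
open Var Arr

/-! ## The program -/

/-- The parameters of a run. -/
structure Par where
  m : ℕ
  n : ℕ
  B : ℕ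
  nb : ℕ
  kk : ℕ
  sg : ℕ
  N0 : ℕ
  xb : ℕ
  yb : ℕ
  x : ℕ → ℕ
  y : ℕ → ℕ

namespace Par
variable (P : Par)

def big : ℕ := (P.nb + 1) * (P.kk + 1)

/-- A bound for all values of the dynamic program. -/
def inf : ℕ := (P.m + P.n + 1) * P.big

def rect (col : ℕ) : Rect := ⟨P.B, P.big, P.sg, col, P.x, P.y⟩

/-- Consistency of the parameters with each other and with the machine. -/
structure Ok (E : Env) : Prop where
  wf : E.Wf
  B_pos : 1 ≤ P.B
  nb_pos : 1 ≤ P.nb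
  kk_pos : 1 ≤ P.kk
  m_pos : 1 ≤ P.m
  n_pos : 1 ≤ P.n
  nb_le : P.nb ≤ P.B
  m_le : P.m ≤ P.nb * P.B
  lt_m : (P.nb - 1) * P.B < P.m
  sg_le : P.sg ≤ 2
  scratch : ∀ k : Arr, k.large = false → ∀ i ≤ P.B, E.ok k i
  okx : ∀ i < P.m, E.ok inp (P.xb + i)
  oky : ∀ i < P.n, E.ok inp (P.yb + i)
  okla : ∀ i ≤ P.m, E.ok la (P.N0 + i)
  okra : ∀ i ≤ P.m, E.ok ra (P.N0 + i)
  oktb : ∀ i < (P.nb + 1) * (P.kk + 2), E.ok tb (P.N0 + i)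
  w1 : P.N0 + P.m + (P.nb + 2) * (P.kk + 2) < 2 ^ E.w
  w2 : (P.m + P.n + P.B + 4) * P.big < 2 ^ E.w
  w3 : (P.kk + 2) * P.B + P.n + 2 < 2 ^ E.w
  w4 : P.xb + P.m + P.B < 2 ^ E.w
  w5 : P.yb + P.n + 2 < 2 ^ E.w
  w6 : (P.nb + 1) * P.B < 2 ^ E.w

/-- The global variables and the input have their values. -/
structure Glob (s : St) : Prop where
  vm : s.v vm = P.m
  vn : s.v vn = P.n
  vB : s.v vB = P.B
  vnb : s.v vnb = P.nb
  vkk : s.v vkk = P.kk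
  vK : s.v vK = P.kk * P.B
  vxb : s.v vxb = P.xb
  vyb : s.v vyb = P.yb
  vN0 : s.v vN0 = P.N0
  vbig : s.v vbig = P.big
  ve2 : s.v ve2 = P.sg * P.big
  vinf : s.v vinf = P.inf
  vst : s.v vst = P.kk + 2
  hx : ∀ i < P.m, s.a inp (P.xb + i) = P.x i
  hy : ∀ i < P.n, s.a inp (P.yb + i) = P.y i

end Par

/-- The command does not modify the global variables and the input. -/
def Cmd.keepsGlob (p : Cmd) : Bool :=
  [vm, vn, vB, vnb, vkk, vK, vxb, vyb, vN0, vbig, ve2, vinf, vst].all (fun x => !p.modV x) &&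
    !p.modA inp

/-- Bundled frame rule: for a concrete command the check `keepsGlob` is evaluated once, in place of
one check for each variable. -/
theorem Par.Glob.agree {P : Par} {s t : St} (h : P.Glob s) {p : Cmd} (hag : Agree p s t)
    (hp : p.keepsGlob = true) : P.Glob t := by
  simp only [Cmd.keepsGlob, List.all_cons, List.all_nil, Bool.and_eq_true, Bool.not_eq_true',
    Bool.and_true] at hp
  obtain ⟨⟨h1, h2, h3, h4, h5, h6, h7, h8, h9, h10, h11, h12, h13⟩, h14⟩ := hp
  constructor
  · rw [hag.v _ h1, h.vm]
  · rw [hag.v _ h2, h.vn]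
  · rw [hag.v _ h3, h.vB]
  · rw [hag.v _ h4, h.vnb]
  · rw [hag.v _ h5, h.vkk]
  · rw [hag.v _ h6, h.vK]
  · rw [hag.v _ h7, h.vxb]
  · rw [hag.v _ h8, h.vyb]
  · rw [hag.v _ h9, h.vN0]
  · rw [hag.v _ h10, h.vbig]
  · rw [hag.v _ h11, h.ve2]
  · rw [hag.v _ h12, h.vinf]
  · rw [hag.v _ h13, h.vst]
  · rw [hag.a _ h14]; exact h.hx
  · rw [hag.a _ h14]; exact h.hy

/-- The rectangle that is being processed. -/
structure RectSt (P : Par) (col kt : ℕ) (s : St) : Prop where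
  vcol : s.v vcol = col
  vkt : s.v vkt = kt
  vtl : s.v vtl = kt / P.B
  hla : ∀ r, 1 ≤ r → r ≤ P.m → s.a la (P.N0 + r) = (P.rect col).left r

def Cmd.keepsRect (p : Cmd) : Bool :=
  [vcol, vkt, vtl].all (fun x => !p.modV x) && !p.modA la

theorem RectSt.agree {P : Par} {col kt : ℕ} {s t : St} (h : RectSt P col kt s) {p : Cmd}
    (hag : Agree p s t) (hp : p.keepsRect = true) : RectSt P col kt t := by
  simp only [Cmd.keepsRect, List.all_cons, List.all_nil, Bool.and_eq_true, Bool.not_eq_true',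
    Bool.and_true] at hp
  obtain ⟨⟨h1, h2, h3⟩, h4⟩ := hp
  constructor
  · rw [hag.v _ h1, h.vcol]
  · rw [hag.v _ h2, h.vkt]
  · rw [hag.v _ h3, h.vtl]
  · rw [hag.a _ h4]; exact h.hla

/-! ### Derived commands -/

/-- `d := x` -/
def Cmd.mov (d : Var) (x : Opd) : Cmd := .op d .add x (.lit 0)

/-- `d := min d x` -/
def Cmd.setMin (d : Var) (x : Opd) : Cmd := .ite (.lt x d) (.op d .add x (.lit 0)) .skip

theorem Tri.cost {E : Env} {p : Cmd} {s : St} {N N' : ℕ} {Q : St → Prop} (h : Tri E p s N Q)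
    (hN : N ≤ N') : Tri E p s N' Q := h.mono hN fun _ _ h => h

theorem wp_mov {E : Env} {d : Var} {x : Opd} {Q : St → Prop} {s : St} :
    wp E (.mov d x) Q s ↔ x.val s < 2 ^ E.w ∧ Q (s.setV d (x.val s)) := by
  simp [Cmd.mov, wp, opOk, opNat]

theorem wp_setMin {E : Env} {d : Var} {x : Opd} {Q : St → Prop} {s : St} :
    wp E (.setMin d x) Q s ↔
      (x.val s < s.v d → x.val s < 2 ^ E.w) ∧ Q (s.setV d (min (s.v d) (x.val s))) := by
  simp only [Cmd.setMin, wp, opOk, opNat, Opd.val_lit, add_zero, Cnd.holds_lt, Opd.val_var]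
  by_cases h : x.val s < s.v d
  · simp [h, min_eq_right h.le]
  · have : s.setV d (s.v d) = s := by
      cases s
      simp only [St.setV, St.mk.injEq, and_true]
      funext y
      split
      · next h => rw [h]
      · rfl
    simp [h, min_eq_left (not_lt.1 h), this]

/-! ### One column of a band -/

/-- Update of one cell. -/
def rowStep (F X : Arr) : Cmd :=
  .load sold F si ;; .op t0 .sub si (.lit 1) ;; .load sx X t0 ;;
  .mov sw sdiag ;; .ite (.eq sx sy) .skip (.op sw .add sw ve2) ;;
  .op sp .add sold vbig ;; .setMin sw sp ;; .op sp .add sup vbig ;; .setMin sw sp ;;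
  .setMin sw vinf ;; .store F si sw ;; .mov sdiag sold ;; .mov sup sw

/-- Replace the column in `F` by the next one, or by the left boundary in column `0`. -/
def sweepCol (F X : Arr) : Cmd :=
  .op t1 .add snr (.lit 1) ;;
  .ite (.eq sc (.lit 0))
    (.store F (.lit 0) stp ;;
      .for si (.lit 1) t1
        (.op t0 .add vN0 sr ;; .op t0 .add t0 si ;; .load sold la t0 ;; .store F si sold))
    ((.op t0 .add vyb vcol ;; .op t0 .add t0 sc ;; .op t0 .sub t0 (.lit 1) ;; .load sy inp t0 ;;
        .load sdiag F (.lit 0) ;; .store F (.lit 0) stp ;; .mov sup stp) ;;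
      .for si (.lit 1) t1 (rowStep F X))

theorem setA_a_self (s : St) (k : Arr) (i z : ℕ) :
    (s.setA k i z).a k = Function.update (s.a k) i z := by
  ext i'
  simp [Function.update_apply]

/-- The column is updated in place. The overwritten entry is kept in `sdiag` as the diagonal
neighbour for the next row, and the new entry in `sup` as the upper neighbour. -/
theorem rowStep_spec {E : Env} {F X : Arr} (hF : F.large = false) (hX : X.large = false)
    {s : St} {i up diag big e2 inf : ℕ} (hi : s.v si = i) (hi1 : 1 ≤ i) (hu : s.v sup = up)
    (hd : s.v sdiag = diag) (hb : s.v vbig = big) (he : s.v ve2 = e2) (hf : s.v vinf = inf)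
    (okF : E.ok F i) (okX : E.ok X (i - 1)) (w1 : diag + e2 < 2 ^ E.w)
    (w2 : s.a F i + big < 2 ^ E.w) (w3 : up + big < 2 ^ E.w) (w4 : inf < 2 ^ E.w) {z : ℕ}
    (hz : z = min inf (min (min (up + big) (s.a F i + big))
      (diag + if s.a X (i - 1) = s.v sy then 0 else e2))) :
    Tri E (rowStep F X) s (20 * E.cs) fun t =>
      t.a F = Function.update (s.a F) i z ∧ t.v sdiag = s.a F i ∧ t.v sup = z := by
  have h : wp E (rowStep F X) (fun t => t.a F = Function.update (s.a F) i z ∧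
      t.v sdiag = s.a F i ∧ t.v sup = z) s := by
    simp only [rowStep, wp, wp_mov, wp_setMin, Opd.val_var, Opd.val_lit, St.setV_v, St.setV_a,
      St.setA_v, reduceCtorEq, if_true, if_false, hi, hu, hd, hb, he, hf, opOk, opNat, Cnd.holds_eq,
      setA_a_self]
    refine ⟨okF, hi1, okX, by omega, ?_⟩
    constructor <;> intro h1
    · rw [if_pos h1] at hz
      have hz' : z = min (min (min diag (s.a F i + big)) (up + big)) inf := by omega
      rw [← hz']
      exact ⟨w2, by omega, w3, by omega, by omega, okF, by omega, by omega, rfl, trivial, rfl⟩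
    · rw [if_neg h1] at hz
      have hz' : z = min (min (min (diag + e2) (s.a F i + big)) (up + big)) inf := by omega
      rw [← hz']
      exact ⟨by omega, w2, by omega, w3, by omega, by omega, okF, by omega, by omega, rfl, trivial, rfl⟩
  refine (Tri.of_wp h).mono ?_ fun _ _ h => h
  simp only [rowStep, Cmd.scost, Cmd.mov, Cmd.setMin, hF, hX, Bool.false_eq_true, if_false]
  omega

/-- The next column of the dynamic program with all values capped by `inf`. -/
def nextCol (big e2 inf : ℕ) (x : ℕ → ℕ) (y tp : ℕ) (F : ℕ → ℕ) : ℕ → ℕ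
  | 0 => tp
  | i + 1 => min inf (min (min (nextCol big e2 inf x y tp F i + big) (F (i + 1) + big))
      (F i + if x i = y then 0 else e2))

/-- The column buffers. -/
inductive SweepArr : Arr → Arr → Prop
  | one : SweepArr F1 X1
  | two : SweepArr F2 X2

namespace Par
variable {P : Par} {E : Env}

/-- The distance is at most `m + n` and the count is below `big`. So `inf` may stand for any unknown
value, and capping by `inf` changes no true value while it keeps the upper bounds from overflowing a
word. -/
theorem cell_le {col kt : ℕ} (hk : col + kt ≤ P.n) (hf : (P.rect col).Fits kt P.nb)
    {l r c : ℕ} (hl : l ≤ P.nb) (hr : l * P.B + r ≤ P.m) (hc : c ≤ kt) :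
    (P.rect col).cell l r c ≤ P.inf := by
  have h1 := (hf.phi_cell (r := r) hl hc).1
  have h2 := hf.phi_lt ((P.rect col).cell l r c)
  have h3 : (P.rect col).dist (l * P.B + r) (col + c) ≤ P.m + P.n :=
    (gridDist_le _ _ _ _ _).trans (by omega)
  have h4 := Nat.mul_le_mul_right P.big h3
  rw [h1]
  change (P.rect col).phi _ < P.big at h2
  change (P.rect col).dist (l * P.B + r) (col + c) * P.big + _ ≤ (P.m + P.n + 1) * P.big
  rw [Nat.succ_mul]
  omega

end Par

/-- The state in which column `c` of band `l` can be computed from the column before. -/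
structure SweepPre (P : Par) (col kt : ℕ) (F X : Arr) (p : ℕ → Prop) (l nr c : ℕ) (s : St) :
    Prop where
  glob : P.Glob s
  rect : RectSt P col kt s
  vsc : s.v sc = c
  vsnr : s.v snr = nr
  vsr : s.v sr = l * P.B
  hX : ∀ i < nr, s.a X i = P.x (l * P.B + i)
  tp_le : s.v stp ≤ P.inf + P.big
  le_tp : (P.rect col).top l c ≤ s.v stp
  tp_eq : p ((P.rect col).phi ((P.rect col).top l c)) → s.v stp = (P.rect col).top l c
  hF : 0 < c → (P.rect col).Col p l nr (c - 1) (s.a F) ∧ ∀ i ≤ nr, s.a F i ≤ P.inf + P.big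

/-- Column `0` is copied from the left boundary in large memory, one read per row. Any other column
needs a single read of large memory, for its character of the second string. -/
def sweepCost (E : Env) (nr c : ℕ) : ℕ :=
  (nr + 1) * (30 * E.cs) + E.cr + if c = 0 then nr * E.cr else 0

/-- The predicate `p` on counts serves both uses: it is always true in the exact sweep of a band,
and it is equality with one count in the evaluation of a corridor. -/
theorem sweepCol_spec {E : Env} {P : Par} (hP : P.Ok E) {col kt : ℕ} (hk : col + kt ≤ P.n)
    (hf : (P.rect col).Fits kt P.nb) {F X : Arr} (hFX : SweepArr F X) {p : ℕ → Prop} {l nr c : ℕ}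
    (hl : l ≤ P.nb) (hnr : nr ≤ P.B) (hm : l * P.B + nr ≤ P.m) (hc : c ≤ kt) {s : St}
    (hs : SweepPre P col kt F X p l nr c s) :
    Tri E (sweepCol F X) s (sweepCost E nr c) fun t =>
      (P.rect col).Col p l nr c (t.a F) ∧ (∀ i ≤ nr, t.a F i ≤ P.inf + P.big) ∧
        ∀ i ≤ nr, 1 ≤ i → t.a F i ≤ P.inf := by
  have hFl : F.large = false := by cases hFX <;> rfl
  have hXl : X.large = false := by cases hFX <;> rfl
  have hFX' : X ≠ F := by cases hFX <;> decide
  have hla : la ≠ F := by cases hFX <;> decide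
  have hinp : inp ≠ F := by cases hFX <;> decide
  have okF : ∀ i ≤ P.B, E.ok F i := hP.scratch F hFl
  have okX : ∀ i ≤ P.B, E.ok X i := hP.scratch X hXl
  have hw1 := hP.w1
  have hw2 := hP.w2
  have hw5 := hP.w5
  have hw4 := hP.w4
  have hbig : 1 ≤ P.big := Nat.mul_pos (by omega) (by omega)
  have hinf : P.inf + 3 * P.big < 2 ^ E.w := by
    refine lt_of_le_of_lt ?_ hw2
    rw [Par.inf, ← Nat.add_mul]; exact Nat.mul_le_mul_right _ (by omega)
  have hmw : P.m + P.n + P.B + 4 < 2 ^ E.w :=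
    lt_of_le_of_lt (Nat.le_mul_of_pos_right _ hbig) hw2
  have hsg := Nat.mul_le_mul_right P.big hP.sg_le
  unfold sweepCol
  rw [show sweepCost E nr c = E.cs + (sweepCost E nr c - E.cs) by
    unfold sweepCost; rw [Nat.succ_mul]; omega]
  refine Tri.seq (Q := fun t => t = s.setV t1 (nr + 1)) (Tri.of_wp ?_) ?_
  · simp only [wp, opOk, opNat, Opd.val_var, Opd.val_lit, hs.vsnr]
    exact ⟨by omega, trivial⟩
  rintro s1 - rfl
  rw [show sweepCost E nr c - E.cs = E.cs + (sweepCost E nr c - 2 * E.cs) by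
    unfold sweepCost; rw [Nat.succ_mul]; omega]
  refine Tri.ite (fun h0 => ?_) (fun h0 => ?_)
  · replace h0 : c = 0 := by rw [← hs.vsc]; exact h0
    subst h0
    refine Tri.mono (N := E.cs + ((nr + 1 - 1) * ((3 * E.cs + E.cr) + 2 * E.cs) + 2 * E.cs))
      (Tri.seq (Q := fun t => t = (s.setV t1 (nr + 1)).setA F 0 (s.v stp)) ?_ ?_)
      (N' := sweepCost E nr 0 - 2 * E.cs)
      (Q := fun t => ∀ i ≤ nr, t.a F i = if i = 0 then s.v stp else (P.rect col).left (l * P.B + i))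
      ?_ ?_
    · refine (Tri.of_wp ?_).mono ?_ fun _ _ h => h
      · simp only [wp, Opd.val_var, Opd.val_lit]
        exact ⟨okF 0 (by omega), rfl⟩
      · simp only [Cmd.scost, hFl, Bool.false_eq_true, if_false]; exact le_rfl
    · rintro s2 - rfl
      refine Tri.mono (Tri.for_const (Inv := fun k t => ∀ i < k, t.a F i = if i = 0 then s.v stp
        else (P.rect col).left (l * P.B + i)) (3 * E.cs + E.cr) 1 (nr + 1) rfl (by simp) ?_ ?_ ?_ ?_ ?_ ?_)
        le_rfl (fun t _ h => ?_)
      · omega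
      · omega
      · cases hFX <;> rfl
      · cases hFX <;> rfl
      · intro i hi
        obtain rfl : i = 0 := by omega
        simp
      · intro k t h1 h2 hk hag hinv
        have g1 : t.v vN0 = P.N0 := by
          rw [hag.v _ (by cases hFX <;> rfl), ← hs.glob.vN0]; rfl
        have g2 : t.v sr = l * P.B := by
          rw [hag.v _ (by cases hFX <;> rfl), ← hs.vsr]; rfl
        have g3 : t.a la (P.N0 + l * P.B + k) = (P.rect col).left (l * P.B + k) := by
          rw [hag.a _ (by cases hFX <;> rfl), ← hs.rect.hla _ (by omega) (by omega)]
          simp [hla, add_assoc]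
        refine (Tri.of_wp ?_).mono ?_ fun _ _ h => h
        · simp only [wp, opOk, opNat, Opd.val_var, St.setV_v, St.setV_a, reduceCtorEq,
            if_true, if_false, hk, g1, g2, g3, setA_a_self]
          have hokla := hP.okla (l * P.B + k) (by omega)
          rw [← add_assoc] at hokla
          refine ⟨by omega, by omega, hokla, okF k (by omega), fun i hi => ?_⟩
          rw [Function.update_apply]
          by_cases hik : i = k
          · rw [if_pos hik, hik, if_neg (by omega)]
          · rw [if_neg hik]; exact hinv i (by omega)
        · simp only [Cmd.scost, hFl, Bool.false_eq_true, if_false]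
          rw [if_pos (by rfl)]; omega
      · intro i hi
        exact h.1 i (by omega)
    · simp only [sweepCost, if_true, Env.cr]
      rw [Nat.add_sub_cancel]
      have : nr * (3 * E.cs + (E.cs + E.wR) + 2 * E.cs) = nr * (E.cs + E.wR) + 5 * (nr * E.cs) := by
        ring
      rw [this]
      have : (nr + 1) * (30 * E.cs) = 30 * (nr * E.cs) + 30 * E.cs := by ring
      omega
    · intro t _ ht
      constructor
      · intro i hi
        rw [ht i hi]
        rcases Nat.eq_zero_or_pos i with h0 | h0
        · subst h0
          rw [if_pos rfl, Rect.cell_zero]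
          exact ⟨hs.le_tp, hs.tp_eq⟩
        · obtain ⟨j, rfl⟩ : ∃ j, i = j + 1 := ⟨i - 1, by omega⟩
          rw [if_neg (by omega), Rect.cell_left]
          exact ⟨le_rfl, fun _ => rfl⟩
      · have hle : ∀ i ≤ nr, 1 ≤ i → t.a F i ≤ P.inf := by
          intro i hi h0
          obtain ⟨j, rfl⟩ : ∃ j, i = j + 1 := ⟨i - 1, by omega⟩
          have := Par.cell_le hk hf (l := l) (r := j + 1) (c := 0) hl (by omega) (by omega)
          rw [ht _ hi, if_neg (by omega)]
          rwa [Rect.cell_left] at this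
        refine ⟨fun i hi => ?_, hle⟩
        rcases Nat.eq_zero_or_pos i with h0 | h0
        · rw [ht i hi, if_pos h0]
          exact hs.tp_le
        · exact (hle i hi h0).trans (Nat.le_add_right _ _)
  · replace h0 : c ≠ 0 := by rw [← hs.vsc]; exact h0
    obtain ⟨hcol, hle⟩ := hs.hF (by omega)
    set G := nextCol P.big (P.sg * P.big) P.inf (fun i => P.x (l * P.B + i)) (P.y (col + (c - 1)))
      (s.v stp) (s.a F) with hG
    -- Only row `0` can exceed `inf`: it holds a value on a line, to which a tile number has been
    -- added after capping.
    have hGle : ∀ i, G i ≤ P.inf + P.big := by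
      intro i
      cases i with
      | zero => exact hs.tp_le
      | succ i => exact (min_le_left _ _).trans (Nat.le_add_right _ _)
    refine Tri.mono (N := (6 * E.cs + E.cr) + ((nr + 1 - 1) * ((20 * E.cs) + 2 * E.cs) + 2 * E.cs))
      (Tri.seq (Q := fun t => P.Glob t ∧ t.v sy = P.y (col + (c - 1)) ∧ t.v sdiag = s.a F 0 ∧
        t.v sup = s.v stp ∧ t.v t1 = nr + 1 ∧ t.a F = Function.update (s.a F) 0 (s.v stp) ∧
        t.a X = s.a X) ?_ ?_)
      (N' := sweepCost E nr c - 2 * E.cs)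
      (Q := fun t => ∀ i ≤ nr, t.a F i = G i)
      ?_ ?_
    · refine ((Tri.of_wp (Q := fun t => t.v sy = P.y (col + (c - 1)) ∧ t.v sdiag = s.a F 0 ∧
        t.v sup = s.v stp ∧ t.a F = Function.update (s.a F) 0 (s.v stp)) ?_).mono ?_
        fun t hag h => ⟨?_, h.1, h.2.1, h.2.2.1, ?_, h.2.2.2, ?_⟩)
      · simp only [wp, wp_mov, opOk, opNat, Opd.val_var, Opd.val_lit, St.setV_v, St.setV_a,
          St.setA_v, reduceCtorEq, if_true, if_false, hs.glob.vyb, hs.rect.vcol, hs.vsc, setA_a_self]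
        have e1 : P.yb + col + c - 1 = P.yb + (col + (c - 1)) := by omega
        have e2 := hP.oky (col + (c - 1)) (by omega)
        have e3 := hs.glob.hy (col + (c - 1)) (by omega)
        rw [e1]
        have := hs.tp_le
        exact ⟨by omega, by omega, by omega, e2, okF 0 (by omega), okF 0 (by omega), by omega, e3,
          trivial, trivial, trivial⟩
      · simp only [Cmd.scost, Cmd.mov, hFl, Bool.false_eq_true, if_false]
        rw [if_pos (by rfl)]; omega
      · have : P.Glob (s.setV t1 (nr + 1)) := by
          cases hs.glob
          constructor <;> assumption
        exact this.agree hag (by cases hFX <;> rfl)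
      · rw [hag.v _ (by cases hFX <;> rfl)]; simp
      · rw [hag.a _ (by cases hFX <;> rfl)]; simp
    · rintro s2 - ⟨q0, q1, q2, q3, q4, q5, q6⟩
      refine Tri.mono (Tri.for_const (Inv := fun k t => (∀ i, t.a F i = if i < k then G i
        else s.a F i) ∧ t.v sdiag = s.a F (k - 1) ∧ t.v sup = G (k - 1)) (20 * E.cs) 1 (nr + 1) rfl
        (by simp [q4]) (by omega) (by omega) (by cases hFX <;> rfl) (by cases hFX <;> rfl) ?_ ?_)
        le_rfl (fun t _ h => ?_)
      · refine ⟨fun i => ?_, q2, q3⟩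
        rw [St.setV_a, q5, Function.update_apply]
        by_cases hi : i = 0
        · rw [if_pos hi, if_pos (by omega), hi]; rfl
        · rw [if_neg hi, if_neg (by omega)]
      · rintro k t h1 h2 hk hag ⟨i1, i2, i3⟩
        have hg := q0.agree hag (by cases hFX <;> rfl)
        have hy : t.v sy = P.y (col + (c - 1)) := by rw [hag.v _ (by cases hFX <;> rfl), q1]
        have hX : t.a X = s.a X := by rw [hag.a _ (by cases hFX <;> rfl), q6]
        have hFk : t.a F k = s.a F k := by rw [i1, if_neg (by omega)]
        have hb1 := hle (k - 1) (by omega)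
        have hb2 := hle k (by omega)
        have hb3 := hGle (k - 1)
        refine (rowStep_spec hFl hXl (z := G k) hk h1 i3 i2 hg.vbig hg.ve2 hg.vinf (okF k (by omega))
          (okX _ (by omega)) (by omega) (by omega) (by omega) (by omega) ?_).mono le_rfl ?_
        · obtain ⟨j, rfl⟩ : ∃ j, k = j + 1 := ⟨k - 1, by omega⟩
          rw [hFk, hX, hy, Nat.add_sub_cancel, hs.hX j (by omega)]
          rfl
        · rintro t' - ⟨j1, j2, j3⟩
          refine ⟨fun i => ?_, by simpa [hFk] using j2, by simpa using j3⟩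
          rw [St.setV_a, j1, Function.update_apply]
          by_cases hi : i = k
          · rw [if_pos hi, hi, if_pos (by omega)]
          · rw [if_neg hi, i1]
            by_cases hi' : i < k
            · rw [if_pos hi', if_pos (by omega)]
            · rw [if_neg hi', if_neg (by omega)]
      · intro i hi
        rw [h.1.1, if_pos (by omega)]
    · simp only [sweepCost, if_neg h0, Env.cr]
      rw [Nat.add_sub_cancel]
      have : nr * (20 * E.cs + 2 * E.cs) = 22 * (nr * E.cs) := by ring
      rw [this]
      have : (nr + 1) * (30 * E.cs) = 30 * (nr * E.cs) + 30 * E.cs := by ring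
      omega
    · intro t _ ht
      -- Induction on the row. The neighbours in the previous column are controlled by `hcol` and
      -- the one above by the induction hypothesis.
      have hind : ∀ i ≤ nr, (P.rect col).cell l i c ≤ G i ∧
          (p ((P.rect col).phi ((P.rect col).cell l i c)) → G i = (P.rect col).cell l i c) := by
        obtain ⟨d, rfl⟩ : ∃ d, c = d + 1 := ⟨c - 1, by omega⟩
        intro i
        induction i with
        | zero =>
          intro _
          rw [Rect.cell_zero]
          exact ⟨hs.le_tp, hs.tp_eq⟩
        | succ i ih =>
          intro hi
          exact Rect.step_exact p (Par.cell_le hk hf hl (by omega) hc) (ih (by omega))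
            (hcol (i + 1) hi) (hcol i (by omega)) rfl
      refine ⟨fun i hi => by rw [ht i hi]; exact hind i hi, fun i hi => by rw [ht i hi]; exact hGle i,
        fun i hi h0 => ?_⟩
      obtain ⟨j, rfl⟩ : ∃ j, i = j + 1 := ⟨i - 1, by omega⟩
      rw [ht _ hi]
      exact min_le_left _ _

end AsymDP

namespace AsymDP
open Var Arr

/-! ### Loops that fill an array -/

/-- The offset `o` is needed for arrays in large memory, which start behind the input. The body may
use that entries not yet reached are unchanged, as in updates of an array by itself. -/
theorem Tri.forStore {E : Env} {k : Arr} {i : Var} {hi : Opd} {p : Cmd} {s : St} (o : ℕ) (g : ℕ → ℕ)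
    (N n : ℕ) (hb : hi.val s = n) (hn : n < 2 ^ E.w) (hfix : hi.fixed p i = true)
    (hmod : p.modV i = false)
    (hstep : ∀ j t, j < n → t.v i = j → Agree (.for i (.lit 0) hi p) s t →
      (∀ l, l < o ∨ o + j ≤ l → t.a k l = s.a k l) →
      Tri E p t N fun t' => t'.a k = Function.update (t.a k) (o + j) (g j)) :
    Tri E (.for i (.lit 0) hi p) s (n * (N + 2 * E.cs) + 2 * E.cs) fun t =>
      (∀ j < n, t.a k (o + j) = g j) ∧ ∀ l, l < o ∨ o + n ≤ l → t.a k l = s.a k l := by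
  refine (Tri.for_const (Inv := fun j t => (∀ j' < j, t.a k (o + j') = g j') ∧
    ∀ l, l < o ∨ o + j ≤ l → t.a k l = s.a k l) N 0 n rfl hb (by omega) hn hfix hmod ?_ ?_).mono
    le_rfl ?_
  · exact ⟨fun j hj => by omega, fun l _ => rfl⟩
  · rintro j t - hj hti hag ⟨h1, h2⟩
    refine (hstep j t hj hti hag h2).mono le_rfl fun t' _ ht' => ?_
    rw [St.setV_a, ht']
    refine ⟨fun j' hj' => ?_, fun l hl => ?_⟩
    · rw [Function.update_apply]
      split
      · next h => rw [show j' = j by omega]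
      · next h => exact h1 j' (by omega)
    · rw [Function.update_apply, if_neg (by omega)]
      exact h2 l (by omega)
  · rintro t - ⟨h, -⟩
    simpa using h

/-- Set the entries below `hi` to `x`. -/
def fill (k : Arr) (x hi : Opd) : Cmd := .for vi (.lit 0) hi (.store k vi x)

theorem fill_spec {E : Env} {k : Arr} (hk : k.large = false) {x hi : Opd} {s : St} {z n : ℕ}
    (hx : x.val s = z) (hb : hi.val s = n) (hn : n < 2 ^ E.w) (hxf : x.fixed .skip vi = true)
    (hbf : hi.fixed .skip vi = true) (ok : ∀ i < n, E.ok k i) :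
    Tri E (fill k x hi) s (n * (3 * E.cs) + 2 * E.cs) fun t => ∀ i < n, t.a k i = z := by
  refine (Tri.forStore (k := k) 0 (fun _ => z) E.cs n hb hn (by
    cases hi
    · rfl
    · simpa [Opd.fixed, Cmd.modV] using hbf) rfl ?_).mono (by apply le_of_eq; ring) fun t _ h i hi => by simpa using h.1 i hi
  intro j t hj htj hag _
  refine (Tri.of_wp ?_).mono ?_ fun _ _ h => h
  · simp only [wp, Opd.val_var, htj]
    refine ⟨ok j hj, ?_⟩
    rw [setA_a_self, zero_add]
    congr 1
    rw [← hx]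
    cases x with
    | lit c => rfl
    | var x =>
      simp only [Opd.fixed, Cmd.modV, Bool.not_false, Bool.and_true, Bool.not_eq_true',
        decide_eq_false_iff_not] at hxf
      exact hag.v x (by simp [Cmd.for, Cmd.modV, hxf])
  · simp [Cmd.scost, hk]

/-- Load `cnt` characters of the first string, starting at `off`. -/
def loadX (X : Arr) (off cnt : Var) : Cmd :=
  .for vi (.lit 0) cnt
    (.op t0 .add vxb off ;; .op t0 .add t0 vi ;; .load sx inp t0 ;; .store X vi sx)

theorem loadX1_spec {E : Env} {P : Par} (hP : P.Ok E) {s : St} (hs : P.Glob s) {l n : ℕ}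
    (hoff : s.v vr0 = l * P.B) (hcnt : s.v vbl = n) (hm : l * P.B + n ≤ P.m) (hn : n ≤ P.B) :
    Tri E (loadX X1 vr0 vbl) s (n * (5 * E.cs + E.cr) + 2 * E.cs) fun t =>
      ∀ i < n, t.a X1 i = P.x (l * P.B + i) := by
  have hw := hP.w4
  refine (Tri.forStore (k := X1) 0 (fun i => P.x (l * P.B + i)) (3 * E.cs + E.cr) n (hi := .var vbl) hcnt (by omega)
    rfl rfl ?_).mono (by apply le_of_eq; ring) fun t _ h i hi => by simpa using h.1 i hi
  intro j t hj htj hag _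
  have hg := hs.agree hag rfl
  have h1 : t.v vr0 = l * P.B := by rw [hag.v _ rfl, hoff]
  have h2 := hg.hx (l * P.B + j) (by omega)
  have h3 := hP.okx (l * P.B + j) (by omega)
  rw [← add_assoc] at h2 h3
  refine (Tri.of_wp ?_).mono ?_ fun _ _ h => h
  · simp only [wp, opOk, opNat, Opd.val_var, St.setV_v, St.setV_a, reduceCtorEq,
            if_true, if_false, htj, h1, hg.vxb, setA_a_self, h2, zero_add, and_true]
    exact ⟨by omega, by omega, h3, hP.scratch X1 rfl j (by omega)⟩
  · simp only [Cmd.scost, Arr.large, if_true, Bool.false_eq_true, if_false]; omega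

theorem loadX2_spec {E : Env} {P : Par} (hP : P.Ok E) {s : St} (hs : P.Glob s) {l : ℕ}
    (hoff : s.v vr2 = l * P.B) (hm : l * P.B + P.B ≤ P.m) :
    Tri E (loadX X2 vr2 vB) s (P.B * (5 * E.cs + E.cr) + 2 * E.cs) fun t =>
      ∀ i < P.B, t.a X2 i = P.x (l * P.B + i) := by
  have hw := hP.w4
  refine (Tri.forStore (k := X2) 0 (fun i => P.x (l * P.B + i)) (3 * E.cs + E.cr) P.B (hi := .var vB) hs.vB
    (by omega) rfl rfl ?_).mono (by apply le_of_eq; ring) fun t _ h i hi => by simpa using h.1 i hi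
  intro j t hj htj hag _
  have hg := hs.agree hag rfl
  have h1 : t.v vr2 = l * P.B := by rw [hag.v _ rfl, hoff]
  have h2 := hg.hx (l * P.B + j) (by omega)
  have h3 := hP.okx (l * P.B + j) (by omega)
  rw [← add_assoc] at h2 h3
  refine (Tri.of_wp ?_).mono ?_ fun _ _ h => h
  · simp only [wp, opOk, opNat, Opd.val_var, St.setV_v, St.setV_a, reduceCtorEq,
            if_true, if_false, htj, h1, hg.vxb, setA_a_self, h2, zero_add, and_true]
    exact ⟨by omega, by omega, h3, hP.scratch X2 rfl j (by omega)⟩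
  · simp only [Cmd.scost, Arr.large, if_true, Bool.false_eq_true, if_false]; omega

/-! ### Tables of tile counts -/

/-- The rows up to `j` of the table are known. -/
def TabSt (P : Par) (col kt j : ℕ) (s : St) : Prop :=
  ∀ l ≤ j, ∀ t ≤ kt / P.B + 1,
    s.a tb (P.N0 + l * (P.kk + 2) + t) = (P.rect col).tab kt l t

theorem TabSt.agree {P : Par} {col kt j : ℕ} {s t : St} (h : TabSt P col kt j s) {p : Cmd}
    (hag : Agree p s t) (hp : p.modA tb = false) : TabSt P col kt j t := by
  intro l hl u hu
  rw [hag.a _ hp]; exact h l hl u hu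

/-- Facts about the position of a rectangle. -/
structure RectOk (P : Par) (col kt : ℕ) : Prop where
  col_le : col + kt ≤ P.n
  kt_le : kt ≤ P.kk * P.B

section
variable {P : Par} {E : Env} {col kt : ℕ}

theorem RectOk.tl_le (hP : P.Ok E) (h : RectOk P col kt) : kt / P.B ≤ P.kk := by
  have := Nat.div_le_div_right (c := P.B) h.kt_le
  rwa [Nat.mul_div_cancel _ hP.B_pos] at this

theorem RectOk.fits (hP : P.Ok E) (h : RectOk P col kt) : (P.rect col).Fits kt P.nb where
  pos := hP.B_pos
  lt := by
    have := h.tl_le hP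
    change (P.nb + 1) * (kt / P.B) < (P.nb + 1) * (P.kk + 1)
    exact Nat.mul_lt_mul_of_pos_left (by omega) (by omega)

theorem Par.Ok.oktb' (hP : P.Ok E) {l t : ℕ} (hl : l ≤ P.nb) (ht : t < P.kk + 2) :
    E.ok tb (P.N0 + l * (P.kk + 2) + t) ∧ P.N0 + l * (P.kk + 2) + t < 2 ^ E.w := by
  have h1 : l * (P.kk + 2) + t < (P.nb + 1) * (P.kk + 2) := by
    have := Nat.mul_le_mul_right (P.kk + 2) hl
    rw [Nat.succ_mul]; omega
  have h2 := hP.oktb _ h1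
  have h3 := hP.w1
  rw [← add_assoc] at h2
  refine ⟨h2, ?_⟩
  have : (P.nb + 1) * (P.kk + 2) ≤ (P.nb + 2) * (P.kk + 2) := Nat.mul_le_mul_right _ (by omega)
  omega
end

/-- The last tile of line `vu` whose table entry is at most `ve`. -/
def findTile : Cmd :=
  (.mov vq (.lit 0) ;; .op t1 .add vtl (.lit 1)) ;;
  .for vv (.lit 1) t1
    (.op t0 .add vu vv ;; .load sold tb t0 ;; .ite (.lt ve sold) .skip (.mov vq vv))

/-- A linear scan that remembers the last table entry not exceeding `e`. Entry `0` need not be read,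
because it is `0` on every line. -/
theorem findTile_spec {E : Env} {P : Par} (hP : P.Ok E) {col kt : ℕ} (hR : RectOk P col kt) {s : St}
    (hr : RectSt P col kt s) {j : ℕ} (ht : TabSt P col kt j s) {l e q : ℕ} (hj : j ≤ P.nb)
    (hl : l ≤ j) (hu : s.v vu = P.N0 + l * (P.kk + 2)) (he : s.v ve = e)
    (hq : (P.rect col).IsTile kt l e q) :
    Tri E findTile s ((P.kk + 1) * (6 * E.cs + E.cr)) fun t => t.v vq = q := by
  have hw := hP.w1
  have htl := hR.tl_le hP
  have hw' : P.kk + 2 ≤ (P.nb + 2) * (P.kk + 2) := Nat.le_mul_of_pos_left _ (by omega)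
  have hB := hP.B_pos
  have hf := hR.fits hP
  unfold findTile
  refine Tri.mono (Tri.seq (N := 2 * E.cs) (N' := (kt / P.B + 1 - 1) * ((3 * E.cs + E.cr) +
    2 * E.cs) + 2 * E.cs) (Q := fun t => t.v vq = 0 ∧ t.v t1 = kt / P.B + 1) ?_ ?_)
    (Q := fun t => t.v vq = q) ?_ fun _ _ h => h
  · refine (Tri.of_wp ?_).mono ?_ fun _ _ h => h
    · simp only [wp, wp_mov, opOk, opNat, Opd.val_var, Opd.val_lit, St.setV_v, reduceCtorEq,
            if_true, if_false, hr.vtl, and_true]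
      exact ⟨by omega, by omega⟩
    · simp only [Cmd.scost, Cmd.mov]; omega
  · rintro s1 hag1 ⟨g1, g2⟩
    refine Tri.mono (Tri.for_const (Inv := fun k t => t.v vq < k ∧
      (P.rect col).tab kt l (t.v vq) ≤ e ∧
        ∀ u, t.v vq < u → u < k → e < (P.rect col).tab kt l u) (3 * E.cs + E.cr) 1 (kt / P.B + 1) rfl
      g2 (by omega) (by omega) rfl rfl ?_ ?_) le_rfl ?_
    · simp only [St.setV_v, reduceCtorEq, if_false, g1]
      exact ⟨by omega, by rw [Rect.tab_zero_right]; omega, fun u _ _ => by omega⟩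
    · rintro k t h1 h2 hk hag2 ⟨i1, i2, i3⟩
      have a1 : t.v vu = P.N0 + l * (P.kk + 2) := by rw [hag2.v _ rfl, hag1.v _ rfl, hu]
      have a2 : t.v ve = e := by rw [hag2.v _ rfl, hag1.v _ rfl, he]
      have a3 := ((ht.agree hag1 rfl).agree hag2 rfl) l hl k (by omega)
      obtain ⟨a4, a5⟩ := hP.oktb' (l := l) (t := k) (by omega) (by omega)
      refine (Tri.of_wp ?_).mono ?_ fun _ _ h => h
      · simp only [wp, wp_mov, opOk, opNat, Opd.val_var, St.setV_v, St.setV_a, reduceCtorEq,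
            if_true, if_false, hk, a1, a2, a3, Cnd.holds_lt]
        refine ⟨a5, a4, fun h => ⟨by omega, i2, fun u hu1 hu2 => ?_⟩, fun h => ⟨by omega,
          by omega, by omega, fun u hu1 hu2 => by omega⟩⟩
        rcases Nat.lt_or_ge u k with h' | h'
        · exact i3 u hu1 h'
        · rwa [show u = k by omega]
      · simp only [Cmd.scost, Cmd.mov, Arr.large, if_true]; omega
    · rintro t - ⟨⟨i1, i2, i3⟩, -⟩
      rw [Nat.max_eq_right (Nat.le_add_left 1 _)] at i1 i3
      refine Rect.IsTile.unique (kt := kt) (l := l) (τ := e) (R := P.rect col)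
        ⟨Nat.le_of_lt_succ i1, i2, fun u h1 h2 => i3 u h1 ?_⟩ hq
      exact Nat.lt_succ_of_le h2
  · have h1 : (kt / P.B + 1 - 1) * ((3 * E.cs + E.cr) + 2 * E.cs) ≤ P.kk * (5 * E.cs + E.cr) :=
      Nat.mul_le_mul (by omega) (by omega)
    have h2 : P.kk * (5 * E.cs + E.cr) ≤ P.kk * (6 * E.cs + E.cr) :=
      Nat.mul_le_mul_left _ (by omega)
    rw [Nat.succ_mul P.kk]
    omega

/-- The tiles `q` of a path that crosses line `j` with tile count `τ`, and the tile counts `e` of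
its crossings. -/
structure Rect.Tiles (R : Rect) (kt j τ : ℕ) (q e : ℕ → ℕ) : Prop where
  last : e j = τ
  tile : ∀ l ≤ j, R.IsTile kt l (e l) (q l)
  step : ∀ l < j, e l = e (l + 1) - q (l + 1)

/-- On each line take the last tile whose entry is at most the current count; tile `0` always
qualifies. The sequence exists also for counts that no path attains. For those the exactness
statements below are vacuous, and only upper bounds are produced. -/
theorem Rect.Fits.exists_tiles {R : Rect} {kt nb : ℕ} (_ : R.Fits kt nb) (j τ : ℕ) :
    ∃ q e, R.Tiles kt j τ q e := by
  have ex : ∀ l τ, ∃ q, R.IsTile kt l τ q := by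
    intro l τ
    refine ⟨Nat.findGreatest (fun q => R.tab kt l q ≤ τ) (kt / R.B), Nat.findGreatest_le _, ?_, ?_⟩
    · exact Nat.findGreatest_spec (P := fun q => R.tab kt l q ≤ τ) (Nat.zero_le _)
        (by rw [Rect.tab_zero_right]; omega)
    · intro u h1 h2
      exact not_le.1 (Nat.findGreatest_is_greatest (P := fun q => R.tab kt l q ≤ τ) h1 h2)
  choose f hf using ex
  -- `g k` is the count that remains after going back `k` lines from line `j`.
  let g : ℕ → ℕ := fun k => Nat.rec τ (fun k e => e - f (j - k) e) k
  refine ⟨fun l => f l (g (j - l)), fun l => g (j - l), by simp [g], fun l _ => hf _ _, ?_⟩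
  intro l hl
  have h1 : j - l = (j - (l + 1)) + 1 := by omega
  have h2 : j - (j - (l + 1)) = l + 1 := by omega
  change g (j - l) = _
  rw [h1]
  change g (j - (l + 1)) - f (j - (j - (l + 1))) (g (j - (l + 1))) = _
  rw [h2]

/-- Find the tiles for tile count `vtau` on line `vj` and store them in `sq`. -/
def findTiles : Cmd :=
  (.mov ve vtau ;; .op vd .add vj (.lit 1)) ;;
  .for va (.lit 0) vd
    ((.op vl .sub vj va ;; .op vu .mul vl vst ;; .op vu .add vN0 vu) ;; findTile ;;
      .store sq vl vq ;; .op ve .sub ve vq)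

theorem findTiles_spec {E : Env} {P : Par} (hP : P.Ok E) {col kt : ℕ} (hR : RectOk P col kt) {s : St}
    (hg : P.Glob s) (hr : RectSt P col kt s) {j : ℕ} (ht : TabSt P col kt j s) (hj : j < P.nb)
    (hvj : s.v vj = j) {τ : ℕ} (hτ : s.v vtau = τ) (hτw : τ < 2 ^ E.w) {q e : ℕ → ℕ}
    (hq : (P.rect col).Tiles kt j τ q e) :
    Tri E findTiles s ((P.nb + 1) * ((P.kk + 2) * (10 * E.cs + E.cr))) fun t =>
      ∀ l ≤ j, t.a sq l = q l := by
  have hw := hP.w1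
  have hw' : P.nb + 2 ≤ (P.nb + 2) * (P.kk + 2) := Nat.le_mul_of_pos_right _ (by omega)
  have hnb := hP.nb_le
  have hf := hR.fits hP
  unfold findTiles
  refine Tri.mono (Tri.seq (N := 2 * E.cs) (N' := (j + 1 - 0) * ((5 * E.cs +
    (P.kk + 1) * (6 * E.cs + E.cr)) + 2 * E.cs) + 2 * E.cs)
    (Q := fun t => t.v ve = τ ∧ t.v vd = j + 1) ?_ ?_)
    (Q := fun t => ∀ l ≤ j, t.a sq l = q l) ?_ fun _ _ h => h
  · refine (Tri.of_wp ?_).mono ?_ fun _ _ h => h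
    · simp only [wp, wp_mov, opOk, opNat, Opd.val_var, Opd.val_lit, St.setV_v, reduceCtorEq,
            if_true, if_false, hvj, hτ, and_true]
      exact ⟨by omega, by omega⟩
    · simp only [Cmd.scost, Cmd.mov]; omega
  · rintro s1 hag1 ⟨g1, g2⟩
    refine Tri.mono (Tri.for_const (Inv := fun k t => (k ≤ j → t.v ve = e (j - k)) ∧
      ∀ l ≤ j, j < l + k → t.a sq l = q l) (5 * E.cs +
    (P.kk + 1) * (6 * E.cs + E.cr)) 0 (j + 1) rfl
      g2 (by omega) (by omega) rfl rfl ?_ ?_) le_rfl ?_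
    · refine ⟨fun _ => ?_, fun l hl hl' => by omega⟩
      simp only [St.setV_v, reduceCtorEq, if_false, g1, Nat.sub_zero, hq.last]
    · rintro k t - h2 hk hag2 ⟨i1, i2⟩
      have i1 := i1 (by omega)
      have a1 : t.v vj = j := by rw [hag2.v _ rfl, hag1.v _ rfl, hvj]
      have hg' := (hg.agree hag1 rfl).agree hag2 rfl
      have hr' := (hr.agree hag1 rfl).agree hag2 rfl
      have ht' := (ht.agree hag1 rfl).agree hag2 rfl
      have a5 := (hP.oktb' (l := j - k) (t := 0) (by omega) (by omega)).2
      have b1 : (j - k) * (P.kk + 2) ≤ P.N0 + (j - k) * (P.kk + 2) := by omega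
      refine Tri.mono (Tri.seq (N := 3 * E.cs) (N' := (P.kk + 1) * (6 * E.cs + E.cr) + 2 * E.cs)
        (Q := fun t => t.v vl = j - k ∧
        t.v vu = P.N0 + (j - k) * (P.kk + 2)) (Q' := fun t' => t'.v ve = e (j - k) - q (j - k) ∧
          t'.a sq = Function.update (t.a sq) (j - k) (q (j - k))) ?_ ?_) (by omega) ?_
      · refine (Tri.of_wp ?_).mono ?_ fun _ _ h => h
        · simp only [wp, opOk, opNat, Opd.val_var, St.setV_v, reduceCtorEq,
            if_true, if_false, hk, a1, hg'.vst, hg'.vN0, and_true]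
          exact ⟨by omega, by omega, by omega⟩
        · simp only [Cmd.scost]; omega
      · rintro s2 hag3 ⟨c1, c2⟩
        refine Tri.seq (findTile_spec hP hR (hr'.agree hag3 rfl) (ht'.agree hag3 rfl)
          (by omega) (l := j - k) (by omega) c2 (e := e (j - k)) (by rw [hag3.v _ rfl, i1])
          (hq.tile _ (by omega))) ?_
        intro s3 hag4 d1
        have d2 : s3.v vl = j - k := by rw [hag4.v _ rfl, c1]
        have d3 : s3.v ve = e (j - k) := by rw [hag4.v _ rfl, hag3.v _ rfl, i1]
        have d4 : s3.a sq = t.a sq := by rw [hag4.a _ rfl, hag3.a _ rfl]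
        have d5 : q (j - k) ≤ e (j - k) :=
          (hf.le_tab (by omega) (hq.tile _ (by omega)).le).trans (hq.tile (j - k) (by omega)).tab_le
        refine (Tri.of_wp ?_).mono ?_ fun _ _ h => h
        · simp only [wp, opOk, opNat, Opd.val_var, St.setV_v, St.setV_a, St.setA_v,
            if_true, d1, d2, d3, setA_a_self, and_true, d4]
          exact ⟨hP.scratch sq rfl _ (by omega), d5⟩
        · simp only [Cmd.scost, Arr.large, Bool.false_eq_true, if_false]; omega
      · rintro t' - ⟨d1, d2⟩
        refine ⟨fun hk' => ?_, fun l hl hl' => ?_⟩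
        · rw [St.setV_v, if_neg (by decide), d1, hq.step (j - (k + 1)) (by omega)]
          rw [show j - (k + 1) + 1 = j - k by omega]
        · rw [St.setV_a, d2, Function.update_apply]
          split
          · next h => rw [h]
          · exact i2 l hl (by omega)
    · rintro t - ⟨⟨i1, i2⟩, -⟩ l hl
      exact i2 l hl (by omega)
  · have h1 : (j + 1 - 0) * ((5 * E.cs + (P.kk + 1) * (6 * E.cs + E.cr)) + 2 * E.cs) ≤
        P.nb * ((P.kk + 2) * (10 * E.cs + E.cr)) := by
      refine Nat.mul_le_mul (by omega) ?_
      nlinarith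
    rw [Nat.succ_mul]
    nlinarith

end AsymDP

namespace AsymDP
open Var Arr

/-! ### Evaluation along the paths with a given tile count -/

/-- `W` holds, for tile `q` of line `l`, upper bounds that are exact for tile count `τ`. -/
def LineVal (P : Par) (col kt l τ q : ℕ) (W : ℕ → ℕ) : Prop :=
  ∀ c, q * P.B ≤ c → c < (q + 1) * P.B → c ≤ kt →
    (P.rect col).top l c ≤ W (c - q * P.B) ∧ W (c - q * P.B) ≤ P.inf + P.big ∧
      ((P.rect col).phi ((P.rect col).top l c) = τ → W (c - q * P.B) = (P.rect col).top l c)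

/-- One column of band `vl` restricted to the columns from `vv` on. -/
def evalColumn : Cmd :=
  (.op t0 .sub vc2 vv ;; .ite (.lt t0 vB) (.load stp W t0) (.mov stp vinf) ;; .mov sc vc2) ;;
  sweepCol F2 X2 ;;
  .ite (.lt vc2 vd) .skip
    (.load sold F2 vB ;; .op sold .add sold va ;; .op t0 .sub vc2 vd ;; .store W2 t0 sold)

/-- Load the data of band `vl`. -/
def evalBandInit : Cmd :=
  (.load vq sq vl ;; .op vu .add vl (.lit 1) ;; .load va sq vu ;; .op vr2 .mul vl vB ;;
    .op vv .mul vq vB ;; .op vd .mul va vB ;; .op vchi2 .add vd vB ;; .op t0 .add vkt (.lit 1) ;;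
    .setMin vchi2 t0 ;; .mov snr vB ;; .mov sr vr2 ;; .op t1 .add vB (.lit 1)) ;;
  loadX X2 vr2 vB ;; fill F2 vinf t1 ;; fill W2 vinf vB

/-- Proceed from line `vl` to the next line. -/
def evalBand : Cmd :=
  evalBandInit ;; .for vc2 vv vchi2 evalColumn ;;
  .for vi (.lit 0) vB (.load sold W2 vi ;; .store W vi sold)

/-- Cost of one column of a band. -/
def colCost (E : Env) (P : Par) : ℕ := (P.B + 1) * (50 * E.cs) + E.cr

/-- The state during the evaluation of a band. -/
structure BandSt (P : Par) (col kt l q q' : ℕ) (s : St) : Prop where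
  glob : P.Glob s
  rect : RectSt P col kt s
  vv : s.v vv = q * P.B
  va : s.v va = q'
  vd : s.v vd = q' * P.B
  vchi2 : s.v vchi2 = min (q' * P.B + P.B) (kt + 1)
  vsnr : s.v snr = P.B
  vsr : s.v sr = l * P.B
  hX : ∀ i < P.B, s.a X2 i = P.x (l * P.B + i)

def Cmd.keepsBand (p : Cmd) : Bool :=
  p.keepsGlob && (p.keepsRect && ([Var.vv, .va, .vd, .vchi2, snr, sr].all (fun x => !p.modV x) &&
    !p.modA X2))

theorem BandSt.agree {P : Par} {col kt l q q' : ℕ} {s t : St} (h : BandSt P col kt l q q' s) {p : Cmd}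
    (hag : Agree p s t) (hp : p.keepsBand = true) : BandSt P col kt l q q' t := by
  simp only [Cmd.keepsBand, List.all_cons, List.all_nil, Bool.and_eq_true, Bool.not_eq_true',
    Bool.and_true] at hp
  obtain ⟨h1, h2, ⟨h3, h4, h5, h6, h7, h8⟩, h9⟩ := hp
  constructor
  · exact h.glob.agree hag h1
  · exact h.rect.agree hag h2
  · rw [hag.v _ h3, h.vv]
  · rw [hag.v _ h4, h.va]
  · rw [hag.v _ h5, h.vd]
  · rw [hag.v _ h6, h.vchi2]
  · rw [hag.v _ h7, h.vsnr]
  · rw [hag.v _ h8, h.vsr]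
  · rw [hag.a _ h9]; exact h.hX

theorem Par.bounds {P : Par} {E : Env} (hP : P.Ok E) : 1 ≤ P.big ∧ P.inf + 4 * P.big < 2 ^ E.w ∧
    P.m + P.n + P.B + 4 < 2 ^ E.w ∧ P.kk + 1 ≤ P.big ∧ P.big ≤ P.inf := by
  have hw2 := hP.w2
  have hB := hP.B_pos
  have hbig : 1 ≤ P.big := Nat.mul_pos (by omega) (by omega)
  refine ⟨hbig, lt_of_le_of_lt ?_ hw2, lt_of_le_of_lt (Nat.le_mul_of_pos_right _ hbig) hw2,
    Nat.le_mul_of_pos_left _ (by omega), Nat.le_mul_of_pos_left _ (by omega)⟩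
  rw [Par.inf, ← Nat.add_mul]
  exact Nat.mul_le_mul_right _ (by omega)

section
variable {E : Env} {P : Par} {col kt : ℕ}

/-- Within the band a value keeps its count `e`. On crossing the next line in tile `q'` it gets `e'
= e + q'`, so exactness for `e` in the bottom row is exactness for `e'` on the line. -/
theorem evalColumn_spec (hP : P.Ok E) (hR : RectOk P col kt) {l e e' q q' : ℕ}
    (hl : l + 1 ≤ P.nb) (hm : l * P.B + P.B ≤ P.m) (hq : (P.rect col).IsTile kt l e q)
    (hq' : (P.rect col).IsTile kt (l + 1) e' q') (hee : e' = e + q') {k : ℕ} {s : St}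
    (hs : BandSt P col kt l q q' s)
    (hW : LineVal P col kt l e q (s.a W)) (hk : s.v vc2 = k) (hk1 : q * P.B ≤ k)
    (hk2 : k < q' * P.B + P.B) (hk3 : k ≤ kt)
    (hF : 0 < k → (P.rect col).Col (· = e) l P.B (k - 1) (s.a F2) ∧
      ∀ i ≤ P.B, s.a F2 i ≤ P.inf + P.big) :
    Tri E evalColumn s (colCost E P + if k = 0 then P.B * E.cr else 0) fun t =>
      ((P.rect col).Col (· = e) l P.B k (t.a F2) ∧ ∀ i ≤ P.B, t.a F2 i ≤ P.inf + P.big) ∧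
      (∀ i, q' * P.B + i ≠ k → t.a W2 i = s.a W2 i) ∧
      (q' * P.B ≤ k → t.a W2 (k - q' * P.B) ≤ P.inf + P.big ∧
        (P.rect col).top (l + 1) k ≤ t.a W2 (k - q' * P.B) ∧
        ((P.rect col).phi ((P.rect col).top (l + 1) k) = e' →
          t.a W2 (k - q' * P.B) = (P.rect col).top (l + 1) k)) := by
  obtain ⟨hb1, hb2, hb3, hb4, hb5⟩ := Par.bounds hP
  have hf := hR.fits hP
  have hcn := hR.col_le
  have hkn := hR.tl_le hP
  have hq'k : q' ≤ P.kk := hq'.le.trans hkn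
  unfold evalColumn
  refine Tri.mono (Tri.seq (N := 5 * E.cs) (N' := sweepCost E P.B k + 6 * E.cs)
    (Q := fun t => SweepPre P col kt F2 X2 (· = e) l P.B k t) ?_ ?_) (Q := fun t =>
      ((P.rect col).Col (· = e) l P.B k (t.a F2) ∧ ∀ i ≤ P.B, t.a F2 i ≤ P.inf + P.big) ∧
      (∀ i, q' * P.B + i ≠ k → t.a W2 i = s.a W2 i) ∧
      (q' * P.B ≤ k → t.a W2 (k - q' * P.B) = t.a F2 P.B + q' ∧ t.a F2 P.B ≤ P.inf)) ?_ ?_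
  · refine ((Tri.of_wp (Q := fun t => t.v sc = k ∧
      t.v stp = if k - q * P.B < P.B then s.a W (k - q * P.B) else P.inf) ?_).mono ?_ ?_)
    · simp only [wp, wp_mov, opOk, opNat, Opd.val_var, St.setV_v, St.setV_a, reduceCtorEq,
            if_true, if_false, hk, hs.vv, hs.glob.vB, hs.glob.vinf, Cnd.holds_lt]
      exact ⟨hk1, fun h => ⟨hP.scratch W rfl _ (by omega), by omega, trivial, by rw [if_pos h]⟩,
        fun h => ⟨by omega, by omega, trivial, by rw [if_neg h]⟩⟩
    · simp only [Cmd.scost, Cmd.mov, Arr.large, Bool.false_eq_true, if_false]; omega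
    · rintro t hag ⟨h1, h2⟩
      have hb := hs.agree hag rfl
      have key : (P.rect col).top l k ≤ t.v stp ∧ t.v stp ≤ P.inf + P.big ∧
          ((P.rect col).phi ((P.rect col).top l k) = e → t.v stp = (P.rect col).top l k) := by
        rw [h2]
        split
        · exact hW k hk1 (by rw [Nat.succ_mul]; omega) hk3
        · next h =>
          refine ⟨?_, by omega, fun h3 => ?_⟩
          · rw [← Rect.cell_zero]
            exact Par.cell_le hcn hf (by omega) (by omega) hk3
          -- To the right of tile `q` the line is replaced by `inf`. Nothing is lost, because by
          -- uniqueness a column with count `e` lies in tile `q`.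
          · have := hf.isTile_div (l := l) (c := k) (by omega) hk3
            rw [h3] at this
            have h4 := this.unique hq
            have h5 := Nat.lt_div_mul_add (a := k) hP.B_pos
            change k / P.B = q at h4
            rw [h4] at h5
            omega
      exact ⟨hb.glob, hb.rect, h1, hb.vsnr, hb.vsr, hb.hX, key.2.1, key.1, key.2.2,
        fun h0 => by rw [hag.a _ rfl]; exact hF h0⟩
  · intro s1 hag1 hs1
    refine Tri.seq (sweepCol_spec hP hcn hf .two (by omega) le_rfl hm hk3 hs1) ?_
    rintro s2 hag2 ⟨h1, h2, h20⟩
    have hb := (hs.agree hag1 rfl).agree hag2 rfl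
    have hk' : s2.v vc2 = k := by rw [hag2.v _ rfl, hag1.v _ rfl, hk]
    have hW2 : s2.a W2 = s.a W2 := by rw [hag2.a _ rfl, hag1.a _ rfl]
    have h3 := h2 P.B le_rfl
    refine ((Tri.of_wp (Q := fun t => t.a F2 = s2.a F2 ∧
      (∀ i, q' * P.B + i ≠ k → t.a W2 i = s.a W2 i) ∧
      (q' * P.B ≤ k → t.a W2 (k - q' * P.B) = t.a F2 P.B + q')) ?_).mono ?_ ?_)
    · simp only [wp, opOk, opNat, Opd.val_var, St.setV_v, St.setV_a, St.setA_a, reduceCtorEq,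
            if_true, if_false, hk', hb.vd, hb.va, hb.glob.vB, Cnd.holds_lt, true_and, false_and, hW2]
      refine ⟨fun h => ⟨fun _ _ => trivial, fun h' => by omega⟩, fun h => ⟨hP.scratch F2 rfl _ le_rfl,
        by omega, by omega, hP.scratch W2 rfl _ (by omega), rfl, fun i hi => by rw [if_neg (by omega)],
        fun _ => trivial⟩⟩
    · simp only [Cmd.scost, Arr.large, Bool.false_eq_true, if_false]; omega
    · rintro t - ⟨j1, j2, j3⟩
      rw [j1] at j3 ⊢
      exact ⟨⟨h1, h2⟩, j2, fun h => ⟨j3 h, h20 P.B le_rfl hP.B_pos⟩⟩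
  · unfold sweepCost colCost
    have : (P.B + 1) * (50 * E.cs) = (P.B + 1) * (30 * E.cs) + 20 * (P.B * E.cs) + 20 * E.cs := by
      ring
    omega
  · rintro t - ⟨⟨h1, h2⟩, h3, h4⟩
    refine ⟨⟨h1, h2⟩, h3, fun h => ?_⟩
    obtain ⟨h4, h40⟩ := h4 h
    rw [h4]
    obtain ⟨c1, c2⟩ := h1 P.B le_rfl
    have hkB : k / P.B = q' := by
      refine Nat.div_eq_of_lt_le (by omega) (by rw [Nat.succ_mul]; omega)
    have htop : (P.rect col).top (l + 1) k = (P.rect col).cell l P.B k + q' := by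
      rw [Rect.top_succ]
      change _ + k / P.B = _
      rw [hkB]; rfl
    have hphi : (P.rect col).phi ((P.rect col).top (l + 1) k) =
        (P.rect col).phi ((P.rect col).cell l P.B k) + q' := by
      rw [hf.phi_top_succ (by omega) hk3]
      change _ + k / P.B = _
      rw [hkB]; rfl
    refine ⟨by omega, ?_, fun h5 => ?_⟩
    · rw [htop]; exact Nat.add_le_add_right c1 _
    · rw [hphi] at h5
      rw [htop, c2 (by omega)]

theorem evalBandInit_spec (hP : P.Ok E) {l q q' : ℕ} {s : St} (hg : P.Glob s)
    (hr : RectSt P col kt s) (hl : l + 1 < P.nb) (hm : l * P.B + P.B ≤ P.m) (hvl : s.v vl = l)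
    (hkt : kt ≤ P.n) (hq1 : q * P.B ≤ kt) (hq'1 : q' * P.B ≤ kt) (hq : s.a sq l = q)
    (hq' : s.a sq (l + 1) = q') :
    Tri E evalBandInit s ((P.B + 2) * (12 * E.cs + E.cr)) fun t =>
      BandSt P col kt l q q' t ∧ (∀ i ≤ P.B, t.a F2 i = P.inf) ∧ (∀ i < P.B, t.a W2 i = P.inf) ∧
        t.a W = s.a W := by
  obtain ⟨hb1, hb2, hb3, hb4, hb5⟩ := Par.bounds hP
  have hnb := hP.nb_le
  unfold evalBandInit
  refine Tri.cost (Tri.seq (N := 14 * E.cs) (N' := (P.B * (5 * E.cs + E.cr) + 2 * E.cs) +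
    (((P.B + 1) * (3 * E.cs) + 2 * E.cs) + (P.B * (3 * E.cs) + 2 * E.cs)))
    (Q := fun t => P.Glob t ∧ RectSt P col kt t ∧ t.v vv = q * P.B ∧ t.v va = q' ∧
      t.v vd = q' * P.B ∧ t.v vchi2 = min (q' * P.B + P.B) (kt + 1) ∧ t.v snr = P.B ∧
      t.v sr = l * P.B ∧ t.v vr2 = l * P.B ∧ t.v t1 = P.B + 1) ?_ ?_) ?_
  · refine ((Tri.of_wp (Q := fun t => t.v vv = q * P.B ∧ t.v va = q' ∧
      t.v vd = q' * P.B ∧ t.v vchi2 = min (q' * P.B + P.B) (kt + 1) ∧ t.v snr = P.B ∧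
      t.v sr = l * P.B ∧ t.v vr2 = l * P.B ∧ t.v t1 = P.B + 1) ?_).mono ?_
      fun t hag h => ⟨hg.agree hag rfl, hr.agree hag rfl, h⟩)
    · simp only [wp, wp_mov, wp_setMin, opOk, opNat, Opd.val_var, Opd.val_lit, St.setV_v, St.setV_a,
        reduceCtorEq, if_true, if_false, hvl, hg.vB, hq, hq', hr.vkt, and_true]
      exact ⟨hP.scratch sq rfl _ (by omega), by omega, hP.scratch sq rfl _ (by omega), by omega,
        by omega, by omega, by omega, by omega, by omega, by omega, by omega, by omega⟩
    · simp only [Cmd.scost, Cmd.mov, Cmd.setMin, Arr.large, Bool.false_eq_true, if_false]; omega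
  rotate_left
  · nlinarith
  rintro s1 hag1 ⟨hg1, hr1, p1, p2, p3, p4, p5, p6, p7, p8⟩
  refine Tri.seq (loadX2_spec hP hg1 p7 hm) ?_
  intro s2 hag2 hx
  have hb : BandSt P col kt l q q' s2 := by
    refine ⟨hg1.agree hag2 rfl, hr1.agree hag2 rfl, ?_, ?_, ?_, ?_, ?_, ?_, hx⟩
    · rw [hag2.v _ rfl, p1]
    · rw [hag2.v _ rfl, p2]
    · rw [hag2.v _ rfl, p3]
    · rw [hag2.v _ rfl, p4]
    · rw [hag2.v _ rfl, p5]
    · rw [hag2.v _ rfl, p6]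
  refine Tri.seq (fill_spec (k := F2) (x := .var vinf) rfl (hb.glob.vinf) (n := P.B + 1) (hi := .var t1)
    (show s2.v t1 = _ by rw [hag2.v _ rfl, p8]) (by omega) rfl rfl
    (fun i hi => hP.scratch F2 rfl i (by omega))) ?_
  intro s3 hag3 hf2
  have hb3 := hb.agree hag3 rfl
  refine (fill_spec (k := W2) (x := .var vinf) rfl (hb3.glob.vinf) (n := P.B) (hi := .var vB)
    hb3.glob.vB (by omega) rfl rfl
    (fun i hi => hP.scratch W2 rfl i (by omega))).mono le_rfl ?_
  intro s4 hag4 hw2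
  refine ⟨hb3.agree hag4 rfl, ?_, hw2, ?_⟩
  · intro i hi
    rw [hag4.a _ rfl]
    exact hf2 i (by omega)
  · rw [hag4.a _ rfl, hag3.a _ rfl, hag2.a _ rfl, hag1.a _ rfl]

/-- Cost of proceeding from tile `q` to tile `q'` of the next line. -/
def bandCost (E : Env) (P : Par) (q q' : ℕ) : ℕ :=
  (q' + 1 - q) * (P.B * (colCost E P + 2 * E.cs)) + (P.B + 2) * (20 * E.cs + 2 * E.cr)

/-- Paths with the given count enter the band in tile `q` and leave it in tile `q'`, so it suffices
to sweep from the start of `q` to the end of `q'`. If `q'` lies to the left of `q` there is nothing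
to sweep, and the values `inf` are correct because no column of `q'` has the count in question. -/
theorem evalBand_spec (hP : P.Ok E) (hR : RectOk P col kt) {l e e' q q' : ℕ}
    (hl : l + 1 < P.nb) (hm : l * P.B + P.B ≤ P.m) (hq : (P.rect col).IsTile kt l e q)
    (hq' : (P.rect col).IsTile kt (l + 1) e' q') (hee : e' = e + q') {s : St} (hg : P.Glob s)
    (hr : RectSt P col kt s) (hvl : s.v vl = l) (hsq : s.a sq l = q) (hsq' : s.a sq (l + 1) = q')
    (hW : LineVal P col kt l e q (s.a W)) :
    Tri E evalBand s (bandCost E P q q') fun t => LineVal P col kt (l + 1) e' q' (t.a W) := by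
  obtain ⟨hb1, hb2, hb3, hb4, hb5⟩ := Par.bounds hP
  have hf := hR.fits hP
  have hcn := hR.col_le
  have hB := hP.B_pos
  have hq1 : q * P.B ≤ kt := (Nat.le_div_iff_mul_le hB).1 hq.le
  have hq'1 : q' * P.B ≤ kt := (Nat.le_div_iff_mul_le hB).1 hq'.le
  have hphi : ∀ k, q' * P.B ≤ k → k < (q' + 1) * P.B → k ≤ kt →
      (P.rect col).phi ((P.rect col).top (l + 1) k) =
        (P.rect col).phi ((P.rect col).cell l P.B k) + q' := by
    intro k h1 h2 h3
    have hkB : k / P.B = q' := Nat.div_eq_of_lt_le h1 h2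
    rw [hf.phi_top_succ (by omega) h3]
    change _ + k / P.B = _
    rw [hkB]; rfl
  have htop : ∀ k ≤ kt, (P.rect col).top (l + 1) k ≤ P.inf := by
    intro k hk
    rw [← Rect.cell_zero]
    exact Par.cell_le hcn hf (by omega) (by rw [Nat.succ_mul]; omega) hk
  unfold evalBand
  set hi := min (q' * P.B + P.B) (kt + 1) with hhi
  refine Tri.mono (Tri.seq (evalBandInit_spec hP hg hr hl hm hvl (by omega) hq1 hq'1 hsq hsq')
    (Q' := fun t => LineVal P col kt (l + 1) e' q' (t.a W)) (N' := (∑ k ∈ Finset.Ico (q * P.B) hi,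
      (colCost E P + (if k = 0 then P.B * E.cr else 0) + 2 * E.cs) + 2 * E.cs) +
      (P.B * (2 * E.cs + 2 * E.cs) + 2 * E.cs)) ?_) ?_ fun _ _ h => h
  · rintro s1 - ⟨hb, hF2, hW2, hWW⟩
    refine Tri.seq (Tri.for (Inv := fun k t =>
      (0 < k → (P.rect col).Col (· = e) l P.B (k - 1) (t.a F2) ∧
        ∀ i ≤ P.B, t.a F2 i ≤ P.inf + P.big) ∧
      ∀ c, q' * P.B ≤ c → c < (q' + 1) * P.B → c ≤ kt →
        (P.rect col).top (l + 1) c ≤ t.a W2 (c - q' * P.B) ∧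
        t.a W2 (c - q' * P.B) ≤ P.inf + P.big ∧ (c < k →
          (P.rect col).phi ((P.rect col).top (l + 1) c) = e' →
          t.a W2 (c - q' * P.B) = (P.rect col).top (l + 1) c)) _ (q * P.B) hi hb.vv hb.vchi2
      (by omega) (by omega) rfl rfl ?_ ?_) ?_
    · refine ⟨fun h0 => ⟨fun i hi => ⟨?_, fun h => ?_⟩, fun i hi => ?_⟩, fun c h1 h2 h3 => ⟨?_, ?_,
        fun h4 h5 => ?_⟩⟩
      · rw [St.setV_a, hF2 i hi]
        exact Par.cell_le hcn hf (by omega) (by omega) (by omega)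
      -- The column before the sweep is filled with `inf`. Its counts are all below `e`, so
      -- exactness is not required there.
      · have := hf.phi_lt_of_isTile (by omega) hq i (c := q * P.B - 1)
          (show q * P.B - 1 < q * P.B by omega)
        omega
      · rw [St.setV_a, hF2 i hi]; omega
      · rw [St.setV_a, hW2 _ (by rw [Nat.succ_mul] at h2; omega)]
        exact htop c h3
      · rw [St.setV_a, hW2 _ (by rw [Nat.succ_mul] at h2; omega)]; omega
      · rw [hphi c h1 h2 h3] at h5
        have := hf.phi_lt_of_isTile (by omega) hq P.B (c := c) h4
        omega
    · rintro k t h1 h2 hk hag ⟨i1, i2⟩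
      have hb' := hb.agree hag rfl
      refine (evalColumn_spec hP hR (by omega) hm hq hq' hee hb' (by rwa [hag.a _ rfl, hWW]) hk h1
        (by omega) (by omega) i1).mono le_rfl ?_
      rintro t' - ⟨j1, j2, j3⟩
      refine ⟨fun _ => by simpa using j1, fun c c1 c2 c3 => ?_⟩
      rw [St.setV_a]
      by_cases hck : c = k
      · subst hck
        obtain ⟨j4, j5, j6⟩ := j3 c1
        exact ⟨j5, j4, fun _ => j6⟩
      · rw [j2 _ (by omega)]
        obtain ⟨j4, j5, j6⟩ := i2 c c1 c2 c3
        exact ⟨j4, j5, fun h => j6 (by omega)⟩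
    · rintro s2 hag2 ⟨⟨-, i2⟩, -⟩
      have hb2 := hb.agree hag2 rfl
      refine (Tri.forStore (k := W) 0 (fun i => s2.a W2 i) (2 * E.cs) P.B (hi := .var vB) hb2.glob.vB
        (by omega) rfl rfl ?_).mono le_rfl fun t _ h c h1 h2 h3 => ?_
      · intro j t hj htj hag _
        refine (Tri.of_wp ?_).mono ?_ fun _ _ h => h
        · simp only [wp, Opd.val_var, St.setV_v, St.setV_a, reduceCtorEq,
            if_true, if_false, htj, setA_a_self, zero_add]
          refine ⟨hP.scratch W2 rfl j (by omega), hP.scratch W rfl j (by omega), ?_⟩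
          rw [hag.a W2 rfl]
        · simp only [Cmd.scost, Arr.large, Bool.false_eq_true, if_false]; omega
      · have := h.1 (c - q' * P.B) (by rw [Nat.succ_mul] at h2; omega)
        rw [zero_add] at this
        rw [this]
        obtain ⟨j1, j2, j3⟩ := i2 c h1 h2 h3
        exact ⟨j1, j2, j3 (by rw [Nat.succ_mul] at h2; omega)⟩
  · have h1 : ∑ k ∈ Finset.Ico (q * P.B) hi,
        (colCost E P + (if k = 0 then P.B * E.cr else 0) + 2 * E.cs) ≤
        (hi - q * P.B) * (colCost E P + 2 * E.cs) + P.B * E.cr := by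
      have : ∀ k, colCost E P + (if k = 0 then P.B * E.cr else 0) + 2 * E.cs =
        (colCost E P + 2 * E.cs) + (if k = 0 then P.B * E.cr else 0) := fun k => by ring
      simp only [this, Finset.sum_add_distrib, Finset.sum_const, Nat.card_Ico, smul_eq_mul]
      -- The surcharge for reading the left boundary is paid at most once, in column `0`.
      rw [Finset.sum_ite_eq' (Finset.Ico (q * P.B) hi) 0]
      rw [Nat.mul_add (hi - q * P.B)]
      split
      · rfl
      · exact Nat.add_le_add_left (Nat.zero_le _) _
    have h2 : (hi - q * P.B) * (colCost E P + 2 * E.cs) ≤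
        (q' + 1 - q) * (P.B * (colCost E P + 2 * E.cs)) := by
      rw [← mul_assoc]
      refine Nat.mul_le_mul_right _ ?_
      rw [Nat.sub_mul, Nat.succ_mul]
      omega
    unfold bandCost
    nlinarith

end
end AsymDP

/-! ### Evaluating a line for one tile count -/

namespace AsymDP
open Var Arr

/-- Load the values on the first line. -/
def evalInit : Cmd :=
  (.load vq sq (.lit 0) ;; .op t1 .mul vq vB ;; .op t1 .add vcol t1) ;;
  .for vi (.lit 0) vB
    (.op t0 .add t1 vi ;; .op t0 .mul t0 vbig ;; .op t0 .add t0 vq ;; .store W vi t0)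

/-- Evaluate line `vj` for tile count `vtau` and include the result in `acc`. -/
def eval : Cmd :=
  findTiles ;; evalInit ;; .for vl (.lit 0) vj evalBand ;;
  .for vi (.lit 0) vB (.load sold W vi ;; .load sx acc vi ;; .setMin sx sold ;; .store acc vi sx)

/-- The first term pays for the columns of at most `kk + nb` tiles. The second pays for finding the
tiles and for the preparation of each band. -/
def evalCost (E : Env) (P : Par) : ℕ :=
  (P.kk + P.nb) * (P.B * (colCost E P + 2 * E.cs)) +
    (P.nb + 1) * ((P.B + P.kk + 4) * (40 * E.cs + 3 * E.cr))

section
variable {E : Env} {P : Par} {col kt : ℕ}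

theorem evalInit_spec (hP : P.Ok E) (hR : RectOk P col kt) {τ q : ℕ} {s : St} (hg : P.Glob s)
    (hr : RectSt P col kt s) (hq : s.a sq 0 = q) (hq1 : q * P.B ≤ kt) :
    Tri E evalInit s ((P.B + 1) * (6 * E.cs)) fun t =>
      LineVal P col kt 0 τ q (t.a W) := by
  obtain ⟨hb1, hb2, hb3, hb4, hb5⟩ := Par.bounds hP
  have hcn := hR.col_le
  have hqB : q ≤ q * P.B := Nat.le_mul_of_pos_right _ hP.B_pos
  unfold evalInit
  refine Tri.cost (Tri.seq (N := 3 * E.cs) (N' := P.B * (4 * E.cs + 2 * E.cs) + 2 * E.cs)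
    (Q := fun t => P.Glob t ∧ t.v vq = q ∧ t.v t1 = col + q * P.B) ?_ ?_) (by rw [Nat.succ_mul]; nlinarith)
  · refine ((Tri.of_wp (Q := fun t => t.v vq = q ∧ t.v t1 = col + q * P.B) ?_).mono ?_
      fun t hag h => ⟨hg.agree hag rfl, h⟩)
    · simp only [wp, opOk, opNat, Opd.val_var, Opd.val_lit, St.setV_v,
        reduceCtorEq, if_true, if_false, hg.vB, hq, hr.vcol, and_true]
      exact ⟨hP.scratch sq rfl _ (by omega), by omega, by omega⟩
    · simp only [Cmd.scost, Arr.large, Bool.false_eq_true, if_false]; omega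
  rintro s1 - ⟨hg1, h1, h2⟩
  refine (Tri.forStore (k := W) 0 (fun i => (col + q * P.B + i) * P.big + q) (4 * E.cs) P.B
    (hi := .var vB) hg1.vB (by omega) rfl rfl ?_).mono le_rfl fun t _ h c c1 c2 c3 => ?_
  · intro j t hj htj hag _
    have hg2 := hg1.agree hag rfl
    refine (Tri.of_wp ?_).mono ?_ fun _ _ h => h
    · have h3 : (col + q * P.B + j) * P.big + P.big ≤ (P.m + P.n + P.B + 4) * P.big := by
        rw [← Nat.succ_mul]; exact Nat.mul_le_mul_right _ (by omega)
      have h4 := hP.w2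
      have h5 : q ≤ P.kk := by
        have := (Nat.le_div_iff_mul_le hP.B_pos).2 hq1
        have := hR.tl_le hP
        omega
      have e1 : t.v t1 = col + q * P.B := by rw [hag.v _ rfl, h2]
      have e2 : t.v vq = q := by rw [hag.v _ rfl, h1]
      simp only [wp, opOk, opNat, Opd.val_var, St.setV_v, St.setV_a, reduceCtorEq,
            if_true, if_false, htj, e1, e2, hg2.vbig, setA_a_self, zero_add, and_true]
      exact ⟨by omega, by omega, by omega, hP.scratch W rfl _ (by omega)⟩
    · simp only [Cmd.scost, Arr.large, Bool.false_eq_true, if_false]; omega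
  · have h3 := h.1 (c - q * P.B) (by rw [Nat.succ_mul] at c2; omega)
    rw [zero_add] at h3
    have h4 : (P.rect col).top 0 c = t.a W (c - q * P.B) := by
      rw [Rect.top_zero, h3]
      change (col + c) * P.big + c / P.B = _
      rw [Nat.div_eq_of_lt_le c1 c2, show col + q * P.B + (c - q * P.B) = col + c by omega]
    rw [← h4]
    refine ⟨le_rfl, ?_, fun _ => rfl⟩
    rw [← Rect.cell_zero]
    exact (Par.cell_le hcn (hR.fits hP) (by omega) (by omega) c3).trans (Nat.le_add_right _ _)

/-- The hypothesis, supplied by `Fits.tile_le_succ`, makes the truncated differences genuine, so the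
sum telescopes. This is why a corridor costs `kk + nb` tiles and not `kk * nb`. -/
theorem sum_tiles {q : ℕ → ℕ} {j : ℕ} (h : ∀ l < j, q l ≤ q (l + 1) + 1) :
    ∑ l ∈ Finset.Ico 0 j, (q (l + 1) + 1 - q l) + q 0 = q j + j := by
  induction j with
  | zero => simp
  | succ j ih =>
    rw [← Finset.range_eq_Ico, Finset.sum_range_succ, Finset.range_eq_Ico]
    have := ih fun l hl => h l (by omega)
    have := h j (by omega)
    omega

/-- The corridor is traversed from line `0`, whose values are explicit, down to line `j`. Its last
tile is `t`, because `τ` determines the tile on line `j`. -/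
theorem eval_spec (hP : P.Ok E) (hR : RectOk P col kt) {s : St}
    (hg : P.Glob s) (hr : RectSt P col kt s) {j : ℕ} (ht : TabSt P col kt j s) (hj : j < P.nb)
    (hvj : s.v vj = j) {τ t : ℕ} (hτ : s.v vtau = τ) (hτw : τ < 2 ^ E.w)
    (hq : (P.rect col).IsTile kt j τ t) (hacc : ∀ i < P.B, s.a acc i ≤ P.inf + P.big) :
    Tri E eval s (evalCost E P) fun s' => ∃ V, LineVal P col kt j τ t V ∧
      ∀ i < P.B, s'.a acc i = min (s.a acc i) (V i) := by
  obtain ⟨hb1, hb2, hb3, hb4, hb5⟩ := Par.bounds hP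
  have hnb := hP.nb_le
  have hB := hP.B_pos
  have hltm := hP.lt_m
  have hf := hR.fits hP
  obtain ⟨q, e, hqe⟩ := hf.exists_tiles j τ
  have hqt : q j = t := by
    have := hqe.tile j le_rfl
    rw [hqe.last] at this
    exact this.unique hq
  have hlm : ∀ l < j, l * P.B + P.B ≤ P.m := by
    intro l hl
    have : (l + 1) * P.B ≤ (P.nb - 1) * P.B := Nat.mul_le_mul_right _ (by omega)
    rw [Nat.succ_mul] at this
    omega
  -- The subtraction in `Tiles.step` is not truncated: the table entry of tile `q` is at least `q`
  -- and at most the count.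
  have hee : ∀ l < j, e (l + 1) = e l + q (l + 1) := by
    intro l hl
    have h1 := hqe.step l hl
    have h2 := hqe.tile (l + 1) hl
    have h3 := (hf.le_tab (by omega) h2.le).trans h2.tab_le
    omega
  have hqB : ∀ l ≤ j, q l * P.B ≤ kt := fun l hl =>
    (Nat.le_div_iff_mul_le hB).1 (hqe.tile l hl).le
  have hqs : ∀ l < j, q l ≤ q (l + 1) + 1 := by
    intro l hl
    refine hf.tile_le_succ (by omega) (hqe.tile (l + 1) hl) ?_
    have := hqe.tile l hl.le
    rwa [hqe.step l hl] at this
  unfold eval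
  refine Tri.cost (Tri.seq (findTiles_spec hP hR hg hr ht hj hvj hτ hτw hqe) ?_
    (Q' := fun s' => ∃ V, LineVal P col kt j τ t V ∧
      ∀ i < P.B, s'.a acc i = min (s.a acc i) (V i))
    (N' := (P.B + 1) * (6 * E.cs) + ((∑ l ∈ Finset.Ico 0 j,
      (bandCost E P (q l) (q (l + 1)) + 2 * E.cs) + 2 * E.cs) +
      (P.B * (5 * E.cs + 2 * E.cs) + 2 * E.cs)))) ?_
  · intro s1 hag1 hsq
    have hg1 := hg.agree hag1 rfl
    have hr1 := hr.agree hag1 rfl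
    refine Tri.seq (evalInit_spec hP hR (τ := e 0) hg1 hr1 (hsq 0 (by omega)) (hqB 0 (by omega))) ?_
    intro s2 hag2 hW
    have hg2 := hg1.agree hag2 rfl
    have hr2 := hr1.agree hag2 rfl
    have hsq2 : ∀ l ≤ j, s2.a sq l = q l := by rw [hag2.a _ rfl]; exact hsq
    refine Tri.seq (Tri.for (Inv := fun k t => LineVal P col kt k (e k) (q k) (t.a W)) _ 0 j rfl
      (show s2.v vj = j by rw [hag2.v _ rfl, hag1.v _ rfl, hvj]) (by omega) (by omega) rfl rfl hW ?_) ?_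
    · intro l t _ hl hvl hag hinv
      have hsq3 : ∀ l ≤ j, t.a sq l = q l := by rw [hag.a _ rfl]; exact hsq2
      exact (evalBand_spec hP hR (by omega) (hlm l hl) (hqe.tile l hl.le) (hqe.tile (l + 1) hl)
        (hee l hl) (hg2.agree hag rfl) (hr2.agree hag rfl) hvl (hsq3 l hl.le) (hsq3 (l + 1) hl)
        hinv).mono le_rfl fun _ _ h => h
    · rintro s3 hag3 ⟨hW3, -⟩
      have hg3 := hg2.agree hag3 rfl
      have hacc3 : s3.a acc = s.a acc := by rw [hag3.a _ rfl, hag2.a _ rfl, hag1.a _ rfl]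
      refine (Tri.forStore (k := acc) 0 (fun i => min (s.a acc i) (s3.a W i)) (5 * E.cs) P.B
        (hi := .var vB) hg3.vB (by omega) rfl rfl ?_).mono le_rfl fun t _ h => ⟨s3.a W, ?_, ?_⟩
      · intro i t hi hti hag hacc4
        have h1 := hacc4 i (by omega)
        rw [hacc3] at h1
        have h2 := hacc i hi
        refine (Tri.of_wp ?_).mono ?_ fun _ _ h => h
        · simp only [wp, wp_setMin, Opd.val_var, St.setV_v, St.setV_a, reduceCtorEq,
            if_true, if_false, hti, setA_a_self, zero_add, h1, hag.a W rfl, and_true]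
          exact ⟨hP.scratch W rfl _ (by omega), hP.scratch acc rfl _ (by omega), by omega,
            hP.scratch acc rfl _ (by omega)⟩
        · simp only [Cmd.scost, Cmd.setMin, Arr.large, Bool.false_eq_true, if_false]; omega
      · rw [Nat.max_eq_right (Nat.zero_le _), hqe.last, hqt] at hW3
        exact hW3
      · intro i hi
        simpa using h.1 i hi
  · have h1 := sum_tiles hqs
    have h2 : q j ≤ P.kk := (hqe.tile j le_rfl).le.trans (hR.tl_le hP)
    have h3 : ∑ l ∈ Finset.Ico 0 j, (bandCost E P (q l) (q (l + 1)) + 2 * E.cs) ≤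
        (P.kk + P.nb) * (P.B * (colCost E P + 2 * E.cs)) +
          P.nb * ((P.B + 2) * (22 * E.cs + 2 * E.cr)) := by
      simp only [bandCost, Finset.sum_add_distrib, Finset.sum_const, Nat.card_Ico, smul_eq_mul]
      rw [← Finset.sum_mul]
      have h4 := Nat.mul_le_mul_right (P.B * (colCost E P + 2 * E.cs))
        (show ∑ l ∈ Finset.Ico 0 j, (q (l + 1) + 1 - q l) ≤ P.kk + P.nb by omega)
      have h5 : (j - 0) * ((P.B + 2) * (22 * E.cs + 2 * E.cr)) ≤
        P.nb * ((P.B + 2) * (22 * E.cs + 2 * E.cr)) := Nat.mul_le_mul_right _ (by omega)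
      have h6 : (j - 0) * ((P.B + 2) * (20 * E.cs + 2 * E.cr)) + (j - 0) * (2 * E.cs) ≤
          (j - 0) * ((P.B + 2) * (22 * E.cs + 2 * E.cr)) := by
        rw [← Nat.mul_add]
        exact Nat.mul_le_mul_left _ (by nlinarith)
      omega
    unfold evalCost
    have h7 : (P.nb + 1) * ((P.kk + 2) * (10 * E.cs + E.cr)) + ((P.B + 1) * (6 * E.cs) +
        ((P.nb * ((P.B + 2) * (22 * E.cs + 2 * E.cr)) + 2 * E.cs) +
        (P.B * (5 * E.cs + 2 * E.cs) + 2 * E.cs))) ≤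
        (P.nb + 1) * ((P.B + P.kk + 4) * (40 * E.cs + 3 * E.cr)) := by
      generalize E.cs = x
      generalize E.cr = y
      generalize P.B = B
      generalize P.kk = k
      generalize P.nb = b
      have : (b + 1) * ((B + k + 4) * (40 * x + 3 * y)) =
        (b + 1) * ((k + 2) * (10 * x + y)) + ((B + 1) * (6 * x) +
        ((b * ((B + 2) * (22 * x + 2 * y)) + 2 * x) +
        (B * (5 * x + 2 * x) + 2 * x))) + ((b + 1) * (k * (30 * x + 2 * y)) +
        (b * (B * (18 * x + y) + 96 * x + 6 * y)) + B * (27 * x + 3 * y) + (130 * x + 10 * y)) := by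
          ring
      omega
    omega

end
end AsymDP

/-! ### Reconstruction and sweep of one tile -/

namespace AsymDP
open Var Arr

/-- Compute line `vj` on tile `vt`. -/
def tileLine : Cmd :=
  fill acc vinf vB ;;
  (.op t0 .mul vj vst ;; .op t0 .add vN0 t0 ;; .op t0 .add t0 vt ;; .load t1 tb t0 ;;
    .op t0 .add t0 (.lit 1) ;; .load vtauhi tb t0) ;;
  .for vtau t1 vtauhi eval

/-- Sweep band `vj` over tile `vt`. -/
def tileSweep : Cmd :=
  (.op vct .mul vt vB ;; .op vchi .add vct vB ;; .op t0 .add vkt (.lit 1) ;; .setMin vchi t0 ;;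
    .mov snr vbl ;; .mov sr vr0) ;;
  .for vc vct vchi
    ((.op t0 .sub vc vct ;; .load stp acc t0 ;; .mov sc vc) ;; sweepCol F1 X1 ;;
      .ite (.eq vc vct) (.load vd F1 vbl) .skip) ;;
  (.op vd .mod vd vbig ;; .op vd .add vd vt ;; .op vu .add vj (.lit 1) ;; .op vu .mul vu vst ;;
    .op vu .add vN0 vu ;; .op vu .add vu vt ;; .store tb vu vd)

/-- The state while band `j` is processed. -/
structure StageSt (P : Par) (col kt j bl : ℕ) (s : St) : Prop where
  glob : P.Glob s
  rect : RectSt P col kt s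
  vj : s.v vj = j
  vbl : s.v vbl = bl
  vr0 : s.v vr0 = j * P.B
  hX : ∀ i < bl, s.a X1 i = P.x (j * P.B + i)

def Cmd.keepsStage (p : Cmd) : Bool :=
  p.keepsGlob && (p.keepsRect && ([Var.vj, .vbl, .vr0].all (fun x => !p.modV x) && !p.modA X1))

theorem StageSt.agree {P : Par} {col kt j bl : ℕ} {s t : St} (h : StageSt P col kt j bl s) {p : Cmd}
    (hag : Agree p s t) (hp : p.keepsStage = true) : StageSt P col kt j bl t := by
  simp only [Cmd.keepsStage, List.all_cons, List.all_nil, Bool.and_eq_true, Bool.not_eq_true',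
    Bool.and_true] at hp
  obtain ⟨h1, h2, ⟨h3, h4, h5⟩, h9⟩ := hp
  constructor
  · exact h.glob.agree hag h1
  · exact h.rect.agree hag h2
  · rw [hag.v _ h3, h.vj]
  · rw [hag.v _ h4, h.vbl]
  · rw [hag.v _ h5, h.vr0]
  · rw [hag.a _ h9]; exact h.hX

section
variable {E : Env} {P : Par} {col kt : ℕ}

theorem tab_lt_word (hP : P.Ok E) (hR : RectOk P col kt) (l t : ℕ) :
    (P.rect col).tab kt l t < 2 ^ E.w := by
  obtain ⟨hb1, hb2, hb3, hb4, hb5⟩ := Par.bounds hP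
  have hf := hR.fits hP
  have h1 : (P.rect col).tab kt l t ≤ (P.rect col).big := by
    unfold Rect.tab
    split
    · exact (hf.phi_lt _).le
    · exact hf.phi_lt _
  change _ ≤ P.big at h1
  omega

/-- Every column of the tile has its count between the two consecutive table entries. The evaluation
for that count is exact there and all others give upper bounds, so the minimum over the interval is
exact. -/
theorem tileLine_spec (hP : P.Ok E) (hR : RectOk P col kt) {j bl t : ℕ} (hj : j < P.nb)
    (ht : t ≤ kt / P.B) {s : St} (hs : StageSt P col kt j bl s) (htab : TabSt P col kt j s)
    (hvt : s.v vt = t) :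
    Tri E tileLine s (((P.rect col).tab kt j (t + 1) - (P.rect col).tab kt j t) *
        (evalCost E P + 2 * E.cs) + (P.B + 4) * (3 * E.cs + E.cr)) fun s' =>
      ∀ c, t * P.B ≤ c → c < (t + 1) * P.B → c ≤ kt →
        s'.a acc (c - t * P.B) = (P.rect col).top j c := by
  obtain ⟨hb1, hb2, hb3, hb4, hb5⟩ := Par.bounds hP
  have hf := hR.fits hP
  have hkn := hR.tl_le hP
  unfold tileLine
  set lo := (P.rect col).tab kt j t with hlo
  set hi := (P.rect col).tab kt j (t + 1) with hhi
  have hlohi : lo ≤ hi := hf.tab_mono_succ hj.le ht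
  refine Tri.cost (Tri.seq (fill_spec (k := acc) (x := .var vinf) (hi := .var vB) rfl hs.glob.vinf
    hs.glob.vB (by omega) rfl rfl fun i hi => hP.scratch acc rfl i (by omega))
    (N' := (4 * E.cs + 2 * E.cr) + ((hi - lo) * (evalCost E P + 2 * E.cs) + 2 * E.cs)) ?_) ?_
  · intro s1 hag1 hacc
    have hs1 := hs.agree hag1 rfl
    have htab1 := htab.agree hag1 rfl
    obtain ⟨a1, a2⟩ := hP.oktb' (l := j) (t := t) hj.le (by omega)
    obtain ⟨a3, a4⟩ := hP.oktb' (l := j) (t := t + 1) hj.le (by omega)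
    have a5 := htab1 j le_rfl t (by omega)
    have a6 := htab1 j le_rfl (t + 1) (by omega)
    rw [← add_assoc] at a3 a4 a6
    refine Tri.seq (Q := fun s' => s'.v t1 = lo ∧ s'.v vtauhi = hi) ?_ ?_
    · refine (Tri.of_wp ?_).mono ?_ fun _ _ h => h
      · have e1 : s1.v vt = t := by rw [hag1.v _ rfl, hvt]
        simp only [wp, opOk, opNat, Opd.val_var, Opd.val_lit, St.setV_v, St.setV_a, reduceCtorEq,
            if_true, if_false, hs1.vj, hs1.glob.vst, hs1.glob.vN0, e1, a5, a6]
        exact ⟨by omega, by omega, a2, a1, a4, a3, rfl, rfl⟩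
      · simp only [Cmd.scost, Arr.large, if_true]; omega
    rintro s2 hag2 ⟨b1, b2⟩
    have hs2 := hs1.agree hag2 rfl
    have htab2 := htab1.agree hag2 rfl
    have hacc2 : ∀ i < P.B, s2.a acc i = P.inf := by rw [hag2.a _ rfl]; exact hacc
    refine (Tri.for_const (Inv := fun k s' => (∀ i < P.B, s'.a acc i ≤ P.inf + P.big) ∧
      ∀ c, t * P.B ≤ c → c < (t + 1) * P.B → c ≤ kt →
        (P.rect col).top j c ≤ s'.a acc (c - t * P.B) ∧
        ((P.rect col).phi ((P.rect col).top j c) < k →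
          s'.a acc (c - t * P.B) = (P.rect col).top j c)) (evalCost E P) lo hi (lo := .var t1)
      (hi := .var vtauhi) b1 b2 (tab_lt_word hP hR _ _)
      (tab_lt_word hP hR _ _) rfl rfl ?_ ?_).mono le_rfl ?_
    · refine ⟨fun i hi => ?_, fun c c1 c2 c3 => ⟨?_, fun h => ?_⟩⟩
      · rw [St.setV_a, hacc2 i hi]; omega
      · rw [St.setV_a, hacc2 _ (by rw [Nat.succ_mul] at c2; omega), ← Rect.cell_zero]
        refine Par.cell_le hR.col_le hf hj.le ?_ c3
        have := Nat.mul_le_mul_right P.B (show j ≤ P.nb - 1 by omega)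
        have := hP.lt_m
        omega
      · have h1 := (hf.tab_div hj.le c3).1
        change (P.rect col).tab kt j (c / P.B) ≤ _ at h1
        rw [Nat.div_eq_of_lt_le c1 c2] at h1
        omega
    · rintro τ s3 h1 h2 hτ hag3 ⟨i1, i2⟩
      have hs3 := hs2.agree hag3 rfl
      have htab3 := htab2.agree hag3 rfl
      have hhw := tab_lt_word hP hR j (t + 1)
      have htile := hf.isTile_of_mem hj.le ht h1 h2
      refine (eval_spec hP hR hs3.glob hs3.rect htab3 hj hs3.vj hτ (by omega) htile i1).mono le_rfl ?_
      rintro s4 - ⟨V, hV, hacc4⟩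
      refine ⟨fun i hi => ?_, fun c c1 c2 c3 => ?_⟩
      · rw [St.setV_a, hacc4 i hi]
        exact (min_le_left _ _).trans (i1 i hi)
      · rw [St.setV_a, hacc4 _ (by rw [Nat.succ_mul] at c2; omega)]
        obtain ⟨v1, v2, v3⟩ := hV c c1 c2 c3
        obtain ⟨u1, u2⟩ := i2 c c1 c2 c3
        refine ⟨le_min u1 v1, fun h => ?_⟩
        -- Columns with a smaller count were settled in earlier iterations and are not lowered now,
        -- since `V` is an upper bound. Columns with count `τ` become exact in this one.
        rcases Nat.lt_or_ge ((P.rect col).phi ((P.rect col).top j c)) τ with h' | h'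
        · rw [u2 h', min_eq_left v1]
        · rw [v3 (by omega), min_eq_right u1]
    · rintro s3 - ⟨⟨-, i2⟩, -⟩ c c1 c2 c3
      refine (i2 c c1 c2 c3).2 ?_
      have h1 := (hf.tab_div hj.le c3).2
      change _ < (P.rect col).tab kt j (c / P.B + 1) at h1
      rw [Nat.div_eq_of_lt_le c1 c2] at h1
      exact lt_of_lt_of_le h1 (le_max_right _ _)
  · nlinarith

/-- With the line known exactly, the exact column in `F1` is carried across the tile and on to the
next one, so each band is swept once. The bottom value in the first column of the tile gives its
table entry on the next line, which is the only write. -/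
theorem tileSweep_spec (hP : P.Ok E) (hR : RectOk P col kt) {j bl t : ℕ} (hj : j < P.nb)
    (hbl : bl ≤ P.B) (hblm : j * P.B + bl ≤ P.m) (ht : t ≤ kt / P.B) {s : St}
    (hs : StageSt P col kt j bl s) (hvt : s.v vt = t)
    (hacc : ∀ c, t * P.B ≤ c → c < (t + 1) * P.B → c ≤ kt →
        s.a acc (c - t * P.B) = (P.rect col).top j c)
    (hF : 0 < t → (P.rect col).Col (fun _ => True) j bl (t * P.B - 1) (s.a F1) ∧
      ∀ i ≤ bl, s.a F1 i ≤ P.inf + P.big) :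
    Tri E tileSweep s (P.B * (colCost E P + 2 * E.cs) + (P.B + 1) * (16 * E.cs + E.cr) + E.cw)
      fun s' =>
      ((P.rect col).Col (fun _ => True) j bl (min (t * P.B + P.B) (kt + 1) - 1) (s'.a F1) ∧
        ∀ i ≤ bl, s'.a F1 i ≤ P.inf + P.big) ∧
      s'.a tb = Function.update (s.a tb) (P.N0 + (j + 1) * (P.kk + 2) + t)
        ((P.rect col).phi ((P.rect col).cell j bl (t * P.B)) + t) := by
  obtain ⟨hb1, hb2, hb3, hb4, hb5⟩ := Par.bounds hP
  have hf := hR.fits hP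
  have hcn := hR.col_le
  have hkn := hR.tl_le hP
  have hB := hP.B_pos
  have htk : t * P.B ≤ kt := (Nat.le_div_iff_mul_le hB).1 ht
  unfold tileSweep
  set hi := min (t * P.B + P.B) (kt + 1) with hhi
  refine Tri.cost (Tri.seq (Q := fun s' => s'.v vct = t * P.B ∧ s'.v vchi = hi ∧ s'.v snr = bl ∧
    s'.v sr = j * P.B) (N := 7 * E.cs) (N' := ((∑ k ∈ Finset.Ico (t * P.B) hi,
      ((colCost E P + (if k = 0 then P.B * E.cr else 0)) + 2 * E.cs)) + 2 * E.cs) +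
        (6 * E.cs + E.cw)) ?_ ?_) ?_
  · refine (Tri.of_wp ?_).mono ?_ fun _ _ h => h
    · simp only [wp, wp_mov, wp_setMin, opOk, opNat, Opd.val_var, Opd.val_lit, St.setV_v,
        reduceCtorEq, if_true, if_false, hs.vbl, hs.vr0, hs.glob.vB, hs.rect.vkt, hvt, and_true,
        true_and]
      exact ⟨by omega, by omega, by omega, by omega, by omega, by omega, rfl⟩
    · simp only [Cmd.scost, Cmd.mov, Cmd.setMin]; omega
  · rintro s1 hag1 ⟨b1, b2, b3, b4⟩
    have hs1 := hs.agree hag1 rfl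
    have hacc1 : s1.a acc = s.a acc := by rw [hag1.a _ rfl]
    refine Tri.seq (Tri.for (Inv := fun k s' => (0 < k →
      (P.rect col).Col (fun _ => True) j bl (k - 1) (s'.a F1) ∧
        ∀ i ≤ bl, s'.a F1 i ≤ P.inf + P.big) ∧
      (t * P.B < k → s'.v vd = (P.rect col).cell j bl (t * P.B))) _ (t * P.B) hi b1 b2
      (by omega) (by omega) rfl rfl ?_ ?_) ?_
    · refine ⟨fun h => ?_, fun h => by omega⟩
      rw [St.setV_a, hag1.a _ rfl]
      exact hF (Nat.pos_of_ne_zero fun h0 => by rw [h0] at h; omega)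
    · rintro k s2 h1 h2 hk hag2 ⟨i1, i2⟩
      have hs2 := hs1.agree hag2 rfl
      have c2 : k < (t + 1) * P.B := by rw [Nat.succ_mul]; omega
      have c3 : k ≤ kt := by omega
      have hacc2 := hacc k h1 c2 c3
      rw [← hacc1, ← hag2.a _ rfl] at hacc2
      have e1 : s2.v vct = t * P.B := by rw [hag2.v _ rfl, b1]
      have htop : (P.rect col).top j k ≤ P.inf := by
        rw [← Rect.cell_zero]
        exact Par.cell_le hcn hf hj.le (by omega) c3
      refine Tri.cost (Tri.seq (N := 3 * E.cs) (N' := sweepCost E bl k + 2 * E.cs)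
        (Q := fun s' => SweepPre P col kt F1 X1 (fun _ => True) j bl k s') ?_ ?_) ?_
      · refine ((Tri.of_wp (Q := fun s' => s'.v sc = k ∧ s'.v stp = (P.rect col).top j k) ?_).mono
          ?_ ?_)
        · simp only [wp, wp_mov, opOk, opNat, Opd.val_var, St.setV_v, St.setV_a, reduceCtorEq,
            if_true, if_false, hk, e1, hacc2, and_true]
          exact ⟨h1, hP.scratch acc rfl _ (by omega), by omega⟩
        · simp only [Cmd.scost, Cmd.mov, Arr.large, Bool.false_eq_true, if_false]; omega
        · rintro s3 hag3 ⟨f1, f2⟩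
          have hs3 := hs2.agree hag3 rfl
          refine ⟨hs3.glob, hs3.rect, f1, ?_, ?_, hs3.hX, by omega, by omega, fun _ => f2,
            fun h0 => by rw [hag3.a _ rfl]; exact i1 h0⟩
          · rw [hag3.v _ rfl, hag2.v _ rfl, b3]
          · rw [hag3.v _ rfl, hag2.v _ rfl, b4]
      · intro s3 hag3 hs3
        refine Tri.seq (sweepCol_spec hP hcn hf .one hj.le hbl hblm c3 hs3) ?_
        rintro s4 hag4 ⟨f1, f2, -⟩
        have hs4 := (hs2.agree hag3 rfl).agree hag4 rfl
        have hk4 : s4.v vc = k := by rw [hag4.v _ rfl, hag3.v _ rfl, hk]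
        have e4 : s4.v vct = t * P.B := by rw [hag4.v _ rfl, hag3.v _ rfl, e1]
        have hd4 : s4.v vd = s2.v vd := by rw [hag4.v _ rfl, hag3.v _ rfl]
        have f3 := (f1 bl le_rfl).2 trivial
        refine ((Tri.of_wp (Q := fun t' => t'.a F1 = s4.a F1 ∧
          (t * P.B < k + 1 → t'.v vd = (P.rect col).cell j bl (t * P.B))) ?_).mono ?_ ?_)
        · simp only [wp, Opd.val_var, St.setV_v, St.setV_a, if_true, hk4, e4, hs4.vbl, Cnd.holds_eq,
            true_and, f3]
          refine ⟨fun h => ⟨hP.scratch F1 rfl _ hbl, fun _ => by rw [h]⟩, fun h h' => ?_⟩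
          rw [hd4]
          exact i2 (by omega)
        · simp only [Cmd.scost, Arr.large, Bool.false_eq_true, if_false]; omega
        · rintro s5 - ⟨g1, g2⟩
          rw [St.setV_a, g1]
          exact ⟨fun _ => ⟨f1, f2⟩, fun h => by simpa using g2 h⟩
      · unfold sweepCost colCost
        have h3 : (bl + 1) * (30 * E.cs) ≤ (P.B + 1) * (30 * E.cs) := Nat.mul_le_mul_right _ (by omega)
        have h4 : bl * E.cr ≤ P.B * E.cr := Nat.mul_le_mul_right _ hbl
        have h5 : (P.B + 1) * (50 * E.cs) = (P.B + 1) * (30 * E.cs) + 20 * (P.B * E.cs) + 20 * E.cs := by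
          ring
        split <;> omega
    · rintro s2 hag2 ⟨⟨i1, i2⟩, -⟩
      have hmax : max (t * P.B) hi = hi := by omega
      rw [hmax] at i1 i2
      have hs2 := hs1.agree hag2 rfl
      have e1 : s2.v vt = t := by rw [hag2.v _ rfl, hag1.v _ rfl, hvt]
      have e2 : s2.a tb = s.a tb := by rw [hag2.a _ rfl, hag1.a _ rfl]
      have i2 := i2 (by omega)
      have i1 := i1 (by omega)
      obtain ⟨a1, a2⟩ := hP.oktb' (l := j + 1) (t := t) (by omega) (by omega)
      have hph := hf.phi_lt ((P.rect col).cell j bl (t * P.B))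
      change _ < P.big at hph
      have hnb := hP.nb_le
      have hnbB : P.nb ≤ P.nb * P.B := Nat.le_mul_of_pos_right _ hB
      have hw6 := hP.w6
      rw [Nat.succ_mul] at hw6
      refine ((Tri.of_wp (Q := fun t' => t'.a F1 = s2.a F1 ∧
          t'.a tb = Function.update (s2.a tb) (P.N0 + (j + 1) * (P.kk + 2) + t)
        ((P.rect col).phi ((P.rect col).cell j bl (t * P.B)) + t)) ?_).mono ?_ ?_)
      · simp only [wp, opOk, opNat, Opd.val_var, Opd.val_lit, St.setV_v, St.setV_a, reduceCtorEq,
            if_true, if_false, hs2.vj, hs2.glob.vst, hs2.glob.vN0, e1, i2, hs2.glob.vbig, setA_a_self]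
        change True ∧ (P.rect col).phi ((P.rect col).cell j bl (t * P.B)) + t < _ ∧ _
        refine ⟨trivial, by omega, by omega, by omega, by omega, a2, a1, ?_, rfl⟩
        ext i
        simp
      · simp only [Cmd.scost, Arr.large, if_true]; omega
      · rintro s3 - ⟨g1, g2⟩
        rw [g1, g2, e2]
        exact ⟨i1, rfl⟩
  · have h1 : ∑ k ∈ Finset.Ico (t * P.B) hi,
        ((colCost E P + (if k = 0 then P.B * E.cr else 0)) + 2 * E.cs) ≤
        (hi - t * P.B) * (colCost E P + 2 * E.cs) + P.B * E.cr := by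
      have : ∀ k, (colCost E P + (if k = 0 then P.B * E.cr else 0)) + 2 * E.cs =
        (colCost E P + 2 * E.cs) + (if k = 0 then P.B * E.cr else 0) := fun k => by ring
      simp only [this, Finset.sum_add_distrib, Finset.sum_const, Nat.card_Ico, smul_eq_mul]
      rw [Finset.sum_ite_eq' (Finset.Ico (t * P.B) hi) 0, Nat.mul_add (hi - t * P.B)]
      split
      · rfl
      · exact Nat.add_le_add_left (Nat.zero_le _) _
    have h2 : (hi - t * P.B) * (colCost E P + 2 * E.cs) ≤
        P.B * (colCost E P + 2 * E.cs) := Nat.mul_le_mul_right _ (by omega)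
    nlinarith

end
end AsymDP

/-! ### Bands, rectangles and the whole grid -/

namespace AsymDP
open Var Arr

/-- Process band `vj`. -/
def stage : Cmd :=
  (.op vr0 .mul vj vB ;; .op vbl .sub vm vr0 ;; .setMin vbl vB ;; .op vres .add vtl (.lit 1)) ;;
  loadX X1 vr0 vbl ;; .for vt (.lit 0) vres (tileLine ;; tileSweep) ;;
  (.load vd F1 vbl ;; .op vd .mod vd vbig ;; .op vd .add vd vtl ;; .op vd .add vd (.lit 1) ;;
    .op vu .add vj (.lit 1) ;; .op vu .mul vu vst ;; .op vu .add vN0 vu ;; .op vu .add vu vtl ;;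
    .op vu .add vu (.lit 1) ;; .store tb vu vd ;;
    .op t1 .add vN0 vr0 ;; .op t1 .add t1 (.lit 1)) ;;
  .for vi (.lit 0) vbl
    (.op t0 .add vi (.lit 1) ;; .load sold F1 t0 ;; .op sold .div sold vbig ;;
      .op sold .mul sold vbig ;; .op t0 .add t1 vi ;; .store ra t0 sold)

/-- Process rectangle `vrho`. -/
def rectangle : Cmd :=
  (.op vcol .mul vrho vK ;; .op vkt .sub vn vcol ;; .setMin vkt vK ;; .op vtl .div vkt vB ;;
    .op t1 .add vtl (.lit 2)) ;;
  .for vi (.lit 0) t1 (.op t0 .add vN0 vi ;; .store tb t0 vi) ;;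
  .for vj (.lit 0) vnb stage ;;
  .op t1 .add vm (.lit 1) ;;
  .for vi (.lit 0) t1 (.op t0 .add vN0 vi ;; .load sold ra t0 ;; .store la t0 sold)

/-- Compute the distance in the whole grid. -/
def mainLoop : Cmd :=
  .op t1 .add vm (.lit 1) ;;
  .for vi (.lit 0) t1 (.op sold .mul vi vbig ;; .op t0 .add vN0 vi ;; .store la t0 sold) ;;
  (.op t0 .add vn vK ;; .op t0 .sub t0 (.lit 1) ;; .op vnr .div t0 vK) ;;
  .for vrho (.lit 0) vnr rectangle ;;
  (.op t0 .add vN0 vm ;; .load vres la t0 ;; .op vres .div vres vbig)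

/-- The dominating middle term counts one evaluation for each tile count on the line. The writes are
one table entry per tile and the right boundary of the band. -/
def stageCost (E : Env) (P : Par) : ℕ :=
  (P.kk + 1) * (P.B * (colCost E P + 2 * E.cs) + (P.B + 4) * (21 * E.cs + 2 * E.cr) + E.cw) +
    (P.nb * P.kk + 1) * (evalCost E P + 2 * E.cs) + (P.B + 1) * (30 * E.cs + E.cr + E.cw)

def rectCost (E : Env) (P : Par) : ℕ :=
  P.nb * (stageCost E P + 2 * E.cs) + (P.kk + 2) * (12 * E.cs + E.cw) +
    (P.m + 1) * (6 * E.cs + E.cr + E.cw)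

def mainCost (E : Env) (P : Par) : ℕ :=
  ((P.n + P.kk * P.B - 1) / (P.kk * P.B)) * (rectCost E P + 2 * E.cs) +
    (P.m + 1) * (20 * E.cs + E.cr + E.cw)

section
variable {E : Env} {P : Par} {col kt : ℕ}

/-- The numbers of evaluations telescope over the tiles of a line, as the intervals of counts are
adjacent and start at `0`. -/
theorem sum_tab (hf : (P.rect col).Fits kt P.nb) {j : ℕ} (hj : j ≤ P.nb) {u : ℕ}
    (hu : u ≤ kt / P.B + 1) :
    ∑ t ∈ Finset.Ico 0 u, ((P.rect col).tab kt j (t + 1) - (P.rect col).tab kt j t) =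
      (P.rect col).tab kt j u := by
  induction u with
  | zero => simp [Rect.tab_zero_right]
  | succ u ih =>
    have h2 := hf.tab_mono_succ hj (t := u) (Nat.le_of_succ_le_succ hu)
    rw [← Finset.range_eq_Ico, Finset.sum_range_succ, Finset.range_eq_Ico,
      ih (Nat.le_of_succ_le hu)]
    omega

/-- The step from the tables of lines up to `j` to that of line `j + 1`. The right boundary goes to
`ra` and not to `la`, because evaluations for later bands start again from line `0` and still need
the old left boundary. -/
theorem stage_spec (hP : P.Ok E) (hR : RectOk P col kt) {j bl : ℕ} (hj : j < P.nb)
    (hbl : bl = min (P.m - j * P.B) P.B) {s : St} (hg : P.Glob s) (hr : RectSt P col kt s)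
    (htab : TabSt P col kt j s) (hvj : s.v vj = j) :
    Tri E stage s (stageCost E P) fun s' =>
      (j + 1 < P.nb → TabSt P col kt (j + 1) s') ∧
      (∀ i < bl, s'.a ra (P.N0 + j * P.B + 1 + i) = (P.rect (col + kt)).left (j * P.B + 1 + i)) ∧
      ∀ l < P.N0 + j * P.B + 1, s'.a ra l = s.a ra l := by
  obtain ⟨hb1, hb2, hb3, hb4, hb5⟩ := Par.bounds hP
  have hf := hR.fits hP
  have hcn := hR.col_le
  have hkn := hR.tl_le hP
  have hB := hP.B_pos
  have hnb := hP.nb_le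
  have hltm := hP.lt_m
  have hw1 := hP.w1
  have hw6 := hP.w6
  have hjm : j * P.B < P.m := lt_of_le_of_lt (Nat.mul_le_mul_right _ (by omega)) hltm
  have hkw : P.kk + 2 ≤ (P.nb + 2) * (P.kk + 2) := Nat.le_mul_of_pos_left _ (by omega)
  have htlw : kt / P.B + 1 < 2 ^ E.w := by omega
  have hnbB : P.nb ≤ P.nb * P.B := Nat.le_mul_of_pos_right _ hB
  rw [Nat.succ_mul] at hw6
  unfold stage
  set V := P.B * (colCost E P + 2 * E.cs) + (P.B + 1) * (16 * E.cs + E.cr) + E.cw with hV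
  refine Tri.cost (Tri.seq (Q := fun s' => s'.v vr0 = j * P.B ∧ s'.v vbl = bl ∧
      s'.v vres = kt / P.B + 1) (N := 5 * E.cs) (N' := (bl * (5 * E.cs + E.cr) + 2 * E.cs) +
      ((∑ t ∈ Finset.Ico 0 (kt / P.B + 1), (((((P.rect col).tab kt j (t + 1) -
        (P.rect col).tab kt j t) *
        (evalCost E P + 2 * E.cs) + (P.B + 4) * (3 * E.cs + E.cr)) + V) + 2 * E.cs) + 2 * E.cs) +
      ((11 * E.cs + E.cw) + (bl * ((5 * E.cs + E.cw) + 2 * E.cs) + 2 * E.cs)))) ?_ ?_) ?_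
  · refine (Tri.of_wp ?_).mono ?_ fun _ _ h => h
    · simp only [wp, wp_setMin, opOk, opNat, Opd.val_var, Opd.val_lit, St.setV_v,
        reduceCtorEq, if_true, if_false, hg.vB, hg.vm, hvj, hr.vtl, and_true,
        true_and]
      exact ⟨by omega, by omega, by omega, by omega, by omega⟩
    · simp only [Cmd.scost, Cmd.setMin]; omega
  rintro s1 hag1 ⟨b1, b2, b3⟩
  refine Tri.seq (loadX1_spec hP (hg.agree hag1 rfl) b1 b2 (by omega) (by omega)) ?_
  intro s2 hag2 hx
  have hs2 : StageSt P col kt j bl s2 := by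
    refine ⟨(hg.agree hag1 rfl).agree hag2 rfl, (hr.agree hag1 rfl).agree hag2 rfl, ?_, ?_, ?_, hx⟩
    · rw [hag2.v _ rfl, hag1.v _ rfl, hvj]
    · rw [hag2.v _ rfl, b2]
    · rw [hag2.v _ rfl, b1]
  have htab2 := (htab.agree hag1 rfl).agree hag2 rfl
  refine Tri.seq (Tri.for (Inv := fun k s' => (0 < k →
      (P.rect col).Col (fun _ => True) j bl (min (k * P.B) (kt + 1) - 1) (s'.a F1) ∧
        ∀ i ≤ bl, s'.a F1 i ≤ P.inf + P.big) ∧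
      (∀ u < k, s'.a tb (P.N0 + (j + 1) * (P.kk + 2) + u) =
        (P.rect col).phi ((P.rect col).cell j bl (u * P.B)) + u) ∧ TabSt P col kt j s') _ 0
      (kt / P.B + 1) rfl (hi := .var vres) (show s2.v vres = _ by rw [hag2.v _ rfl, b3]) (by omega)
      htlw rfl rfl ?_ ?_) ?_
  · exact ⟨fun h => by omega, fun u hu => by omega, htab2⟩
  · rintro t s3 - ht2 hvt hag3 ⟨i1, i2, i3⟩
    have ht2' : t ≤ kt / P.B := Nat.le_of_lt_succ ht2
    have htk : t * P.B ≤ kt := (Nat.le_div_iff_mul_le hB).1 ht2'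
    have hs3 := hs2.agree hag3 rfl
    refine Tri.seq (tileLine_spec hP hR hj ht2' hs3 i3 hvt) ?_
    intro s4 hag4 hacc
    refine (tileSweep_spec hP hR hj (by omega) (by omega) ht2' (hs3.agree hag4 rfl)
      (by rw [hag4.v _ rfl, hvt]) hacc ?_).mono le_rfl ?_
    · intro h0
      have := i1 h0
      rw [min_eq_left (by omega)] at this
      rw [hag4.a _ rfl]
      exact this
    · rintro s5 - ⟨j1, j2⟩
      rw [hag4.a tb rfl] at j2
      refine ⟨fun _ => ?_, fun u hu => ?_, fun l hl u hu => ?_⟩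
      · rw [Nat.succ_mul]; exact j1
      · rw [St.setV_a, j2, Function.update_apply]
        split
        · next h => rw [show u = t by omega]
        · exact i2 u (by omega)
      · have h1 : l * (P.kk + 2) + (P.kk + 2) ≤ (j + 1) * (P.kk + 2) := by
          rw [← Nat.succ_mul]; exact Nat.mul_le_mul_right _ (by omega)
        have h2 : u < P.kk + 2 := by omega
        rw [St.setV_a, j2, Function.update_apply, if_neg (by omega)]
        exact i3 l hl u hu
  · rintro s3 hag3 ⟨⟨i1, i2, i3⟩, -⟩
    rw [Nat.max_eq_right (Nat.zero_le _)] at i1 i2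
    -- The last tile ends at column `kt` and may be incomplete. In a full rectangle it consists of
    -- this column alone.
    have hlast : min ((kt / P.B + 1) * P.B) (kt + 1) - 1 = kt := by
      have := Nat.lt_div_mul_add (a := kt) hB
      rw [Nat.succ_mul]
      omega
    obtain ⟨i1, -⟩ := i1 (Nat.succ_pos _)
    rw [hlast] at i1
    have hs3 := hs2.agree hag3 rfl
    have hF := (i1 bl le_rfl).2 trivial
    obtain ⟨a1, a2⟩ := hP.oktb' (l := j + 1) (t := kt / P.B + 1) (by omega) (by omega)
    rw [← add_assoc] at a1 a2
    have hph := hf.phi_lt ((P.rect col).cell j bl kt)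
    change _ < P.big at hph
    refine Tri.seq (Q := fun t' => t'.v t1 = P.N0 + j * P.B + 1 ∧
      t'.a tb = Function.update (s3.a tb) (P.N0 + (j + 1) * (P.kk + 2) + kt / P.B + 1)
        ((P.rect col).phi ((P.rect col).cell j bl kt) + kt / P.B + 1)) ?_ ?_
    · refine (Tri.of_wp ?_).mono ?_ fun _ _ h => h
      · simp only [wp, opOk, opNat, Opd.val_var, Opd.val_lit, St.setV_v, St.setV_a, St.setA_v,
          reduceCtorEq, if_true, if_false, hs3.vj, hs3.vbl, hs3.vr0, hs3.glob.vst, hs3.glob.vN0,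
          hs3.rect.vtl, hF, hs3.glob.vbig, setA_a_self]
        change _ ∧ True ∧ (P.rect col).phi ((P.rect col).cell j bl kt) + kt / P.B < _ ∧
          (P.rect col).phi ((P.rect col).cell j bl kt) + kt / P.B + 1 < _ ∧ _
        exact ⟨hP.scratch F1 rfl _ (by omega), trivial, by omega, by omega, by omega, by omega,
          by omega, by omega, by omega, a1, by omega, by omega, trivial, rfl⟩
      · simp only [Cmd.scost, Arr.large, Bool.false_eq_true, if_false, if_true]; omega
    rintro s4 hag4 ⟨c1, c2⟩
    have hs4 := hs3.agree hag4 rfl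
    refine (Tri.forStore (k := ra) (P.N0 + j * P.B + 1)
      (fun i => (P.rect (col + kt)).left (j * P.B + 1 + i)) (5 * E.cs + E.cw) bl
      (hi := .var vbl) hs4.vbl (by omega) rfl rfl ?_).mono le_rfl ?_
    · intro i t hi hti hag _
      have hs5 := hs4.agree hag rfl
      have e1 : t.v t1 = P.N0 + j * P.B + 1 := by rw [hag.v _ rfl, c1]
      have e2 : t.a F1 (i + 1) = (P.rect col).cell j (i + 1) kt := by
        rw [hag.a _ rfl, hag4.a _ rfl]
        exact (i1 (i + 1) (by omega)).2 trivial
      -- Division and multiplication by `big` remove the tile count, which starts afresh at `0` in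
      -- the next rectangle.
      have e3 : (P.rect col).cell j (i + 1) kt / P.big * P.big =
          (P.rect (col + kt)).left (j * P.B + 1 + i) := by
        have h1 := (hf.phi_cell (r := i + 1) hj.le le_rfl).1
        have h2 := hf.phi_lt ((P.rect col).cell j (i + 1) kt)
        change _ < P.big at h2
        change _ = (P.rect col).dist (j * P.B + (i + 1)) (col + kt) * P.big + _ at h1
        rw [Nat.div_eq_of_lt_le (k := (P.rect col).dist (j * P.B + (i + 1)) (col + kt)) (by omega)
          (by rw [Nat.succ_mul]; omega), add_right_comm (j * P.B) 1 i, add_assoc (j * P.B) i 1]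
        rfl
      have hra := hP.okra (j * P.B + 1 + i) (by omega)
      rw [show P.N0 + (j * P.B + 1 + i) = P.N0 + j * P.B + 1 + i by omega] at hra
      have hle := Par.cell_le hcn hf (l := j) (r := i + 1) hj.le (by omega) le_rfl
      have hd := Nat.div_mul_le_self ((P.rect col).cell j (i + 1) kt) P.big
      refine (Tri.of_wp ?_).mono ?_ fun _ _ h => h
      · simp only [wp, opOk, opNat, Opd.val_var, Opd.val_lit, St.setV_v, St.setV_a, reduceCtorEq,
            if_true, if_false, hti, e1, e2, hs5.glob.vbig, setA_a_self, e3]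
        exact ⟨by omega, hP.scratch F1 rfl _ (by omega), trivial, by omega, by omega, hra, trivial⟩
      · simp only [Cmd.scost, Arr.large, Bool.false_eq_true, if_false, if_true]; omega
    · rintro s5 hag5 ⟨d1, d2⟩
      refine ⟨fun hj1 => ?_, d1, fun l hl => ?_⟩
      -- Only the last band may have fewer than `B` rows, and no table is needed below it.
      · have hblB : bl = P.B := by
          have : (j + 1) * P.B ≤ (P.nb - 1) * P.B := Nat.mul_le_mul_right _ (by omega)
          rw [Nat.succ_mul] at this
          omega
        intro l hl u hu
        rw [hag5.a _ rfl, c2]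
        have hu2 : u < P.kk + 2 := by omega
        rcases Nat.lt_or_ge j l with h | h
        · obtain rfl : l = j + 1 := by omega
          rcases Nat.lt_or_ge (kt / P.B) u with h' | h'
          · obtain rfl : u = kt / P.B + 1 := Nat.le_antisymm hu h'
            rw [← add_assoc, Function.update_self, Rect.tab, if_neg (show ¬ kt / P.B + 1 ≤ kt / (P.rect col).B from Nat.not_succ_le_self _),
             
              hf.phi_top_succ (by omega) le_rfl, hblB]
            rfl
          · rw [Function.update_of_ne (by omega), i2 u (by omega), Rect.tab,
              if_pos (show u ≤ kt / (P.rect col).B from h'),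
              hf.phi_top_succ (l := j) (c := u * (P.rect col).B) (by omega)
                ((Nat.le_div_iff_mul_le hB).1 h'), hblB]
            change _ = _ + u * P.B / P.B
            rw [Nat.mul_div_cancel _ hB]
            rfl
        · have h1 : l * (P.kk + 2) + (P.kk + 2) ≤ (j + 1) * (P.kk + 2) := by
            rw [← Nat.succ_mul]; exact Nat.mul_le_mul_right _ (by omega)
          rw [Function.update_of_ne (by omega)]
          exact i3 l h u hu
      · rw [d2 l (Or.inl hl), hag4.a _ rfl, hag3.a _ rfl, hag2.a _ rfl, hag1.a _ rfl]
  · have h1 : ∑ t ∈ Finset.Ico 0 (kt / P.B + 1), (((((P.rect col).tab kt j (t + 1) -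
        (P.rect col).tab kt j t) * (evalCost E P + 2 * E.cs) + (P.B + 4) * (3 * E.cs + E.cr)) + V) +
        2 * E.cs) ≤ (P.nb * P.kk + 1) * (evalCost E P + 2 * E.cs) +
          (P.kk + 1) * ((P.B + 4) * (3 * E.cs + E.cr) + V + 2 * E.cs) := by
      have h2 := sum_tab hf hj.le (le_refl (kt / P.B + 1))
      have h3 := hf.tab_last hj.le
      have h4 : (j + 1) * (kt / P.B) ≤ P.nb * P.kk := Nat.mul_le_mul hj hkn
      have h5 : (P.rect col).tab kt j (kt / P.B + 1) ≤ P.nb * P.kk + 1 :=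
        h3.trans (Nat.succ_le_succ h4)
      simp only [add_assoc, Finset.sum_add_distrib, Finset.sum_const, Nat.card_Ico, smul_eq_mul]
      rw [← Finset.sum_mul, h2]
      refine Nat.add_le_add (Nat.mul_le_mul_right _ h5) ?_
      rw [← Nat.mul_add, ← Nat.mul_add]
      exact Nat.mul_le_mul_right _ (by omega)
    have h6 : bl ≤ P.B := by omega
    have h7 : bl * (5 * E.cs + E.cr) ≤ P.B * (5 * E.cs + E.cr) := Nat.mul_le_mul_right _ h6
    have h8 : bl * ((5 * E.cs + E.cw) + 2 * E.cs) ≤ P.B * (7 * E.cs + E.cw) :=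
      Nat.mul_le_mul h6 (by omega)
    have h9 : (P.B + 4) * (3 * E.cs + E.cr) + V + 2 * E.cs ≤ P.B * (colCost E P + 2 * E.cs) +
        (P.B + 4) * (21 * E.cs + 2 * E.cr) + E.cw := by
      have : (P.B + 4) * (21 * E.cs + 2 * E.cr) = (P.B + 4) * (3 * E.cs + E.cr) +
          (P.B + 1) * (16 * E.cs + E.cr) + (2 * (P.B * E.cs) + 56 * E.cs + 3 * E.cr) := by ring
      omega
    have h10 := Nat.mul_le_mul_left (P.kk + 1) h9
    have h11 : (P.B + 1) * (30 * E.cs + E.cr + E.cw) = P.B * (5 * E.cs + E.cr) +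
        P.B * (7 * E.cs + E.cw) + (18 * (P.B * E.cs) + 30 * E.cs + E.cr + E.cw) := by ring
    unfold stageCost
    omega

/-- On line `0` the count of a column is its tile number, so the first row of the table is the
identity. The minimum with `n` accounts for a narrower last rectangle. -/
theorem rectangle_spec (hP : P.Ok E) {rho : ℕ} (hrho : rho * (P.kk * P.B) < P.n) {s : St}
    (hg : P.Glob s) (hv : s.v vrho = rho)
    (hla : ∀ r, 1 ≤ r → r ≤ P.m →
      s.a la (P.N0 + r) = (P.rect (min (rho * (P.kk * P.B)) P.n)).left r) :
    Tri E rectangle s (rectCost E P) fun s' => ∀ r, 1 ≤ r → r ≤ P.m →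
      s'.a la (P.N0 + r) = (P.rect (min ((rho + 1) * (P.kk * P.B)) P.n)).left r := by
  obtain ⟨hb1, hb2, hb3, hb4, hb5⟩ := Par.bounds hP
  have hB := hP.B_pos
  have hw1 := hP.w1
  have hw6 := hP.w6
  have hltm := hP.lt_m
  have hmle := hP.m_le
  rw [min_eq_left hrho.le] at hla
  set col := rho * (P.kk * P.B) with hcol
  set kt := min (P.n - col) (P.kk * P.B) with hkt
  have hR : RectOk P col kt := ⟨by omega, by omega⟩
  have hf := hR.fits hP
  have hkn := hR.tl_le hP
  have hcn := hR.col_le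
  have hkw : P.kk + 2 ≤ (P.nb + 2) * (P.kk + 2) := Nat.le_mul_of_pos_left _ (by omega)
  have hkk2 : P.kk + 2 ≤ (P.nb + 1) * (P.kk + 2) := Nat.le_mul_of_pos_left _ (by omega)
  have hnext : min ((rho + 1) * (P.kk * P.B)) P.n = col + kt := by
    rw [Nat.succ_mul]; omega
  have hnb : P.nb ≤ P.nb * P.B := Nat.le_mul_of_pos_right _ hB
  have hnbw : P.nb < 2 ^ E.w := by rw [Nat.succ_mul] at hw6; omega
  have htlw : kt / P.B + 2 < 2 ^ E.w := by omega
  rw [hnext]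
  unfold rectangle
  refine Tri.cost (Tri.seq (Q := fun s' => RectSt P col kt s' ∧ s'.v t1 = kt / P.B + 2)
    (N := 6 * E.cs) (N' := ((kt / P.B + 2) * ((2 * E.cs + E.cw) + 2 * E.cs) + 2 * E.cs) +
    (((P.nb - 0) * (stageCost E P + 2 * E.cs) + 2 * E.cs) + (E.cs +
    ((P.m + 1) * ((2 * E.cs + E.cr + E.cw) + 2 * E.cs) + 2 * E.cs)))) ?_ ?_) ?_
  · refine (Tri.of_wp (Q := fun s' => s'.v vcol = col ∧ s'.v vkt = kt ∧ s'.v vtl = kt / P.B ∧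
      s'.v t1 = kt / P.B + 2) ?_).mono ?_ fun t hag h => ⟨⟨h.1, h.2.1, h.2.2.1, ?_⟩, h.2.2.2⟩
    · simp only [wp, wp_setMin, opOk, opNat, Opd.val_var, Opd.val_lit, St.setV_v,
        reduceCtorEq, if_true, if_false, hg.vB, hg.vn, hg.vK, hv, true_and]
      exact ⟨by omega, by omega, by omega, htlw, rfl, rfl, rfl, rfl⟩
    · simp only [Cmd.scost, Cmd.setMin]; omega
    · rw [hag.a _ rfl]; exact hla
  rintro s1 hag1 ⟨hr1, h1⟩
  have hg1 := hg.agree hag1 rfl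
  refine Tri.seq (Tri.forStore (k := tb) P.N0 (fun i => i) (2 * E.cs + E.cw) (kt / P.B + 2)
      (hi := .var t1) h1 (by omega) rfl rfl ?_) ?_
  · intro i t hi hti hag _
    have hg2 := hg1.agree hag rfl
    have hi2 : i < P.kk + 2 := by omega
    refine (Tri.of_wp ?_).mono ?_ fun _ _ h => h
    · simp only [wp, opOk, opNat, Opd.val_var, St.setV_v, St.setV_a, reduceCtorEq,
            if_true, if_false, hti, hg2.vN0, setA_a_self, and_true]
      exact ⟨by omega, hP.oktb _ (by omega)⟩
    · simp only [Cmd.scost, Arr.large, if_true]; omega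
  rintro s2 hag2 ⟨htb, -⟩
  have hg2 := hg1.agree hag2 rfl
  have hr2 := hr1.agree hag2 rfl
  refine Tri.seq (Tri.for_const (Inv := fun k s' => (k < P.nb → TabSt P col kt k s') ∧
    ∀ r, 1 ≤ r → r ≤ min (k * P.B) P.m → s'.a ra (P.N0 + r) = (P.rect (col + kt)).left r)
    (stageCost E P) 0 P.nb rfl (hi := .var vnb) hg2.vnb (by omega) hnbw rfl rfl ?_ ?_) ?_
  · refine ⟨fun _ l hl u hu => ?_, fun r h1 h2 => by omega⟩
    obtain rfl : l = 0 := by omega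
    rw [hf.tab_zero_left hu, Nat.zero_mul, add_zero]
    exact htb u (Nat.lt_succ_of_le hu)
  · rintro j s3 - hj hvj hag3 ⟨i1, i2⟩
    refine (stage_spec hP hR hj rfl (hg2.agree hag3 rfl) (hr2.agree hag3 rfl) (i1 hj) hvj).mono
      le_rfl ?_
    rintro s4 - ⟨j1, j2, j3⟩
    refine ⟨j1, fun r h1 h2 => ?_⟩
    rw [Nat.succ_mul] at h2
    rcases Nat.lt_or_ge (j * P.B) r with h | h
    · have := j2 (r - (j * P.B + 1)) (by omega)
      rwa [show P.N0 + j * P.B + 1 + (r - (j * P.B + 1)) = P.N0 + r by omega,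
        show j * P.B + 1 + (r - (j * P.B + 1)) = r by omega] at this
    · rw [St.setV_a, j3 _ (by omega)]
      exact i2 r h1 (by omega)
  rintro s3 hag3 ⟨⟨-, hra⟩, -⟩
  rw [Nat.max_eq_right (Nat.zero_le _), min_eq_right hmle] at hra
  have hg3 := hg2.agree hag3 rfl
  refine Tri.seq (Q := fun t => t = s3.setV t1 (P.m + 1)) (Tri.of_wp ?_) ?_
  · simp only [wp, opOk, opNat, Opd.val_var, Opd.val_lit, hg3.vm]
    exact ⟨by omega, trivial⟩
  rintro s4 hag4 rfl
  have hg4 := hg3.agree hag4 rfl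
  refine (Tri.forStore (k := la) P.N0 (fun i => s3.a ra (P.N0 + i)) (2 * E.cs + E.cr + E.cw)
      (P.m + 1) (hi := .var t1) (by simp) (by omega) rfl rfl ?_).mono le_rfl ?_
  · intro i t hi hti hag _
    have hg5 := hg4.agree hag rfl
    refine (Tri.of_wp ?_).mono ?_ fun _ _ h => h
    · simp only [wp, opOk, opNat, Opd.val_var, St.setV_v, St.setV_a, reduceCtorEq,
            if_true, if_false, hti, hg5.vN0, setA_a_self, hag.a ra rfl, and_true]
      exact ⟨by omega, hP.okra _ (by omega), hP.okla _ (by omega)⟩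
    · simp only [Cmd.scost, Arr.large, if_true]; omega
  · rintro s5 - ⟨d1, -⟩ r h1 h2
    rw [d1 r (by omega)]
    exact hra r h1 h2
  · have h2 : (kt / P.B + 2) * ((2 * E.cs + E.cw) + 2 * E.cs) ≤
        (P.kk + 2) * (4 * E.cs + E.cw) := Nat.mul_le_mul (by omega) (by omega)
    unfold rectCost
    rw [Nat.sub_zero]
    nlinarith

theorem mainLoop_spec (hP : P.Ok E) {s : St} (hg : P.Glob s) :
    Tri E mainLoop s (mainCost E P) fun s' => s'.v vres = gridDist P.sg P.x P.y P.m P.n := by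
  obtain ⟨hb1, hb2, hb3, hb4, hb5⟩ := Par.bounds hP
  have hB := hP.B_pos
  have hw1 := hP.w1
  have hw2 := hP.w2
  have hw3 := hP.w3
  have hKpos : 0 < P.kk * P.B := Nat.mul_pos hP.kk_pos hB
  rw [Nat.add_mul] at hw3
  unfold mainLoop
  set K := P.kk * P.B with hK
  have hnr : (P.n + K - 1) / K < 2 ^ E.w := lt_of_le_of_lt (Nat.div_le_self _ _) (by omega)
  refine Tri.cost (Tri.seq (Q := fun t => t = s.setV t1 (P.m + 1)) (N := E.cs) (N' :=
    ((P.m + 1) * ((3 * E.cs + E.cw) + 2 * E.cs) + 2 * E.cs) + (3 * E.cs +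
    ((((P.n + K - 1) / K - 0) * (rectCost E P + 2 * E.cs) + 2 * E.cs) + (2 * E.cs + E.cr))))
    (Tri.of_wp ?_) ?_) ?_
  · simp only [wp, opOk, opNat, Opd.val_var, Opd.val_lit, hg.vm]
    exact ⟨by omega, trivial⟩
  · rintro s1 hag1 rfl
    have hg1 := hg.agree hag1 rfl
    refine Tri.seq (Tri.forStore (k := la) P.N0 (fun i => i * P.big) (3 * E.cs + E.cw)
      (P.m + 1) (hi := .var t1) (by simp) (by omega) rfl rfl ?_) ?_
    · intro i t hi hti hag _
      have hg5 := hg1.agree hag rfl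
      have : i * P.big ≤ (P.m + P.n + P.B + 4) * P.big := Nat.mul_le_mul_right _ (by omega)
      refine (Tri.of_wp ?_).mono ?_ fun _ _ h => h
      · simp only [wp, opOk, opNat, Opd.val_var, St.setV_v, St.setV_a, reduceCtorEq,
            if_true, if_false, hti, hg5.vN0, hg5.vbig, setA_a_self, and_true]
        exact ⟨by omega, by omega, hP.okla _ (by omega)⟩
      · simp only [Cmd.scost, Arr.large, if_true]; omega
    rintro s2 hag2 ⟨hla, -⟩
    have hg2 := hg1.agree hag2 rfl
    refine Tri.seq (Q := fun t => P.Glob t ∧ t.a la = s2.a la ∧ t.v vnr = (P.n + K - 1) / K) ?_ ?_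
    · refine (Tri.of_wp (Q := fun t => t.v vnr = (P.n + K - 1) / K) ?_).mono ?_
        fun t hag h => ⟨hg2.agree hag rfl, hag.a _ rfl, h⟩
      · simp only [wp, opOk, opNat, Opd.val_var, Opd.val_lit, St.setV_v, reduceCtorEq,
            if_true, if_false, hg2.vn, hg2.vK]
        exact ⟨by omega, by omega, trivial, rfl⟩
      · simp only [Cmd.scost]; omega
    rintro s3 - ⟨hg3, hla3, hnr3⟩
    refine Tri.seq (Tri.for_const (Inv := fun k s' => ∀ r, 1 ≤ r → r ≤ P.m →
      s'.a la (P.N0 + r) = (P.rect (min (k * K) P.n)).left r)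
      (rectCost E P) 0 ((P.n + K - 1) / K) rfl (hi := .var vnr) hnr3 (by omega) hnr rfl rfl ?_ ?_) ?_
    · intro r h1 h2
      rw [St.setV_a, hla3, hla r (by omega), Nat.zero_mul, Nat.zero_min, Rect.left, Rect.dist]
      change _ = gridDist _ _ _ r 0 * P.big
      rw [gridDist_zero_right]
    · rintro k s4 - hk hvk hag4 hinv
      have hkK : k * K < P.n := by
        have := (Nat.le_div_iff_mul_le hKpos).1 (Nat.succ_le_of_lt hk)
        rw [Nat.succ_mul] at this
        omega
      exact (rectangle_spec hP hkK (hg3.agree hag4 rfl) hvk hinv).mono le_rfl fun _ _ h => h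
    · rintro s4 hag4 ⟨hfin, -⟩
      have hg4 := hg3.agree hag4 rfl
      have hge : P.n ≤ (P.n + K - 1) / K * K := by
        have := Nat.lt_div_mul_add (a := P.n + K - 1) hKpos
        omega
      have h1 := hfin P.m hP.m_pos le_rfl
      rw [Nat.max_eq_right (Nat.zero_le _), min_eq_right hge, Rect.left] at h1
      refine (Tri.of_wp ?_).mono ?_ fun _ _ h => h
      · simp only [wp, opOk, opNat, Opd.val_var, St.setV_v, St.setV_a, reduceCtorEq,
            if_true, if_false, hg4.vN0, hg4.vm, hg4.vbig, h1]
        refine ⟨by omega, hP.okla _ le_rfl, trivial, ?_⟩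
        change gridDist _ _ _ P.m P.n * P.big / P.big = _
        rw [Nat.mul_div_cancel _ hb1]
        rfl
      · simp only [Cmd.scost, Arr.large, if_true]; omega
  · have : (P.m + 1) * (20 * E.cs + E.cr + E.cw) = (P.m + 1) * ((3 * E.cs + E.cw) + 2 * E.cs) +
        (P.m * (15 * E.cs + E.cr) + 15 * E.cs + E.cr) := by ring
    unfold mainCost
    rw [Nat.sub_zero, ← hK]
    omega

end
end AsymDP

namespace AsymDP
open Var Arr

/-! ### Choice of the parameters -/

/-- Compute the derived parameters. -/
def derive (sg : ℕ) : Cmd :=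
  .op vyb .add vxb vm ;; .op vN0 .add vyb vn ;; .op vK .mul vkk vB ;; .op vst .add vkk (.lit 2) ;;
  .op t0 .add vnb (.lit 1) ;; .op vbig .add vkk (.lit 1) ;; .op vbig .mul t0 vbig ;;
  .op ve2 .mul vbig (.lit sg) ;; .op vinf .add vm vn ;; .op vinf .add vinf (.lit 1) ;;
  .op vinf .mul vinf vbig

/-- Turn the distance into the length of the longest common subsequence. -/
def finish : Bool → Cmd
  | true => .op t0 .add vm vn ;; .op t0 .sub t0 vres ;; .op vres .div t0 (.lit 2)
  | false => .skip

def sgOf (lcs : Bool) : ℕ := if lcs then 2 else 1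

def solve (lcs : Bool) : Cmd := derive (sgOf lcs) ;; mainLoop ;; finish lcs

/-- The value computed by `solve`. -/
def solution (lcs : Bool) (x y : List ℕ) : ℕ :=
  let d := gridDist (sgOf lcs) (fun i => x.getD i 0) (fun i => y.getD i 0) x.length y.length
  if lcs then (x.length + y.length - d) / 2 else d

theorem solution_true (x y : List ℕ) : solution true x y = lcsLength x y := by
  have := gridDist_add_lcsLength x y
  simp only [solution, sgOf, if_true]
  omega

theorem solution_false (x y : List ℕ) : solution false x y = editDistance x y := by
  simp only [solution, sgOf, Bool.false_eq_true, if_false]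
  exact (editDistance_eq x y).symm

/-- The parameters for strings `x` and `y`. -/
def parOf (lcs : Bool) (x y : List ℕ) (xb B nb kk : ℕ) : Par where
  m := x.length
  n := y.length
  B := B
  nb := nb
  kk := kk
  sg := sgOf lcs
  N0 := xb + x.length + y.length
  xb := xb
  yb := xb + x.length
  x := fun i => x.getD i 0
  y := fun i => y.getD i 0

theorem solve_spec {E : Env} {lcs : Bool} {x y : List ℕ} {xb B nb kk : ℕ}
    (hP : (parOf lcs x y xb B nb kk).Ok E) {s : St} (h1 : s.v vm = x.length)
    (h2 : s.v vn = y.length) (h3 : s.v vB = B) (h4 : s.v vnb = nb) (h5 : s.v vkk = kk)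
    (h6 : s.v vxb = xb) (hx : ∀ i < x.length, s.a inp (xb + i) = x.getD i 0)
    (hy : ∀ i < y.length, s.a inp (xb + x.length + i) = y.getD i 0) :
    Tri E (solve lcs) s (mainCost E (parOf lcs x y xb B nb kk) + 14 * E.cs) fun t =>
      t.v vres = solution lcs x y := by
  obtain ⟨hb1, hb2, hb3, hb4, hb5⟩ := Par.bounds hP
  have hsg : (sgOf lcs) * ((nb + 1) * (kk + 1)) ≤ 2 * ((nb + 1) * (kk + 1)) :=
    Nat.mul_le_mul_right _ hP.sg_le
  have hw1 := hP.w1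
  have hw3 := hP.w3
  have hw6 := hP.w6
  have hBpos := hP.B_pos
  have hnbB : nb + 1 ≤ (nb + 1) * B := Nat.le_mul_of_pos_right _ hBpos
  simp only [Par.big, Par.inf, parOf] at hb1 hb2 hb3 hb4 hb5 hw1 hw3 hw6
  rw [Nat.add_mul kk] at hw3
  have hnw : kk + 2 ≤ (nb + 2) * (kk + 2) := Nat.le_mul_of_pos_left _ (by omega)
  unfold solve
  refine Tri.cost (Tri.seq (Q := fun t => (parOf lcs x y xb B nb kk).Glob t) (N := 11 * E.cs)
    (N' := mainCost E (parOf lcs x y xb B nb kk) + 3 * E.cs) ?_ ?_) (by omega)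
  · refine (Tri.of_wp (Q := fun t => t.v vyb = xb + x.length ∧ t.v vN0 = xb + x.length + y.length ∧
      t.v vK = kk * B ∧ t.v vst = kk + 2 ∧ t.v vbig = (nb + 1) * (kk + 1) ∧
      t.v ve2 = sgOf lcs * ((nb + 1) * (kk + 1)) ∧
      t.v vinf = (x.length + y.length + 1) * ((nb + 1) * (kk + 1))) ?_).mono ?_ ?_
    · simp only [derive, wp, opOk, opNat, Opd.val_var, Opd.val_lit, St.setV_v, reduceCtorEq,
            if_true, if_false, h1, h2, h3, h4, h5, h6]
      rw [Nat.mul_comm _ (sgOf lcs)]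
      exact ⟨by omega, by omega, by omega, by omega, by omega, by omega, by omega, by omega,
        by omega, by omega, by omega, trivial, trivial, trivial, trivial, trivial, rfl, trivial⟩
    · simp only [derive, Cmd.scost]; omega
    · rintro t hag ⟨g1, g2, g3, g4, g5, g6, g7⟩
      refine ⟨?_, ?_, ?_, ?_, ?_, g3, ?_, g1, g2, g5, g6, g7, g4, ?_, ?_⟩
      · rw [hag.v _ rfl, h1]; rfl
      · rw [hag.v _ rfl, h2]; rfl
      · rw [hag.v _ rfl, h3]; rfl
      · rw [hag.v _ rfl, h4]; rfl
      · rw [hag.v _ rfl, h5]; rfl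
      · rw [hag.v _ rfl, h6]; rfl
      · rw [hag.a _ rfl]; exact hx
      · rw [hag.a _ rfl]; exact hy
  · intro t _ hg
    refine Tri.seq (mainLoop_spec hP hg) ?_
    intro t' hag hres
    have hg' := hg.agree hag rfl
    have hd := gridDist_le (sgOf lcs) (fun i => x.getD i 0) (fun i => y.getD i 0) x.length y.length
    change t'.v vres = gridDist (sgOf lcs) (fun i => x.getD i 0) (fun i => y.getD i 0) x.length
      y.length at hres
    have e1 := hg'.vm
    have e2 := hg'.vn
    simp only [parOf] at e1 e2
    cases lcs with
    | true =>
      refine (Tri.of_wp ?_).mono ?_ fun _ _ h => h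
      · simp only [finish, wp, opOk, opNat, Opd.val_var, Opd.val_lit, St.setV_v, reduceCtorEq,
            if_true, if_false, e1, e2, hres, solution]
        exact ⟨by omega, hd, trivial, trivial⟩
      · simp only [finish, Cmd.scost]; omega
    | false =>
      refine (Tri.of_wp ?_).mono ?_ fun _ _ h => h
      · simpa only [finish, wp, solution, Bool.false_eq_true, if_false] using hres
      · simp only [finish, Cmd.scost]; omega

/-- A width of rectangles that the bounds allow. -/
def GoodWidth (M o nb ρ i : ℕ) : Prop := i * nb ≤ M ∧ i * nb * i * ρ ≤ o

instance (M o nb ρ i : ℕ) : Decidable (GoodWidth M o nb ρ i) := by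
  unfold GoodWidth; infer_instance

/-- The largest good width up to `k`. -/
def width (M o nb ρ : ℕ) : ℕ → ℕ
  | 0 => 1
  | k + 1 => if GoodWidth M o nb ρ (k + 1) then k + 1 else width M o nb ρ k

theorem width_pos (M o nb ρ k : ℕ) : 1 ≤ width M o nb ρ k := by
  induction k with
  | zero => exact le_rfl
  | succ k ih => rw [width]; split <;> omega

theorem width_le (M o nb ρ k : ℕ) : width M o nb ρ k ≤ max k 1 := by
  induction k with
  | zero => exact le_rfl
  | succ k ih => rw [width]; split <;> omega

theorem width_good (M o nb ρ k : ℕ) :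
    width M o nb ρ k = 1 ∨ GoodWidth M o nb ρ (width M o nb ρ k) := by
  induction k with
  | zero => exact Or.inl rfl
  | succ k ih =>
    rw [width]
    split
    · next h => exact Or.inr h
    · exact ih

theorem le_width {M o nb ρ k i : ℕ} (hi : GoodWidth M o nb ρ i) (hik : i ≤ k) :
    i ≤ width M o nb ρ k := by
  induction k with
  | zero => have := width_pos M o nb ρ 0; omega
  | succ k ih =>
    rw [width]
    split
    · exact hik
    · next h =>
      refine ih (Nat.le_of_lt_succ (lt_of_le_of_ne hik ?_))
      rintro rfl
      exact h hi

/-- Multiply by `M` for the bound on the work. -/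
def scaleWidth : Bool → Cmd
  | true => .skip
  | false => .op sx .mul sx vM

/-- Load the parameters of the machine and choose the sizes of tiles and rectangles. -/
def setupSmall (io : Bool) : Cmd :=
  (.load vm inp (.lit 0) ;; .load vn inp (.lit 1) ;; .load vM inp (.lit 2) ;; .load vo inp (.lit 3) ;;
    .op vB .div vM (.lit 16) ;; .op t0 .add vm vB ;; .op t0 .sub t0 (.lit 1) ;; .op vnb .div t0 vB ;;
    .mov vxb (.lit 4) ;; .mov vkk (.lit 1) ;; .op t1 .add vM (.lit 1)) ;;
  .for vi (.lit 1) t1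
    (.op t0 .mul vi vnb ;; .ite (.lt vM t0) .skip
      (.op sx .mul t0 vi ;; scaleWidth io ;; .ite (.lt vo sx) .skip (.mov vkk vi)))

def rhoOf (io : Bool) (M : ℕ) : ℕ := if io then 1 else M

/-- The search for the width runs over `i ≤ M` in scratch memory after only four reads of the input.
The long product is formed only once `i * nb ≤ M` is known, so the cube in `hw` rules out overflow.
-/
theorem setupSmall_spec {E : Env} {io : Bool} {m n M o B nb : ℕ} (ok : ∀ i < 4, E.ok inp i) {s : St}
    (h0 : s.a inp 0 = m) (h1 : s.a inp 1 = n) (h2 : s.a inp 2 = M) (h3 : s.a inp 3 = o)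
    (hB : B = M / 16) (hB1 : 1 ≤ B) (hnb : nb = (m + B - 1) / B) (hw : (m + M + 3) ^ 3 < 2 ^ E.w) :
    Tri E (setupSmall io) s ((M + 2) * (20 * E.cs) + 4 * E.cr) fun t =>
      t.v vm = m ∧ t.v vn = n ∧ t.v vB = B ∧ t.v vnb = nb ∧ t.v vxb = 4 ∧
        t.v vkk = width M o nb (rhoOf io M) M ∧ t.a = s.a := by
  have hw1 : m + M + 3 ≤ (m + M + 3) ^ 3 := Nat.le_self_pow (by norm_num) _
  have hnbm : nb ≤ m + M := by
    have := Nat.div_le_self (m + B - 1) B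
    have := Nat.div_le_self M 16
    omega
  unfold setupSmall
  refine Tri.cost (Tri.seq (Q := fun t => t.v vm = m ∧ t.v vn = n ∧ t.v vB = B ∧ t.v vnb = nb ∧
    t.v vxb = 4 ∧ t.v vM = M ∧ t.v vo = o ∧ t.v vkk = 1 ∧ t.v t1 = M + 1)
    (N := 7 * E.cs + 4 * E.cr) (N' := (M + 1 - 1) * (6 * E.cs + 2 * E.cs) + 2 * E.cs) ?_ ?_) ?_
  · refine (Tri.of_wp ?_).mono ?_ fun _ _ h => h
    · have hBM := Nat.div_le_self M 16
      simp only [wp, wp_mov, opOk, opNat, Opd.val_var, Opd.val_lit, St.setV_v, St.setV_a,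
        reduceCtorEq, if_true, if_false, h0, h1, h2, h3, ← hB, ← hnb]
      exact ⟨ok 0 (by omega), ok 1 (by omega), ok 2 (by omega), ok 3 (by omega), trivial, by omega,
        by omega, trivial, by omega, by omega, by omega, trivial, trivial, trivial, trivial, trivial,
        trivial, trivial, trivial, trivial⟩
    · simp only [Cmd.scost, Cmd.mov, Arr.large, if_true]; omega
  · rintro s1 hag1 ⟨g1, g2, g3, g4, g5, g6, g7, g8, g9⟩
    refine (Tri.for_const (Inv := fun k t => t.v vkk = width M o nb (rhoOf io M) (k - 1))
      (6 * E.cs) 1 (M + 1) rfl (hi := .var t1) g9 (by omega) (by omega) (by cases io <;> rfl)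
      (by cases io <;> rfl) ?_ ?_).mono le_rfl ?_
    · simp only [St.setV_v, reduceCtorEq, if_false, g8]; rfl
    · intro k t hk1 hk2 hk hag hinv
      have e1 : t.v vnb = nb := by rw [hag.v _ (by cases io <;> rfl), g4]
      have e2 : t.v vM = M := by rw [hag.v _ (by cases io <;> rfl), g6]
      have e3 : t.v vo = o := by rw [hag.v _ (by cases io <;> rfl), g7]
      obtain ⟨i, rfl⟩ : ∃ i, k = i + 1 := ⟨k - 1, by omega⟩
      rw [Nat.add_sub_cancel] at hinv
      have b1 : (i + 1) * nb < 2 ^ E.w := by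
        refine lt_of_le_of_lt (Nat.mul_le_mul (show i + 1 ≤ m + M + 3 by omega)
          (show nb ≤ m + M + 3 by omega)) (lt_of_le_of_lt ?_ hw)
        rw [← Nat.pow_two]
        exact Nat.pow_le_pow_right (by omega) (by norm_num)
      have b2 : (i + 1) * nb ≤ M → (i + 1) * nb * (i + 1) < 2 ^ E.w := fun h => by
        refine lt_of_le_of_lt (Nat.mul_le_mul (show (i + 1) * nb ≤ m + M + 3 by omega)
          (show i + 1 ≤ m + M + 3 by omega)) (lt_of_le_of_lt ?_ hw)
        rw [← Nat.pow_two]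
        exact Nat.pow_le_pow_right (by omega) (by norm_num)
      have b3 : (i + 1) * nb ≤ M → (i + 1) * nb * (i + 1) * M < 2 ^ E.w := fun h => by
        refine lt_of_le_of_lt (Nat.mul_le_mul (Nat.mul_le_mul
          (show (i + 1) * nb ≤ m + M + 3 by omega) (show i + 1 ≤ m + M + 3 by omega))
          (show M ≤ m + M + 3 by omega)) (lt_of_le_of_lt ?_ hw)
        exact le_of_eq (by ring)
      refine (Tri.of_wp (Q := fun t' => t'.v vkk = width M o nb (rhoOf io M) (i + 1)) ?_).mono ?_
        fun t' _ h => by simpa using h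
      · cases io
        · simp only [scaleWidth, wp, wp_mov, opOk, opNat, Opd.val_var, St.setV_v,
            reduceCtorEq, if_true, if_false, Cnd.holds_lt, e1, e2, e3, hk, hinv, rhoOf, width,
            GoodWidth, Bool.false_eq_true]
          refine ⟨b1, fun h => by rw [if_neg (by omega)], fun h => ⟨b2 (by omega), b3 (by omega),
            fun h' => by rw [if_neg (by omega)], fun h' => ⟨by omega, by rw [if_pos (by omega)]⟩⟩⟩
        · simp only [scaleWidth, wp, wp_mov, opOk, opNat, Opd.val_var, St.setV_v,
            reduceCtorEq, if_true, if_false, Cnd.holds_lt, e1, e2, e3, hk, hinv, rhoOf, width,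
            GoodWidth, mul_one]
          refine ⟨b1, fun h => by rw [if_neg (by omega)], fun h => ⟨b2 (by omega),
            fun h' => by rw [if_neg (by omega)], fun h' => ⟨by omega, by rw [if_pos (by omega)]⟩⟩⟩
      · cases io <;> (simp only [Cmd.scost, Cmd.mov, scaleWidth]; omega)
    · rintro t hag ⟨i1, -⟩
      rw [max_eq_right (by omega), Nat.add_sub_cancel] at i1
      refine ⟨?_, ?_, ?_, ?_, ?_, i1, ?_⟩
      · rw [hag.v _ (by cases io <;> rfl), g1]
      · rw [hag.v _ (by cases io <;> rfl), g2]
      · rw [hag.v _ (by cases io <;> rfl), g3]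
      · rw [hag.v _ (by cases io <;> rfl), g4]
      · rw [hag.v _ (by cases io <;> rfl), g5]
      · funext k
        rw [hag.a _ (by cases io <;> rfl), hag1.a _ rfl]
  · rw [Nat.add_sub_cancel]
    nlinarith

/-- Parameters for the case that the scratch memory is in large memory. -/
def setupLarge : Cmd :=
  .mov vB vm ;; .mov vnb (.lit 1) ;; .mov vkk (.lit 1) ;; .op vxb .mul vm (.lit 8) ;;
  .op vxb .add vxb (.lit 84)

theorem setupLarge_spec {E : Env} {m : ℕ} {s : St} (h0 : s.v vm = m) (hw : m * 8 + 84 < 2 ^ E.w) :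
    Tri E setupLarge s (5 * E.cs) fun t =>
      t.v vm = m ∧ t.v vn = s.v vn ∧ t.v vB = m ∧ t.v vnb = 1 ∧ t.v vkk = 1 ∧ t.v vxb = m * 8 + 84 ∧
        t.a = s.a := by
  refine (Tri.of_wp ?_).mono ?_ fun _ _ h => h
  · simp only [setupLarge, wp, wp_mov, opOk, opNat, Opd.val_var, Opd.val_lit, St.setV_v, St.setV_a,
      reduceCtorEq, if_true, if_false, h0]
    exact ⟨by omega, by omega, by omega, by omega, hw, trivial, trivial, trivial, trivial, trivial,
      trivial, trivial⟩
  · simp only [setupLarge, Cmd.scost, Cmd.mov]; omega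

end AsymDP

namespace AsymDP
open Var Arr

/-! ### The program on the machine -/

/-- All cells contain words. -/
def Bounded (w : ℕ) (s : Memory) : Prop := ∀ b a, s b a < 2 ^ w

theorem BinOp.eval_lt (w : ℕ) (f : BinOp) (a b : ℕ) : f.eval w a b < 2 ^ w := by
  cases f <;> exact Nat.mod_lt _ (Nat.two_pow_pos w)

theorem Bounded.write {w : ℕ} {s : Memory} (h : Bounded w s) (b : Bank) (a : ℕ) {v : ℕ}
    (hv : v < 2 ^ w) : Bounded w (s.write b a v) := by
  intro b' a'
  unfold Memory.write
  split
  · exact hv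
  · exact h b' a'

/-- The state represented by a memory. -/
def absOf (E : Env) (s : Memory) : St := ⟨fun x => s E.b x.idx, fun k i => s (E.bank k) (k.addr i)⟩

theorem rep_absOf (E : Env) {s : Memory} (h : Bounded E.w s) : Rep E (absOf E s) s :=
  ⟨fun _ => rfl, fun _ _ _ => rfl, fun _ => h _ _, fun _ _ _ => h _ _⟩

/-- The machine that uses small memory as scratch memory; the input ends before cell `N`. -/
def envSmall (M w N wS wR wW : ℕ) : Env where
  M := M
  w := w
  b := .small
  ok k i := if k = inp then i < N else if k.large then N ≤ i ∧ 4 * i + 4 < 2 ^ w else k.addr i < M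
  wS := wS
  wR := wR
  wW := wW

/-- The machine that uses large memory as scratch memory; the input is in cells `L` to `N - 1`. -/
def envLarge (M w cap L N wS wR wW : ℕ) : Env where
  M := M
  w := w
  b := .large
  ok k i := if k = inp then L ≤ i ∧ i < N else if k.large then N ≤ i ∧ 4 * i + 4 < 2 ^ w else i < cap
  wS := wS
  wR := wR
  wW := wW

theorem envSmall_wf {M w N wS wR wW : ℕ} (hM : 64 ≤ M) (hMw : M < 2 ^ w) (hw : 1024 ≤ 2 ^ w)
    (hN : N < 2 ^ w) : (envSmall M w N wS wR wW).Wf where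
  word := hw
  cell i hi := ⟨by change i < 2 ^ w; omega, by change i < M; omega⟩
  arr k i h := by
    cases k <;> simp only [envSmall, reduceCtorEq, if_true, if_false, Arr.large, Bool.false_eq_true,
      Env.bank, Bank.HasCell, Arr.addr, Arr.stride, Arr.off, and_true] at h ⊢ <;> omega
  sep k i h hb := by
    cases k <;> simp only [envSmall, Env.bank, Arr.large, if_true, if_false, Bool.false_eq_true,
      reduceCtorEq, Arr.addr, Arr.stride, Arr.off] at hb ⊢ <;> omega
  inj k i k' i' h h' hb ha := by
    cases k <;> cases k' <;> simp only [envSmall, reduceCtorEq, if_true, if_false, Arr.large,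
      Bool.false_eq_true, Env.bank, Arr.addr, Arr.stride, Arr.off, true_and, false_and] at h h' hb ha ⊢ <;>
      omega

theorem envLarge_wf {M w cap L N wS wR wW : ℕ} (hw : 1024 ≤ 2 ^ w)
    (hL : 8 * cap + 64 ≤ L) (hLN : L ≤ N) (hN : N < 2 ^ w) :
    (envLarge M w cap L N wS wR wW).Wf where
  word := hw
  cell i hi := ⟨by change i < 2 ^ w; omega, trivial⟩
  arr k i h := by
    cases k <;> simp only [envLarge, reduceCtorEq, if_true, if_false, Arr.large, Bool.false_eq_true,
      Env.bank, Bank.HasCell, Arr.addr, Arr.stride, Arr.off, and_true] at h ⊢ <;> omega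
  sep k i h hb := by
    cases k <;> simp only [envLarge, Arr.large, if_true, if_false, Bool.false_eq_true,
      reduceCtorEq, Arr.addr, Arr.stride, Arr.off] at h ⊢ <;> omega
  inj k i k' i' h h' hb ha := by
    cases k <;> cases k' <;> simp only [envLarge, reduceCtorEq, if_true, if_false, Arr.large,
      Bool.false_eq_true, Arr.addr, Arr.stride, Arr.off, true_and, false_and] at h h' ha ⊢ <;>
      omega

/-- Cell `i` of bank `b`. -/
def cellAt (b : Bank) (i : ℕ) : Operand := .cell ⟨b, .direct i⟩

/-- `b[i] := x ∘ y` -/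
def setCell (b : Bank) (i : ℕ) (f : BinOp) (x y : Operand) : Program :=
  .assign ⟨b, .direct i⟩ f x y

theorem exec_set {M w : ℕ} {b : Bank} {i : ℕ} {f : BinOp} {x y : Operand} {s : Memory} {u v z : ℕ}
    (hi : b.HasCell M w i) (hx : x.Valid M w s) (hy : y.Valid M w s) (hu : x.val w s = u)
    (hv : y.val w s = v) (hz : f.eval w u v = z) :
    Exec M w (setCell b i f x y) s (x.cost + y.cost + b.writeCost) (s.write b i z) := by
  subst hu hv hz
  have h := Exec.assign (M := M) (w := w) ⟨b, .direct i⟩ f x y s ⟨trivial, hi⟩ hx hy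
  have e : x.cost + y.cost + ((Addr.direct i).cost + b.writeCost) =
      x.cost + y.cost + b.writeCost := by
    have : ∀ c : Cost, (0 : Cost) + c = c := by
      rintro ⟨a, b, c, d⟩
      change Cost.mk (0 + a) (0 + b) (0 + c) (0 + d) = _
      simp
    rw [Addr.cost, this]
  rw [← e]
  exact h

/-- Store the result. -/
def output (b : Bank) : Program := setCell .large 0 .add (cellAt b vres.idx) (.const 0)

def progSmall (lcs io : Bool) : Program :=
  .seq ((setupSmall io ;; solve lcs).comp .small) (output .small)

theorem progSmall_small (lcs io : Bool) : (setupSmall io ;; solve lcs).small = true := by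
  cases lcs <;> cases io <;> rfl

theorem exec_output {E : Env} (hE : E.Wf) {t : St} {s : Memory} (h : Rep E t s) {z : ℕ}
    (hz : t.v vres = z) : ∃ c s', Exec E.M E.w (output E.b) s c s' ∧ E.μ c ≤ E.cw ∧
      s' .large 0 = z := by
  have h1 : s E.b vres.idx = z := by rw [h.v, hz]
  have h2 : z < 2 ^ E.w := by rw [← hz]; exact h.vlt _
  refine ⟨_, _, exec_set (u := z) (v := 0) (z := z) ⟨by have := hE.word; omega, trivial⟩
    (x := cellAt E.b vres.idx) (y := .const 0) ⟨trivial, hE.cell _ (by have := vres.idx_lt; simp only [Addr.val]; omega)⟩ trivial h1 (Nat.zero_mod _) (Nat.mod_eq_of_lt h2), ?_, ?_⟩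
  · simp only [Env.μ_add, cellAt, Operand.cost, Addr.cost, Env.μ_zero, Env.cw, Env.cs]
    have : E.μ Bank.large.writeCost = E.wW := by simp [Env.μ, Bank.writeCost]
    omega
  · simp [Memory.write]

theorem inputMemory_x {M ω w : ℕ} {x y : List ℕ} {i : ℕ} (hi : i < x.length) :
    inputMemory M ω w x y .large (4 + i) = x.getD i 0 := by
  simp only [inputMemory, List.append_assoc]
  rw [List.getD_append_right _ _ _ _ (by simp), List.getD_append _ _ _ _ (by simpa using hi)]
  simp

theorem inputMemory_y {M ω w : ℕ} {x y : List ℕ} (i : ℕ) :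
    inputMemory M ω w x y .large (4 + x.length + i) = y.getD i 0 := by
  simp only [inputMemory]
  rw [List.getD_append_right _ _ _ _ (by simp; omega)]
  congr 1
  simp; omega

theorem bounded_inputMemory {M ω w : ℕ} {x y : List ℕ} (hx : x.length < 2 ^ w)
    (hy : y.length < 2 ^ w) (hM : M < 2 ^ w) (h : ∀ z ∈ x ++ y, z < 2 ^ w) :
    Bounded w (inputMemory M ω w x y) := by
  have h0 := Nat.two_pow_pos w
  rintro (_ | _) i
  · exact h0
  · have key : ∀ z ∈ [x.length, y.length, M, min ω (2 ^ w - 1)] ++ x ++ y, z < 2 ^ w := by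
      intro z hz
      rw [List.append_assoc, List.mem_append] at hz
      rcases hz with hz | hz
      · simp only [List.mem_cons, List.not_mem_nil, or_false] at hz
        omega
      · exact h z hz
    change List.getD _ i 0 < 2 ^ w
    rw [List.getD_eq_getElem?_getD]
    rcases Nat.lt_or_ge i ([x.length, y.length, M, min ω (2 ^ w - 1)] ++ x ++ y).length with hi | hi
    · rw [List.getElem?_eq_getElem hi]
      exact key _ (List.getElem_mem hi)
    · rw [List.getElem?_eq_none hi]
      exact h0

/-- The hypothesis `hmB` gives `nb ≤ B`, so that one tile number per line fits into a scratch array.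
Eight interleaved arrays of `B + 1` entries fit into `M` cells because `B` is `M / 16` and `M ≥
256`. -/
theorem progSmall_exec {M ω w wS wR wW : ℕ} {lcs io : Bool} {x y : List ℕ} {s : Memory}
    (hs : Bounded w s) (hin : ∀ i, s .large i = inputMemory M ω w x y .large i)
    (hM : 256 ≤ M) (hMm : M ≤ x.length) (hmn : x.length ≤ y.length)
    (hmB : x.length ≤ M / 16 * (M / 16))
    (hw : 16 * (8 * (x.length + y.length)) ^ 3 ≤ 2 ^ w) {B nb kk : ℕ} (hB : B = M / 16)
    (hnb : nb = (x.length + B - 1) / B)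
    (hkk : kk = width M (min ω (2 ^ w - 1)) nb (rhoOf io M) M) {E : Env}
    (hE : E = envSmall M w (4 + x.length + y.length) wS wR wW) :
    ∃ c s', Exec M w (progSmall lcs io) s c s' ∧ s' .large 0 = solution lcs x y ∧
      E.μ c ≤ mainCost E (parOf lcs x y 4 B nb kk) + ((M + 3) * (20 * E.cs) + 4 * E.cr + E.cw) := by
  set m := x.length with hm
  set n := y.length with hn
  set S := m + n with hS
  have hS2 : 512 ≤ S := by omega
  have hSS : 512 * S ≤ S * S := Nat.mul_le_mul_right _ hS2
  have hSSS : 512 * (S * S) ≤ S * S * S := by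
    rw [mul_assoc S]; exact Nat.mul_le_mul_right _ hS2
  have hw' : 8192 * (S * S * S) ≤ 2 ^ w := by
    refine le_trans (le_of_eq ?_) hw
    ring
  have hB1 : 16 ≤ B := by rw [hB]; exact (Nat.le_div_iff_mul_le (by norm_num)).2 (by omega)
  have hBM : B * 16 ≤ M := by rw [hB]; exact Nat.div_mul_le_self _ _
  have hnb1 : 1 ≤ nb := by rw [hnb]; exact (Nat.le_div_iff_mul_le (by omega)).2 (by omega)
  have hnbB : nb ≤ B := by
    rw [hnb]
    refine Nat.le_of_lt_succ ((Nat.div_lt_iff_lt_mul (by omega)).2 ?_)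
    rw [Nat.succ_mul]
    rw [← hB] at hmB
    omega
  have hnbm : m ≤ nb * B := by
    have := Nat.lt_div_mul_add (a := m + B - 1) (b := B) (by omega)
    rw [← hnb] at this
    omega
  have hnbm' : (nb - 1) * B < m := by
    have := Nat.div_mul_le_self (m + B - 1) B
    rw [← hnb] at this
    rw [Nat.sub_mul]
    omega
  have hkk1 : 1 ≤ kk := by rw [hkk]; exact width_pos _ _ _ _ _
  have hkkM : kk ≤ M := by
    have := width_le M (min ω (2 ^ w - 1)) nb (rhoOf io M) M
    rw [← hkk] at this
    omega
  have p1 : (nb + 2) * (kk + 2) ≤ S * S := Nat.mul_le_mul (by omega) (by omega)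
  have p2 : (nb + 1) * (kk + 1) ≤ S * S := Nat.mul_le_mul (by omega) (by omega)
  have p3 : (m + n + B + 4) * ((nb + 1) * (kk + 1)) ≤ 2 * S * (S * S) :=
    Nat.mul_le_mul (by omega) p2
  have p4 : 2 * S * (S * S) = 2 * (S * S * S) := by ring
  have p5 : (kk + 2) * B ≤ S * S := Nat.mul_le_mul (by omega) (by omega)
  have p6 : (nb + 1) * B ≤ S * S := Nat.mul_le_mul (by omega) (by omega)
  have p7 : (nb + 1) * (kk + 2) ≤ S * S := Nat.mul_le_mul (by omega) (by omega)
  have hwf : E.Wf := by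
    rw [hE]
    exact envSmall_wf (by omega) (by omega) (by omega) (by omega)
  have ew : E.w = w := by rw [hE]; rfl
  have eM : E.M = M := by rw [hE]; rfl
  have eb : E.b = .small := by rw [hE]; rfl
  have hP : (parOf lcs x y 4 B nb kk).Ok E := by
    refine ⟨hwf, by change 1 ≤ B; omega, hnb1, hkk1, by change 1 ≤ m; omega, by change 1 ≤ n; omega,
      hnbB, hnbm, hnbm', by change sgOf lcs ≤ 2; cases lcs <;> decide, ?_, ?_, ?_, ?_, ?_, ?_, ?_, ?_, ?_, ?_, ?_, ?_⟩
    · intro k hk i hi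
      change i ≤ B at hi
      subst hE
      cases k <;> simp only [Arr.large, reduceCtorEq] at hk <;>
        simp only [envSmall, reduceCtorEq, if_false, Arr.large, Bool.false_eq_true, Arr.addr,
          Arr.stride, Arr.off] <;> omega
    · intro i hi
      change i < m at hi
      rw [hE]
      simp only [envSmall, if_true]
      change 4 + i < _
      omega
    · intro i hi
      change i < n at hi
      rw [hE]
      simp only [envSmall, if_true]
      change 4 + m + i < _
      omega
    · intro i hi
      change i ≤ m at hi
      subst hE
      change 4 + m + n ≤ 4 + m + n + i ∧ 4 * (4 + m + n + i) + 4 < 2 ^ w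
      omega
    · intro i hi
      change i ≤ m at hi
      subst hE
      change 4 + m + n ≤ 4 + m + n + i ∧ 4 * (4 + m + n + i) + 4 < 2 ^ w
      omega
    · intro i hi
      change i < (nb + 1) * (kk + 2) at hi
      subst hE
      change 4 + m + n ≤ 4 + m + n + i ∧ 4 * (4 + m + n + i) + 4 < 2 ^ w
      omega
    all_goals rw [ew]
    · change 4 + m + n + m + (nb + 2) * (kk + 2) < 2 ^ w; omega
    · change (m + n + B + 4) * ((nb + 1) * (kk + 1)) < 2 ^ w; omega
    · change (kk + 2) * B + n + 2 < 2 ^ w; omega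
    · change 4 + m + B < 2 ^ w; omega
    · change 4 + m + n + 2 < 2 ^ w; omega
    · change (nb + 1) * B < 2 ^ w; omega
  have hrep := rep_absOf E (s := s) (by rw [ew]; exact hs)
  have hinp : ∀ i, (absOf E s).a inp i = inputMemory M ω w x y .large i := by
    intro i
    change s .large (i * 1 + 0) = _
    rw [mul_one, add_zero, hin]
  have hw3 : (m + M + 3) ^ 3 < 2 ^ E.w := by
    rw [ew]
    have h1 : (m + M + 3) ^ 3 ≤ (2 * S) ^ 3 := Nat.pow_le_pow_left (by omega) 3
    have h2 : (2 * S) ^ 3 = 8 * (S * S * S) := by ring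
    omega
  have hok4 : ∀ i < 4, E.ok inp i := by
    intro i hi
    rw [hE]
    simp only [envSmall, if_true]
    omega
  have hset := setupSmall_spec (E := E) (io := io) (m := m) (n := n) (M := M)
    (o := min ω (2 ^ w - 1)) (B := B) (nb := nb) (s := absOf E s) hok4 (by rw [hinp]; rfl) (by rw [hinp]; rfl) (by rw [hinp]; rfl)
    (by rw [hinp]; rfl) hB (by omega) hnb hw3
  have hrun := Tri.seq (Q' := fun t => t.v vres = solution lcs x y) (q := solve lcs) hset (by
    rintro t - ⟨g1, g2, g3, g4, g5, g6, g7⟩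
    refine solve_spec (B := B) (nb := nb) (kk := kk) hP g1 g2 g3 g4 (by rw [g6, hkk]) g5 ?_ ?_
    · intro i hi
      rw [g7, hinp]
      exact inputMemory_x hi
    · intro i hi
      rw [g7, hinp]
      exact inputMemory_y i)
  obtain ⟨c, t, hbig, hc, ht⟩ := hrun
  obtain ⟨c1, s1, e1, m1, r1⟩ := hbig.exec hwf (progSmall_small lcs io) s hrep
  obtain ⟨c2, s2, e2, m2, r2⟩ := exec_output hwf r1 ht
  rw [ew, eM, eb] at e1 e2
  refine ⟨_, s2, .seq e1 e2, r2, ?_⟩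
  rw [E.μ_add]
  have : (M + 3) * (20 * E.cs) = (M + 2) * (20 * E.cs) + 20 * E.cs := by ring
  omega

end AsymDP

/-! ### The variant with scratch memory in large memory -/

namespace AsymDP
open Var Arr

theorem exec_bounded {M w : ℕ} {p : Program} {s s' : Memory} {c : Cost} (h : Exec M w p s c s') :
    Bounded w s → Bounded w s' := by
  induction h with
  | skip => exact id
  | assign => exact fun h => h.write _ _ (BinOp.eval_lt _ _ _ _)
  | seq _ _ ih1 ih2 => exact fun h => ih2 (ih1 h)
  | iteTrue _ _ _ ih => exact ih
  | iteFalse _ _ _ ih => exact ih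
  | whileFalse => exact id
  | whileTrue _ _ _ _ ih1 ih2 => exact fun h => ih2 (ih1 h)

/-- Copy one cell of the input; cells `2` and `3` hold the source and the target. -/
def shiftStep : Program :=
  .seq (.assign ⟨.large, .indirect .large 3⟩ .add (.cell ⟨.large, .indirect .large 2⟩) (.const 0))
    (.seq (setCell .large 2 .sub (cellAt .large 2) (.const 1))
      (setCell .large 3 .sub (cellAt .large 3) (.const 1)))

/-- Move the strings in large memory to make room for scratch memory. -/
def shift : Program :=
  .seq (setCell .large 2 .add (cellAt .large 0) (cellAt .large 1))
    (.seq (setCell .large 2 .add (cellAt .large 2) (.const 3))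
      (.seq (setCell .large 3 .mul (cellAt .large 0) (.const 8))
        (.seq (setCell .large 3 .add (cellAt .large 3) (.const 80))
          (.seq (setCell .large 3 .add (cellAt .large 3) (cellAt .large 2))
            (.while (.lt (.const 3) (cellAt .large 2)) shiftStep)))))

section
variable {E : Env} {M w : ℕ}

theorem valid_cellAt (hw : 1024 ≤ 2 ^ w) {i : ℕ} (hi : i < 1024) (s : Memory) :
    (cellAt .large i).Valid M w s :=
  ⟨trivial, by change i < 2 ^ w; omega, trivial⟩

theorem hasCell_large {i : ℕ} (hi : i < 2 ^ w) : Bank.HasCell M w .large i := ⟨hi, trivial⟩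

theorem val_const (hw : 1024 ≤ 2 ^ w) {i : ℕ} (hi : i < 1024) (s : Memory) :
    (Operand.const i).val w s = i := Nat.mod_eq_of_lt (by omega)

theorem μ_const (i : ℕ) : E.μ (Operand.const i).cost = 0 := by
  simp [Operand.cost, Env.μ_zero]

theorem μ_large_write : E.μ Bank.large.writeCost = E.wW := by simp [Env.μ, Bank.writeCost]

theorem μ_large_read : E.μ Bank.large.readCost = E.wR := by simp [Env.μ, Bank.readCost]

theorem μ_cellAt (i : ℕ) : E.μ (cellAt .large i).cost = E.wR := by
  change E.μ (0 + Bank.large.readCost) = _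
  rw [Env.μ_add, Env.μ_zero, μ_large_read, zero_add]

@[simp] theorem write_self (s : Memory) (b : Bank) (a v : ℕ) : s.write b a v b a = v := by
  simp [Memory.write]

theorem write_ne (s : Memory) (b : Bank) {a a' : ℕ} (v : ℕ) (h : a' ≠ a) :
    s.write b a v b a' = s b a' := by
  simp [Memory.write, h]

theorem shiftStep_exec (hw : 1024 ≤ 2 ^ w) {s : Memory} {k d : ℕ} (h2 : s .large 2 = k)
    (h3 : s .large 3 = k + d) (hk : 3 < k) (hd : k + d < 2 ^ w) (hb : s .large k < 2 ^ w) :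
    ∃ c s', Exec M w shiftStep s c s' ∧ s' .large 2 = k - 1 ∧ s' .large 3 = k - 1 + d ∧
      s' .large (k + d) = s .large k ∧ (∀ i, i ≠ 2 → i ≠ 3 → i ≠ k + d → s' .large i = s .large i) ∧
      E.μ c = 5 * E.wR + 3 * E.wW := by
  have ex := Exec.assign (M := M) (w := w) ⟨.large, .indirect .large 3⟩ .add
    (.cell ⟨.large, .indirect .large 2⟩) (.const 0) s
    ⟨hasCell_large (M := M) (by omega), hasCell_large (M := M) (by simp only [Addr.val, h3]; omega)⟩
    ⟨hasCell_large (M := M) (by omega), hasCell_large (M := M) (by simp only [Addr.val, h2]; omega)⟩ trivial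
  have hv : BinOp.eval w .add (s .large k) ((Operand.const 0).val w s) = s .large k := by
    rw [val_const hw (by omega)]
    exact Nat.mod_eq_of_lt hb
  simp only [Addr.val, h3, Operand.val, h2] at ex hv
  rw [hv] at ex
  set s1 := s.write .large (k + d) (s .large k) with hs1
  have a2 : s1 .large 2 = k := by rw [hs1, write_ne _ _ _ (by omega), h2]
  have hsub : ∀ a, 1 ≤ a → a < 2 ^ w → BinOp.eval w .sub a 1 = a - 1 := by
    intro a h1 h2
    change (a + (2 ^ w - 1)) % 2 ^ w = _
    rw [show a + (2 ^ w - 1) = (a - 1) + 2 ^ w by omega, Nat.add_mod_right]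
    exact Nat.mod_eq_of_lt (by omega)
  have e2 := exec_set (M := M) (w := w) (b := .large) (i := 2) (f := .sub) (x := cellAt .large 2)
    (y := .const 1) (s := s1) (u := k) (v := 1) (z := k - 1) (hasCell_large (by omega))
    (valid_cellAt hw (by omega) _) trivial a2 (val_const hw (by omega) _)
    (hsub k (by omega) (by omega))
  set s2 := s1.write .large 2 (k - 1) with hs2
  have a3 : s2 .large 3 = k + d := by
    rw [hs2, write_ne _ _ _ (by omega), hs1, write_ne _ _ _ (by omega), h3]
  have e3 := exec_set (M := M) (w := w) (b := .large) (i := 3) (f := .sub) (x := cellAt .large 3)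
    (y := .const 1) (s := s2) (u := k + d) (v := 1) (z := k - 1 + d) (hasCell_large (by omega))
    (valid_cellAt hw (by omega) _) trivial a3 (val_const hw (by omega) _)
    (by rw [hsub _ (by omega) (by omega)]; omega)
  refine ⟨_, _, .seq ex (.seq e2 e3), ?_, ?_, ?_, ?_, ?_⟩
  · rw [write_ne _ _ _ (by omega), hs2, write_self]
  · rw [write_self]
  · rw [write_ne _ _ _ (by omega), hs2, write_ne _ _ _ (by omega), hs1, write_self]
  · intro i i1 i2 i3
    rw [write_ne _ _ _ i2, hs2, write_ne _ _ _ i1, hs1, write_ne _ _ _ i3]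
  · simp only [Env.μ_add, μ_cellAt, μ_const, μ_large_write]
    simp only [Operand.cost, Addr.cost, Env.μ_add, μ_large_read]
    omega

/-- Source and target overlap, so copying starts at the end. The strings begin in cell `4`, hence
the loop stops when the source pointer is `3`. -/
theorem shiftLoop_exec (hw : 1024 ≤ 2 ^ w) {d : ℕ} (hd4 : 4 ≤ d) : ∀ {k : ℕ} {s : Memory}, Bounded w s →
    s .large 2 = k + 3 → s .large 3 = k + 3 + d → k + 3 + d < 2 ^ w →
    ∃ c s', Exec M w (.while (.lt (.const 3) (cellAt .large 2)) shiftStep) s c s' ∧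
      (∀ i, 4 ≤ i → i ≤ k + 3 → s' .large (i + d) = s .large i) ∧
      (∀ i, i ≠ 2 → i ≠ 3 → (i < 4 + d ∨ k + 3 + d < i) → s' .large i = s .large i) ∧
      E.μ c ≤ (k + 1) * (6 * E.wR + 3 * E.wW) := by
  intro k
  induction k with
  | zero =>
    intro s _ h2 _ _
    refine ⟨_, s, .whileFalse ⟨trivial, valid_cellAt hw (by omega) _⟩ ?_, fun i h1 h2 => by omega,
      fun _ _ _ _ => rfl, ?_⟩
    · change ¬ 3 % 2 ^ w < s .large 2
      rw [h2, Nat.mod_eq_of_lt (by omega)]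
      omega
    · simp only [Test.cost, Env.μ_add, μ_cellAt, μ_const]; omega
  | succ k ih =>
    intro s hb h2 h3 hd
    obtain ⟨c1, s1, e1, a2, a3, a4, a5, m1⟩ := shiftStep_exec (E := E) (M := M) hw h2 h3 (by omega) hd
      (hb _ _)
    obtain ⟨c2, s2, e2, b1, b2, m2⟩ := ih (exec_bounded e1 hb) (by rw [a2]; omega) (by rw [a3]; omega)
      (by omega)
    refine ⟨_, s2, .whileTrue ⟨trivial, valid_cellAt hw (by omega) _⟩ ?_ e1 e2, ?_, ?_, ?_⟩
    · change 3 % 2 ^ w < s .large 2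
      rw [h2, Nat.mod_eq_of_lt (by omega)]
      omega
    · intro i i1 i2
      rcases Nat.lt_or_ge (k + 3) i with h | h
      · obtain rfl : i = k + 1 + 3 := by omega
        rw [b2 _ (by omega) (by omega) (by omega), a4]
      · rw [b1 i i1 h, a5 i (by omega) (by omega) (by omega)]
    · intro i i1 i2 i3
      rw [b2 i i1 i2 (by omega), a5 i i1 i2 (by omega)]
    · simp only [Test.cost, Env.μ_add, μ_cellAt, μ_const]
      rw [Nat.succ_mul (k + 1)]
      omega

theorem shift_exec (hw : 1024 ≤ 2 ^ w) {m n : ℕ} {s : Memory} (hb : Bounded w s)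
    (h0 : s .large 0 = m) (h1 : s .large 1 = n) (hmn : 9 * m + n + 84 < 2 ^ w) :
    ∃ c s', Exec M w shift s c s' ∧ s' .large 0 = m ∧ s' .large 1 = n ∧
      (∀ i < m + n, s' .large (8 * m + 84 + i) = s .large (4 + i)) ∧
      E.μ c ≤ (m + n + 3) * (6 * (E.wR + E.wW)) := by
  have hadd : ∀ a b, a + b < 2 ^ w → BinOp.eval w .add a b = a + b := fun a b h =>
    Nat.mod_eq_of_lt h
  have e1 := exec_set (M := M) (w := w) (b := .large) (i := 2) (f := .add) (x := cellAt .large 0)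
    (y := cellAt .large 1) (s := s) (u := m) (v := n) (z := m + n) (hasCell_large (by omega))
    (valid_cellAt hw (by omega) _) (valid_cellAt hw (by omega) _) h0 h1 (hadd _ _ (by omega))
  set s1 := s.write .large 2 (m + n) with hs1
  have e2 := exec_set (M := M) (w := w) (b := .large) (i := 2) (f := .add) (x := cellAt .large 2)
    (y := .const 3) (s := s1) (u := m + n) (v := 3) (z := m + n + 3) (hasCell_large (by omega))
    (valid_cellAt hw (by omega) _) trivial (write_self _ _ _ _) (val_const hw (by omega) _)
    (hadd _ _ (by omega))
  set s2 := s1.write .large 2 (m + n + 3) with hs2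
  have e3 := exec_set (M := M) (w := w) (b := .large) (i := 3) (f := .mul) (x := cellAt .large 0)
    (y := .const 8) (s := s2) (u := m) (v := 8) (z := m * 8) (hasCell_large (by omega))
    (valid_cellAt hw (by omega) _) trivial
    (by change s2 .large 0 = m; rw [hs2, write_ne _ _ _ (by omega), hs1, write_ne _ _ _ (by omega), h0])
    (val_const hw (by omega) _) (Nat.mod_eq_of_lt (by omega))
  set s3 := s2.write .large 3 (m * 8) with hs3
  have e4 := exec_set (M := M) (w := w) (b := .large) (i := 3) (f := .add) (x := cellAt .large 3)
    (y := .const 80) (s := s3) (u := m * 8) (v := 80) (z := m * 8 + 80) (hasCell_large (by omega))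
    (valid_cellAt hw (by omega) _) trivial (write_self _ _ _ _)
    (val_const hw (by omega) _) (hadd _ _ (by omega))
  set s4 := s3.write .large 3 (m * 8 + 80) with hs4
  have e5 := exec_set (M := M) (w := w) (b := .large) (i := 3) (f := .add) (x := cellAt .large 3)
    (y := cellAt .large 2) (s := s4) (u := m * 8 + 80) (v := m + n + 3)
    (z := m + n + 3 + (8 * m + 80)) (hasCell_large (by omega))
    (valid_cellAt hw (by omega) _) (valid_cellAt hw (by omega) _) (write_self _ _ _ _)
    (by change s4 .large 2 = _; rw [hs4, write_ne _ _ _ (by omega), hs3, write_ne _ _ _ (by omega),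
      hs2, write_self]) (by rw [hadd _ _ (by omega)]; omega)
  set s5 := s4.write .large 3 (m + n + 3 + (8 * m + 80)) with hs5
  have hs : ∀ i, i ≠ 2 → i ≠ 3 → s5 .large i = s .large i := by
    intro i i1 i2
    rw [hs5, write_ne _ _ _ i2, hs4, write_ne _ _ _ i2, hs3, write_ne _ _ _ i2, hs2,
      write_ne _ _ _ i1, hs1, write_ne _ _ _ i1]
  have hb5 : Bounded w s5 := exec_bounded e5 (exec_bounded e4 (exec_bounded e3 (exec_bounded e2
    (exec_bounded e1 hb))))
  obtain ⟨c, s6, e6, q1, q2, q3⟩ := shiftLoop_exec (E := E) (M := M) hw (d := 8 * m + 80) (by omega) (k := m + n) hb5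
    (by rw [hs5, write_ne _ _ _ (by omega), hs4, write_ne _ _ _ (by omega), hs3,
      write_ne _ _ _ (by omega), hs2, write_self]) (write_self _ _ _ _) (by omega)
  refine ⟨_, s6, .seq e1 (.seq e2 (.seq e3 (.seq e4 (.seq e5 e6)))), ?_, ?_, ?_, ?_⟩
  · rw [q2 0 (by omega) (by omega) (by omega), hs 0 (by omega) (by omega), h0]
  · rw [q2 1 (by omega) (by omega) (by omega), hs 1 (by omega) (by omega), h1]
  · intro i hi
    have := q1 (4 + i) (by omega) (by omega)
    rw [hs _ (by omega) (by omega)] at this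
    rw [← this]
    congr 1
    omega
  · simp only [Env.μ_add, μ_cellAt, μ_const, μ_large_write]
    have : (m + n + 3) * (6 * (E.wR + E.wW)) = (m + n + 1) * (6 * E.wR + 3 * E.wW) +
        ((m + n) * (3 * E.wW) + 12 * E.wR + 15 * E.wW) := by ring
    omega

end

def progLarge (lcs : Bool) : Program :=
  .seq shift (.seq ((setupLarge ;; solve lcs).comp .large) (output .large))

theorem progLarge_small (lcs : Bool) : (setupLarge ;; solve lcs).small = true := by
  cases lcs <;> rfl

/-- A single band of `m` rows, with rectangles of width `m`. The interleaved scratch arrays end at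
cell `8 * m + 79` at the latest, and the strings have been moved to cell `8 * m + 84`. -/
theorem progLarge_exec {M ω w wS wR wW : ℕ} {lcs : Bool} {x y : List ℕ} {s : Memory}
    (hs : Bounded w s) (hin : ∀ i, s .large i = inputMemory M ω w x y .large i)
    (hm1 : 1 ≤ x.length) (hmn : x.length ≤ y.length)
    (hw : 16 * (8 * (x.length + y.length)) ^ 3 ≤ 2 ^ w) {E : Env}
    (hE : E = envLarge M w (x.length + 2) (x.length * 8 + 84)
      (x.length * 8 + 84 + x.length + y.length) wS wR wW) :
    ∃ c s', Exec M w (progLarge lcs) s c s' ∧ s' .large 0 = solution lcs x y ∧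
      E.μ c ≤ mainCost E (parOf lcs x y (x.length * 8 + 84) x.length 1 1) +
        ((x.length + y.length + 3) * (6 * (E.wR + E.wW)) + 19 * E.cs + E.cw) := by
  set m := x.length with hm
  set n := y.length with hn
  set S := m + n with hS
  have hS2 : 2 ≤ S := by omega
  have hSS : 2 * S ≤ S * S := Nat.mul_le_mul_right _ hS2
  have hSSS : 2 * (S * S) ≤ S * S * S := by
    rw [mul_assoc S]; exact Nat.mul_le_mul_right _ hS2
  have hw' : 8192 * (S * S * S) ≤ 2 ^ w := by
    refine le_trans (le_of_eq ?_) hw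
    ring
  have hwf : E.Wf := by
    rw [hE]
    exact envLarge_wf (by omega) (by omega) (by omega) (by omega)
  have ew : E.w = w := by rw [hE]; rfl
  have eM : E.M = M := by rw [hE]; rfl
  have eb : E.b = .large := by rw [hE]; rfl
  have hP : (parOf lcs x y (m * 8 + 84) m 1 1).Ok E := by
    refine ⟨hwf, hm1, le_rfl, le_rfl, hm1, by change 1 ≤ n; omega,
      hm1, by change m ≤ 1 * m; omega, by change (1 - 1) * m < m; omega,
      by change sgOf lcs ≤ 2; cases lcs <;> decide, ?_, ?_, ?_, ?_, ?_, ?_, ?_, ?_, ?_, ?_, ?_, ?_⟩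
    · intro k hk i hi
      change i ≤ m at hi
      subst hE
      cases k <;> simp only [Arr.large, reduceCtorEq] at hk <;>
        simp only [envLarge, reduceCtorEq, if_false, Arr.large, Bool.false_eq_true] <;> omega
    · intro i hi
      change i < m at hi
      rw [hE]
      simp only [envLarge, if_true]
      change _ ≤ m * 8 + 84 + i ∧ m * 8 + 84 + i < _
      omega
    · intro i hi
      change i < n at hi
      rw [hE]
      simp only [envLarge, if_true]
      change _ ≤ m * 8 + 84 + m + i ∧ m * 8 + 84 + m + i < _
      omega
    · intro i hi
      change i ≤ m at hi
      subst hE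
      change m * 8 + 84 + m + n ≤ m * 8 + 84 + m + n + i ∧ 4 * (m * 8 + 84 + m + n + i) + 4 < 2 ^ w
      omega
    · intro i hi
      change i ≤ m at hi
      subst hE
      change m * 8 + 84 + m + n ≤ m * 8 + 84 + m + n + i ∧ 4 * (m * 8 + 84 + m + n + i) + 4 < 2 ^ w
      omega
    · intro i hi
      change i < 6 at hi
      subst hE
      change m * 8 + 84 + m + n ≤ m * 8 + 84 + m + n + i ∧ 4 * (m * 8 + 84 + m + n + i) + 4 < 2 ^ w
      omega
    all_goals rw [ew]
    · change m * 8 + 84 + m + n + m + 9 < 2 ^ w; omega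
    · change (m + n + m + 4) * 4 < 2 ^ w; omega
    · change 3 * m + n + 2 < 2 ^ w; omega
    · change m * 8 + 84 + m + m < 2 ^ w; omega
    · change m * 8 + 84 + m + n + 2 < 2 ^ w; omega
    · change 2 * m < 2 ^ w; omega
  obtain ⟨c0, s0, e0, i0, i1, i2, m0⟩ := shift_exec (E := E) (M := M) (w := w) (m := m) (n := n)
    (by omega) hs (by rw [hin]; rfl) (by rw [hin]; rfl) (by omega)
  have hrep := rep_absOf E (s := s0) (by rw [ew]; exact exec_bounded e0 hs)
  have hinp : ∀ i < m + n, (absOf E s0).a inp (m * 8 + 84 + i) =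
      inputMemory M ω w x y .large (4 + i) := by
    intro i hi
    subst hE
    change s0 .large ((m * 8 + 84 + i) * 1 + 0) = _
    rw [mul_one, add_zero, mul_comm m 8, i2 i hi, hin]
  -- Here scratch memory overlays the input header: `vm` and `vn` are the first two variables and
  -- live in cells `0` and `1`, which already hold the two lengths.
  have hset := setupLarge_spec (E := E) (m := m) (s := absOf E s0) (by subst hE; exact i0)
    (by rw [ew]; omega)
  have hrun := Tri.seq (Q' := fun t => t.v vres = solution lcs x y) (q := solve lcs) hset (by
    rintro t - ⟨g1, g2, g3, g4, g5, g6, g7⟩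
    refine solve_spec (B := m) (nb := 1) (kk := 1) hP g1 (g2.trans (by subst hE; exact i1)) g3 g4 g5
      g6 ?_ ?_
    · intro i hi
      rw [g7, hinp i (by omega)]
      exact inputMemory_x hi
    · intro i hi
      rw [g7, add_assoc, hinp _ (by omega), ← add_assoc]
      exact inputMemory_y i)
  obtain ⟨c, t, hbig, hc, ht⟩ := hrun
  obtain ⟨c1, s1, e1, m1, r1⟩ := hbig.exec hwf (progLarge_small lcs) s0 hrep
  obtain ⟨c2, s2, e2, m2, r2⟩ := exec_output hwf r1 ht
  rw [ew, eM, eb] at e1 e2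
  refine ⟨_, s2, .seq e0 (.seq e1 e2), r2, ?_⟩
  rw [E.μ_add, E.μ_add]
  rw [← hS] at m0
  omega

end AsymDP

/-! ### The complete program and its cost -/

namespace AsymDP
open Var Arr

/-- The program: tiles in small memory if there are few of them, otherwise everything in large
memory. -/
def mainProgram (lcs io : Bool) : Program :=
  .ite (.lt (cellAt .large 2) (.const 256)) (progLarge lcs)
    (.seq (setCell .small 0 .div (cellAt .large 2) (.const 16))
      (.seq (setCell .small 0 .mul (cellAt .small 0) (cellAt .small 0))
        (.ite (.lt (cellAt .small 0) (cellAt .large 0)) (progLarge lcs) (progSmall lcs io))))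

/-- Per rectangle there are `nb` lines with about `nb * kk` counts each, and a corridor has `kk +
nb` tiles of `B` columns at `B * cs + cr` each. All other reads and scratch steps are absorbed by
this product. The assumption `kk ≤ B` absorbs the writes of the table into those of the boundary,
`nb * B`. -/
theorem mainCost_le {E : Env} {P : Par} (hB : 1 ≤ P.B) (hk : 1 ≤ P.kk) (hnb : 1 ≤ P.nb)
    (hkB : P.kk ≤ P.B) (hm : P.m ≤ P.nb * P.B) (hn : 1 ≤ P.n) :
    mainCost E P ≤ ((P.n + P.kk * P.B - 1) / (P.kk * P.B)) *
      (1100 * (P.nb * P.nb * P.kk * (P.kk + P.nb) * (P.B * (P.B * E.cs + E.cr))) +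
        11 * (P.nb * P.B * E.cw)) := by
  have hkB0 : 1 ≤ P.kk * P.B := Nat.mul_pos hk hB
  have hnr : 1 ≤ (P.n + P.kk * P.B - 1) / (P.kk * P.B) := by
    rw [Nat.one_le_div_iff hkB0]; omega
  obtain ⟨m, n, B, nb, kk, sg, N0, xb, yb, x, y⟩ := P
  simp only at *
  simp only [mainCost, rectCost, stageCost, evalCost, colCost]
  set nr := (n + kk * B - 1) / (kk * B)
  set c := E.cs
  set r := E.cr with hr
  set g := E.cw with hg
  clear_value nr c r g
  set Z := B * c + r with hZ
  have hcZ : B * c ≤ Z := by omega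
  have hc0 : c ≤ B * c := Nat.le_mul_of_pos_left _ hB
  have hV : B * ((B + 1) * (50 * c) + r + 2 * c) ≤ 102 * (B * Z) := by
    have : (B + 1) * (50 * c) + r + 2 * c ≤ 102 * Z := by
      have : (B + 1) * (50 * c) = 50 * (B * c) + 50 * c := by ring
      omega
    calc _ ≤ B * (102 * Z) := Nat.mul_le_mul_left _ this
      _ = _ := by ring
  set V := B * ((B + 1) * (50 * c) + r + 2 * c)
  set T := B * Z with hT
  have hZT : Z ≤ T := Nat.le_mul_of_pos_left _ hB
  have hlin : ∀ d e : ℕ, e ≤ d → d * c + e * r ≤ d * Z := by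
    intro d e h
    calc d * c + e * r ≤ d * (B * c) + d * r :=
          Nat.add_le_add (Nat.mul_le_mul_left _ hc0) (Nat.mul_le_mul_right _ h)
      _ = d * Z := by rw [hZ]; ring
  -- One evaluation: finding the tiles costs no more than the sweeps, since `B + kk + 4 ≤ 6 * B` and
  -- `nb + 1 ≤ kk + nb`.
  have hE : (kk + nb) * V + (nb + 1) * ((B + kk + 4) * (40 * c + 3 * r)) + 2 * c ≤
      344 * ((kk + nb) * T) := by
    have h1 : (kk + nb) * V ≤ 102 * ((kk + nb) * T) :=
      (Nat.mul_le_mul_left _ hV).trans (le_of_eq (by ring))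
    have h2 : (nb + 1) * ((B + kk + 4) * (40 * c + 3 * r)) ≤ 240 * ((kk + nb) * T) := by
      calc _ ≤ (kk + nb) * ((6 * B) * (40 * Z)) := Nat.mul_le_mul (by omega)
            (Nat.mul_le_mul (by omega) (hlin 40 3 (by omega)))
        _ = _ := by rw [hT]; ring
    have h3 : 2 * T ≤ (kk + nb) * T := Nat.mul_le_mul_right _ (by omega)
    omega
  set X := (kk + nb) * T with hX
  have hX2 : 2 * T ≤ X := Nat.mul_le_mul_right _ (by omega)
  have hS : (kk + 1) * (V + (B + 4) * (21 * c + 2 * r) + g) +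
      (nb * kk + 1) * ((kk + nb) * V + (nb + 1) * ((B + kk + 4) * (40 * c + 3 * r)) + 2 * c) +
      (B + 1) * (30 * c + r + g) + 2 * c ≤ 1000 * (nb * kk * X) + 4 * (B * g) := by
    have hnk : 1 ≤ nb * kk := Nat.mul_pos hnb hk
    have hXX : X ≤ nb * kk * X := Nat.le_mul_of_pos_left _ hnk
    have h1 : (kk + 1) * (V + (B + 4) * (21 * c + 2 * r) + g) ≤ 207 * X + 2 * (B * g) := by
      have : (B + 4) * (21 * c + 2 * r) ≤ 105 * T := by
        calc _ ≤ (5 * B) * (21 * Z) := Nat.mul_le_mul (by omega) (hlin 21 2 (by omega))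
          _ = _ := by rw [hT]; ring
      calc _ ≤ (kk + 1) * (207 * T + g) := Nat.mul_le_mul_left _ (by omega)
        _ = 207 * ((kk + 1) * T) + (kk + 1) * g := by ring
        _ ≤ 207 * X + (2 * B) * g := Nat.add_le_add (Nat.mul_le_mul_left _
          (Nat.mul_le_mul_right _ (by omega))) (Nat.mul_le_mul_right _ (by omega))
        _ = _ := by ring
    have h2 : (nb * kk + 1) * ((kk + nb) * V + (nb + 1) * ((B + kk + 4) * (40 * c + 3 * r)) + 2 * c)
        ≤ 688 * (nb * kk * X) := by
      calc _ ≤ (2 * (nb * kk)) * (344 * X) := Nat.mul_le_mul (by omega) hE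
        _ = _ := by ring
    have h3 : (B + 1) * (30 * c + r + g) ≤ 60 * T + 2 * (B * g) := by
      have := hlin 30 1 (by omega)
      calc _ ≤ (2 * B) * (30 * Z + g) := Nat.mul_le_mul (by omega) (by omega)
        _ = _ := by rw [hT]; ring
    omega
  have hR : nb * ((kk + 1) * (V + (B + 4) * (21 * c + 2 * r) + g) +
      (nb * kk + 1) * ((kk + nb) * V + (nb + 1) * ((B + kk + 4) * (40 * c + 3 * r)) + 2 * c) +
      (B + 1) * (30 * c + r + g) + 2 * c) + (kk + 2) * (12 * c + g) + (m + 1) * (6 * c + r + g) +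
      2 * c ≤ 1050 * (nb * nb * kk * X) + 9 * (nb * B * g) := by
    have h1 := (Nat.mul_le_mul_left nb hS).trans
      (le_of_eq (show _ = 1000 * (nb * nb * kk * X) + 4 * (nb * B * g) by ring))
    have hBg : B * g ≤ nb * B * g := by
      rw [mul_assoc]; exact Nat.le_mul_of_pos_left _ hnb
    have hXX : X ≤ nb * nb * kk * X :=
      Nat.le_mul_of_pos_left _ (Nat.mul_pos (Nat.mul_pos hnb hnb) hk)
    have h2 : (kk + 2) * (12 * c + g) ≤ 36 * T + 3 * (B * g) := by
      calc _ ≤ (3 * B) * (12 * Z + g) := Nat.mul_le_mul (by omega) (by omega)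
        _ = _ := by rw [hT]; ring
    have h3 : (m + 1) * (6 * c + r + g) ≤ 12 * (nb * T) + 2 * (nb * B * g) := by
      have := hlin 6 1 (by omega)
      have hnB : 1 ≤ nb * B := Nat.mul_pos hnb hB
      calc _ ≤ (2 * (nb * B)) * (6 * Z + g) := Nat.mul_le_mul (by omega) (by omega)
        _ = _ := by rw [hT]; ring
    have h4 : nb * T ≤ X := Nat.mul_le_mul_right _ (by omega)
    omega
  have hL : (m + 1) * (20 * c + r + g) ≤ nr * (40 * (nb * nb * kk * X) + 2 * (nb * B * g)) := by
    have := hlin 20 1 (by omega)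
    have hnB : 1 ≤ nb * B := Nat.mul_pos hnb hB
    have hXX : X ≤ nb * nb * kk * X :=
      Nat.le_mul_of_pos_left _ (Nat.mul_pos (Nat.mul_pos hnb hnb) hk)
    have h4 : nb * T ≤ X := Nat.mul_le_mul_right _ (by omega)
    calc _ ≤ (2 * (nb * B)) * (20 * Z + g) := Nat.mul_le_mul (by omega) (by omega)
      _ = 40 * (nb * T) + 2 * (nb * B * g) := by rw [hT]; ring
      _ ≤ 40 * (nb * nb * kk * X) + 2 * (nb * B * g) := by omega
      _ ≤ _ := Nat.le_mul_of_pos_left _ hnr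
  refine (Nat.add_le_add (Nat.mul_le_mul_left nr hR) hL).trans ?_
  rw [← Nat.mul_add]
  refine Nat.mul_le_mul_left _ ?_
  have : nb * nb * kk * (kk + nb) * T = nb * nb * kk * X := by
    rw [hX]; ring
  rw [this]
  omega

section
variable {M ω w : ℕ} {lcs io : Bool} {x y : List ℕ}

/-- The exponent `16` absorbs constant factors: the total length `S` is at least `2`, so `16 * (8 *
S) ^ 3 = 2 ^ 13 * S ^ 3 ≤ S ^ 16`. -/
theorem largeWord (h1 : 1 ≤ x.length) (h2 : 1 ≤ y.length)
    (hw : (x.length + y.length) ^ 16 ≤ 2 ^ w) :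
    16 * (8 * (x.length + y.length)) ^ 3 ≤ 2 ^ w ∧ 1024 ≤ 2 ^ w := by
  set S := x.length + y.length with hS
  have hS2 : 2 ≤ S := by omega
  have h13 : 2 ^ 13 ≤ S ^ 13 := Nat.pow_le_pow_left hS2 13
  constructor
  · calc 16 * (8 * S) ^ 3 = 2 ^ 13 * S ^ 3 := by ring
      _ ≤ S ^ 13 * S ^ 3 := Nat.mul_le_mul_right _ h13
      _ = S ^ 16 := by ring
      _ ≤ _ := hw
  · calc 1024 ≤ 2 ^ 16 := by norm_num
      _ ≤ S ^ 16 := Nat.pow_le_pow_left hS2 16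
      _ ≤ _ := hw

theorem bounded_input (hM : 1 ≤ M) (hMm : M ≤ x.length) (hmn : x.length ≤ y.length)
    (hw : (x.length + y.length) ^ 16 ≤ 2 ^ w) (hz : ∀ z ∈ x ++ y, z < 2 ^ w) :
    Bounded w (inputMemory M ω w x y) := by
  have h : x.length + y.length ≤ 2 ^ w := (Nat.le_self_pow (by norm_num) _).trans hw
  exact bounded_inputMemory (by omega) (by omega) (by omega) hz

theorem μ_cellAt_small {E : Env} (i : ℕ) : E.μ (cellAt .small i).cost = E.wS := by
  change E.μ (0 + Bank.small.readCost) = _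
  rw [Env.μ_add, Env.μ_zero]
  simp [Env.μ, Bank.readCost]

theorem μ_small_write {E : Env} : E.μ Bank.small.writeCost = E.wS := by
  simp [Env.μ, Bank.writeCost]

theorem readLengths_exec {wS wR wW : ℕ} {E : Env} (hE : E.wS = wS ∧ E.wR = wR ∧ E.wW = wW)
    (hM : 256 ≤ M) (hMm : M ≤ x.length) (hmn : x.length ≤ y.length)
    (hw : (x.length + y.length) ^ 16 ≤ 2 ^ w) (hz : ∀ z ∈ x ++ y, z < 2 ^ w) :
    ∃ c s, (∀ p c' s', Exec M w p s c' s' →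
        Exec M w (.seq (setCell .small 0 .div (cellAt .large 2) (.const 16))
      (.seq (setCell .small 0 .mul (cellAt .small 0) (cellAt .small 0)) p)) (inputMemory M ω w x y)
          (c + c') s') ∧ Bounded w s ∧ s .small 0 = M / 16 * (M / 16) ∧
      (∀ i, s .large i = inputMemory M ω w x y .large i) ∧ E.μ c = wR + 4 * wS := by
  obtain ⟨hw1, hw2⟩ := largeWord (x := x) (y := y) (by omega) (by omega) hw
  have hb := bounded_input (ω := ω) (by omega) hMm hmn hw hz
  have hM2 : M * M < 2 ^ w := by
    refine lt_of_lt_of_le ?_ hw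
    calc M * M < (x.length + y.length) * (x.length + y.length) :=
          Nat.mul_lt_mul_of_lt_of_lt (by omega) (by omega)
      _ = (x.length + y.length) ^ 2 := by ring
      _ ≤ _ := Nat.pow_le_pow_right (by omega) (by omega)
  have hMM : M ≤ M * M := Nat.le_mul_of_pos_left _ (by omega)
  have hle : M / 16 * (M / 16) ≤ M * M := Nat.mul_le_mul (by omega) (by omega)
  have e1 := exec_set (M := M) (w := w) (b := .small) (i := 0) (f := .div) (x := cellAt .large 2)
    (y := .const 16) (s := inputMemory M ω w x y) (u := M) (v := 16) (z := M / 16)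
    ⟨by omega, by change 0 < M; omega⟩ (valid_cellAt hw2 (by omega) _) trivial rfl
    (val_const hw2 (by omega) _) (Nat.mod_eq_of_lt (by omega))
  have e2 := exec_set (M := M) (w := w) (b := .small) (i := 0) (f := .mul) (x := cellAt .small 0)
    (y := cellAt .small 0) (s := (inputMemory M ω w x y).write .small 0 (M / 16)) (u := M / 16)
    (v := M / 16) (z := M / 16 * (M / 16)) ⟨by omega, by change 0 < M; omega⟩
    ⟨trivial, by change 0 < 2 ^ w; omega, by change 0 < M; omega⟩
    ⟨trivial, by change 0 < 2 ^ w; omega, by change 0 < M; omega⟩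
    (write_self _ _ _ _) (write_self _ _ _ _) (Nat.mod_eq_of_lt (by omega))
  refine ⟨(cellAt .large 2).cost + (Operand.const 16).cost + Bank.small.writeCost +
    ((cellAt .small 0).cost + (cellAt .small 0).cost + Bank.small.writeCost), _, fun p c' s' h => ?_, exec_bounded e2 (exec_bounded e1 hb), write_self _ _ _ _,
    fun i => ?_, ?_⟩
  · have h3 := Exec.seq e1 (Exec.seq e2 h)
    rwa [show ∀ a b c : Cost, a + (b + c) = a + b + c by
      rintro ⟨a1, a2, a3, a4⟩ ⟨b1, b2, b3, b4⟩ ⟨c1, c2, c3, c4⟩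
      change Cost.mk _ _ _ _ = Cost.mk _ _ _ _
      congr 1 <;> exact (Nat.add_assoc _ _ _).symm] at h3
  · simp [Memory.write]
  · obtain ⟨rfl, rfl, rfl⟩ := hE
    simp only [Env.μ_add, μ_cellAt, μ_const, μ_cellAt_small, μ_small_write]
    omega

theorem mainProgram_exec_small {wS wR wW B nb kk : ℕ} {E : Env}
    (hM : 256 ≤ M) (hMm : M ≤ x.length) (hmn : x.length ≤ y.length)
    (hmB : x.length ≤ M / 16 * (M / 16))
    (hw : (x.length + y.length) ^ 16 ≤ 2 ^ w) (hz : ∀ z ∈ x ++ y, z < 2 ^ w) (hB : B = M / 16)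
    (hnb : nb = (x.length + B - 1) / B)
    (hkk : kk = width M (min ω (2 ^ w - 1)) nb (rhoOf io M) M)
    (hE : E = envSmall M w (4 + x.length + y.length) wS wR wW) :
    ∃ c s', Exec M w (mainProgram lcs io) (inputMemory M ω w x y) c s' ∧
      s' .large 0 = solution lcs x y ∧
      E.μ c ≤ ((y.length + kk * B - 1) / (kk * B)) *
        (2000 * (nb * nb * kk * (kk + nb) * (B * (B * E.cs + E.cr))) + 12 * (nb * B * E.cw)) := by
  obtain ⟨hw1, hw2⟩ := largeWord (x := x) (y := y) (by omega) (by omega) hw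
  obtain ⟨c0, s0, e0, hb0, h00, hin0, m0⟩ := readLengths_exec (ω := ω) (E := E) (wS := wS) (wR := wR)
    (wW := wW) (by rw [hE]; exact ⟨rfl, rfl, rfl⟩) hM hMm hmn hw hz
  obtain ⟨c1, s1, e1, r1, m1⟩ := progSmall_exec (lcs := lcs) hb0 hin0 hM hMm hmn hmB hw1 hB hnb hkk hE
  refine ⟨_, s1, .iteFalse ⟨valid_cellAt hw2 (by omega) _, trivial⟩ ?_ (e0 _ _ _ (.iteFalse
    ⟨⟨trivial, by change 0 < 2 ^ w; omega, by change 0 < M; omega⟩, valid_cellAt hw2 (by omega) _⟩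
    ?_ e1)), r1, ?_⟩
  · change ¬ M < 256 % 2 ^ w
    rw [Nat.mod_eq_of_lt (by omega)]
    omega
  · change ¬ s0 .small 0 < s0 .large 0
    rw [h00, hin0]
    exact Nat.not_lt.2 hmB
  have hB16 : 16 ≤ B := by omega
  have hnb1 : nb * B ≤ x.length + B - 1 := by rw [hnb]; exact Nat.div_mul_le_self _ _
  have hnb2 : x.length ≤ nb * B := by
    have := Nat.lt_div_mul_add (a := x.length + B - 1) (b := B) (by omega)
    rw [← hnb] at this
    omega
  -- There are at least 16 bands because `m ≥ M ≥ 16 * B`. Together with `kk * nb ≤ M` this yields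
  -- `kk ≤ B`.
  have hnb16 : 16 ≤ nb := by
    by_contra h
    have : nb * B ≤ 15 * B := Nat.mul_le_mul_right _ (by omega)
    omega
  have hk1 : 1 ≤ kk := by rw [hkk]; exact width_pos _ _ _ _ _
  have hkB : kk ≤ B := by
    rcases width_good M (min ω (2 ^ w - 1)) nb (rhoOf io M) M with h | h
    · omega
    · rw [← hkk] at h
      have h1 := h.1
      have : kk * 16 ≤ kk * nb := Nat.mul_le_mul_left _ hnb16
      omega
  have hmain := mainCost_le (E := E) (P := parOf lcs x y 4 B nb kk) (by change 1 ≤ B; omega) hk1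
    (by change 1 ≤ nb; omega) hkB hnb2 (by change 1 ≤ y.length; omega)
  change _ ≤ ((y.length + kk * B - 1) / (kk * B)) *
    (1100 * (nb * nb * kk * (kk + nb) * (B * (B * E.cs + E.cr))) + 11 * (nb * B * E.cw)) at hmain
  have hnr : 1 ≤ (y.length + kk * B - 1) / (kk * B) := by
    rw [Nat.one_le_div_iff (Nat.mul_pos hk1 (by omega))]; omega
  set nr := (y.length + kk * B - 1) / (kk * B)
  have hext : (M + 3) * (20 * E.cs) + 4 * E.cr + E.cw + (3 * wR + 5 * wS) ≤
      nr * (900 * (nb * nb * kk * (kk + nb) * (B * (B * E.cs + E.cr))) + nb * B * E.cw) := by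
    refine le_trans ?_ (Nat.le_mul_of_pos_left _ hnr)
    refine le_trans ?_ (Nat.add_le_add (Nat.mul_le_mul_left 900 (Nat.le_mul_of_pos_left
      (B * (B * E.cs + E.cr)) (Nat.mul_pos (Nat.mul_pos (Nat.mul_pos (by omega) (by omega)) hk1)
        (by omega)))) (Nat.le_mul_of_pos_left E.cw (Nat.mul_pos (by omega) (by omega))))
    have h1 : B * E.cs + E.cr ≤ B * (B * E.cs + E.cr) := Nat.le_mul_of_pos_left _ (by omega)
    have h2 : (M + 3) * (20 * E.cs) ≤ (34 * B) * (20 * E.cs) := Nat.mul_le_mul_right _ (by omega)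
    have h3 : (34 * B) * (20 * E.cs) = 680 * (B * E.cs) := by ring
    have h4 : E.cs = 16 * wS := by
      rw [hE]
      simp only [Env.cs, Env.μ, envSmall, Bank.readCost, Bank.writeCost]
      omega
    have h5 : E.cr = E.cs + wR := by rw [hE]; rfl
    omega
  have hsum : nr * (2000 * (nb * nb * kk * (kk + nb) * (B * (B * E.cs + E.cr))) +
      12 * (nb * B * E.cw)) = nr * (1100 * (nb * nb * kk * (kk + nb) * (B * (B * E.cs + E.cr))) +
      11 * (nb * B * E.cw)) +
      nr * (900 * (nb * nb * kk * (kk + nb) * (B * (B * E.cs + E.cr))) + nb * B * E.cw) := by ring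
  have t1 : E.μ (Test.lt (cellAt .large 2) (.const 256)).cost = wR := by
    rw [hE]
    simp only [Test.cost, Env.μ_add, μ_cellAt, μ_const]
    rfl
  have t2 : E.μ (Test.lt (cellAt .small 0) (cellAt .large 0)).cost = wS + wR := by
    rw [hE]
    simp only [Test.cost, Env.μ_add, μ_cellAt, μ_cellAt_small]
    rfl
  rw [E.μ_add, E.μ_add, E.μ_add, t1, t2]
  omega

/-- The crude factor `x.length` is harmless, since in this case the shorter string has bounded
length by `Sizes.bounded`. -/
theorem mainProgram_exec_large {wS wR wW : ℕ} {E : Env} (hR : 1 ≤ wR) (hSR : wS ≤ wR) (hRW : wR ≤ wW)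
    (hM : 1 ≤ M) (hMm : M ≤ x.length) (hmn : x.length ≤ y.length)
    (hmB : M < 256 ∨ M / 16 * (M / 16) < x.length)
    (hw : (x.length + y.length) ^ 16 ≤ 2 ^ w) (hz : ∀ z ∈ x ++ y, z < 2 ^ w)
    (hE : E.wS = wS ∧ E.wR = wR ∧ E.wW = wW) :
    ∃ c s', Exec M w (mainProgram lcs io) (inputMemory M ω w x y) c s' ∧
      s' .large 0 = solution lcs x y ∧
      E.μ c ≤ 200000 * (x.length * x.length * y.length * wW) := by
  obtain ⟨hw1, hw2⟩ := largeWord (x := x) (y := y) (by omega) (by omega) hw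
  have hb := bounded_input (ω := ω) hM hMm hmn hw hz
  obtain ⟨F, hF⟩ : ∃ F, F = envLarge M w (x.length + 2) (x.length * 8 + 84)
      (x.length * 8 + 84 + x.length + y.length) wS wR wW := ⟨_, rfl⟩
  -- The weighted cost depends only on the three weights, not on the bank that serves as scratch
  -- memory.
  have hEF : E.μ = F.μ := by
    funext c
    simp only [Env.μ, hE.1, hE.2.1, hE.2.2, hF, envLarge]
  rw [hEF]
  have t1 : F.μ (Test.lt (cellAt .large 2) (.const 256)).cost = wR := by
    rw [hF]
    simp only [Test.cost, Env.μ_add, μ_cellAt, μ_const]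
    rfl
  have t2 : F.μ (Test.lt (cellAt .small 0) (cellAt .large 0)).cost = wS + wR := by
    rw [hF]
    simp only [Test.cost, Env.μ_add, μ_cellAt, μ_cellAt_small]
    rfl
  have hbound : mainCost F (parOf lcs x y (x.length * 8 + 84) x.length 1 1) +
      ((x.length + y.length + 3) * (6 * (F.wR + F.wW)) + 19 * F.cs + F.cw) + (3 * wR + 5 * wS) ≤
      200000 * (x.length * x.length * y.length * wW) := by
    have hmain := mainCost_le (E := F) (P := parOf lcs x y (x.length * 8 + 84) x.length 1 1)
      (by change 1 ≤ x.length; omega) le_rfl le_rfl (by change 1 ≤ x.length; omega)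
      (by change x.length ≤ 1 * x.length; omega) (by change 1 ≤ y.length; omega)
    have hcs : F.cs = 8 * (wR + wW) := by
      rw [hF]
      simp only [Env.cs, Env.μ, envLarge, Bank.readCost, Bank.writeCost]
      omega
    have hcr : F.cr = F.cs + wR := by rw [hF]; rfl
    have hcw : F.cw = F.cs + wW := by rw [hF]; rfl
    have hfR : F.wR = wR := by rw [hF]; rfl
    have hfW : F.wW = wW := by rw [hF]; rfl
    change _ ≤ ((y.length + 1 * x.length - 1) / (1 * x.length)) *
      (1100 * (1 * 1 * 1 * (1 + 1) * (x.length * (x.length * F.cs + F.cr))) +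
        11 * (1 * x.length * F.cw)) at hmain
    set m := x.length
    set n := y.length
    have hnr : (n + 1 * m - 1) / (1 * m) * m ≤ 2 * n := by
      have := Nat.div_mul_le_self (n + 1 * m - 1) (1 * m)
      rw [one_mul] at this ⊢
      omega
    set nr := (n + 1 * m - 1) / (1 * m)
    have hm1 : 1 ≤ m := by omega
    have hn1 : 1 ≤ n := by omega
    have hZ : m * F.cs + F.cr ≤ 33 * (m * wW) := by
      have h1 : F.cs ≤ 16 * wW := by omega
      have h2 : m * F.cs ≤ m * (16 * wW) := Nat.mul_le_mul_left _ h1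
      have h3 : m * (16 * wW) = 16 * (m * wW) := by ring
      have h4 : wW ≤ m * wW := Nat.le_mul_of_pos_left _ hm1
      omega
    have hA : nr * (1100 * (1 * 1 * 1 * (1 + 1) * (m * (m * F.cs + F.cr))) + 11 * (1 * m * F.cw)) ≤
        146000 * (m * n * wW) := by
      calc _ ≤ nr * (1100 * (1 * 1 * 1 * (1 + 1) * (m * (33 * (m * wW)))) + 11 * (1 * m * (17 * wW))) := by
            gcongr
            omega
        _ = (nr * m) * (72600 * (m * wW) + 187 * wW) := by ring
        _ ≤ (2 * n) * (72600 * (m * wW) + 187 * (m * wW)) :=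
          Nat.mul_le_mul hnr (Nat.add_le_add_left (Nat.mul_le_mul_left _
            (Nat.le_mul_of_pos_left _ hm1)) _)
        _ = 145574 * (m * n * wW) := by ring
        _ ≤ _ := Nat.mul_le_mul_right _ (by norm_num)
    have hBd : (m + n + 3) * (6 * (F.wR + F.wW)) ≤ 60 * (m * n * wW) := by
      calc _ ≤ (5 * n) * (12 * wW) := Nat.mul_le_mul (by omega) (by omega)
        _ = 60 * (n * wW) := by ring
        _ ≤ 60 * (m * n * wW) := by
          rw [mul_assoc]; exact Nat.mul_le_mul_left _ (Nat.le_mul_of_pos_left _ hm1)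
    have hC : wW ≤ m * n * wW := Nat.le_mul_of_pos_left _ (Nat.mul_pos hm1 hn1)
    have hD : m * n * wW ≤ m * m * n * wW :=
      (Nat.le_mul_of_pos_left _ hm1).trans (le_of_eq (by ring))
    omega
  by_cases h256 : M < 256
  · obtain ⟨c1, s1, e1, r1, m1⟩ := progLarge_exec (lcs := lcs) hb (fun _ => rfl) (by omega) hmn hw1 hF
    refine ⟨_, s1, .iteTrue ⟨valid_cellAt hw2 (by omega) _, trivial⟩ ?_ e1, r1, ?_⟩
    · change M < 256 % 2 ^ w
      rwa [Nat.mod_eq_of_lt (by omega)]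
    · rw [F.μ_add, t1]
      omega
  · obtain ⟨c0, s0, e0, hb0, h00, hin0, m0⟩ := readLengths_exec (ω := ω) (E := F) (wS := wS)
      (wR := wR) (wW := wW) (by rw [hF]; exact ⟨rfl, rfl, rfl⟩) (by omega) hMm hmn hw hz
    obtain ⟨c1, s1, e1, r1, m1⟩ := progLarge_exec (lcs := lcs) hb0 hin0 (by omega) hmn hw1 hF
    refine ⟨_, s1, .iteFalse ⟨valid_cellAt hw2 (by omega) _, trivial⟩ ?_ (e0 _ _ _ (.iteTrue
      ⟨⟨trivial, by change 0 < 2 ^ w; omega, by change 0 < M; omega⟩, valid_cellAt hw2 (by omega) _⟩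
      ?_ e1)), r1, ?_⟩
    · change ¬ M < 256 % 2 ^ w
      rwa [Nat.mod_eq_of_lt (by omega)]
    · change s0 .small 0 < s0 .large 0
      rw [h00, hin0]
      exact hmB.resolve_left h256
    · rw [F.μ_add, F.μ_add, F.μ_add, t1, t2]
      omega

end

end AsymDP

namespace AsymDP

/-! ## The parameters -/

/-- The common form of `kT'` and `kQ'`. -/
noncomputable def kPrime (ω M ρ h : ℝ) : ℝ := min (Real.sqrt (ω / (h * ρ))) (M / h)

/-- The common form of `kT` and `kQ`. -/
noncomputable def kLong (ω M ρ : ℝ) : ℝ := min ((ω / ρ) ^ (1 / 3 : ℝ)) (Real.sqrt M)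

theorem kT'_eq (ω M h : ℝ) : kT' ω M h = kPrime ω M M h := rfl

theorem kQ'_eq (ω M h : ℝ) : kQ' ω M h = kPrime ω M 1 h := by simp [kQ', kPrime]

theorem kT_eq (ω M : ℝ) : kT ω M = kLong ω M M := rfl

theorem kQ_eq (ω M : ℝ) : kQ ω M = kLong ω M 1 := by simp [kQ, kLong]

section
variable {ω M ρ h : ℝ}

theorem cube_rpow_third {v : ℝ} (hv : 0 ≤ v) : (v ^ (1 / 3 : ℝ)) ^ 3 = v := by
  rw [← Real.rpow_natCast, ← Real.rpow_mul hv]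
  norm_num

/-- With `t = (ω / ρ) ^ (1 / 3)`, the bound `h ≤ t` gives `t ^ 2 * h ≤ t ^ 3 = ω / ρ`, and `h ≤ √M`
gives `√M * h ≤ M`. -/
theorem kLong_le_kPrime (hω : 0 < ω) (hM : 0 < M) (hρ : 0 < ρ) (hh : 0 < h)
    (h1 : h ≤ kLong ω M ρ) : kLong ω M ρ ≤ kPrime ω M ρ h := by
  have hv : 0 < ω / ρ := div_pos hω hρ
  have h2 := h1.trans (min_le_left _ _)
  have h3 := h1.trans (min_le_right _ _)
  refine le_min ((min_le_left _ _).trans ?_) ((min_le_right _ _).trans ?_)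
  · set t := (ω / ρ) ^ (1 / 3 : ℝ) with ht
    have ht3 : t ^ 3 = ω / ρ := cube_rpow_third hv.le
    have ht0 : 0 < t := Real.rpow_pos_of_pos hv _
    refine Real.le_sqrt_of_sq_le ?_
    rw [mul_comm, ← div_div, ← ht3, le_div_iff₀ hh]
    nlinarith [mul_le_mul_of_nonneg_left h2 (sq_nonneg t)]
  · rw [le_div_iff₀ hh]
    calc Real.sqrt M * h ≤ Real.sqrt M * Real.sqrt M := by gcongr
      _ = M := Real.mul_self_sqrt hM.le

theorem kLong_lt_kPrime (hω : 0 < ω) (hM : 0 < M) (hρ : 0 < ρ) (hh : 0 < h)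
    (h1 : h < kLong ω M ρ) : kLong ω M ρ < kPrime ω M ρ h := by
  have hv : 0 < ω / ρ := div_pos hω hρ
  have h2 := h1.trans_le (min_le_left _ _)
  have h3 := h1.trans_le (min_le_right _ _)
  refine lt_min ((min_le_left _ _).trans_lt ?_) ((min_le_right _ _).trans_lt ?_)
  · set t := (ω / ρ) ^ (1 / 3 : ℝ) with ht
    have ht3 : t ^ 3 = ω / ρ := cube_rpow_third hv.le
    have ht0 : 0 < t := Real.rpow_pos_of_pos hv _
    refine Real.lt_sqrt_of_sq_lt ?_
    rw [mul_comm h, ← div_div, ← ht3, lt_div_iff₀ hh]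
    nlinarith [mul_lt_mul_of_pos_left h2 (pow_pos ht0 2)]
  · have hs : 0 < Real.sqrt M := Real.sqrt_pos.2 hM
    rw [lt_div_iff₀ hh]
    calc Real.sqrt M * h < Real.sqrt M * Real.sqrt M := by gcongr
      _ = M := Real.mul_self_sqrt hM.le

end

/-- The hypotheses on the sizes of the strings. -/
structure Sizes (a b c : ℝ) (M ω m n ρ : ℕ) (h : ℝ) : Prop where
  M_pos : 1 ≤ M
  ω_pos : 1 ≤ ω
  ρ_pos : 1 ≤ ρ
  ρ_le : ρ ≤ M
  M_le : M ≤ m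
  m_le : m ≤ n
  a_pos : 0 < a
  a_le : a ≤ 1
  b_pos : 0 < b
  c_pos : 0 < c
  le_h : a * (m / M) ≤ h
  h_le : h ≤ b * (m / M)
  h_long : h ≤ kLong ω M ρ
  le_n : c * (kPrime ω M ρ h * M) ≤ n

namespace Sizes
variable {a b c : ℝ} {M ω m n ρ : ℕ} {h : ℝ}

theorem M_real (S : Sizes a b c M ω m n ρ h) : (0 : ℝ) < M := by exact_mod_cast S.M_pos

theorem le_ratio (S : Sizes a b c M ω m n ρ h) : (1 : ℝ) ≤ m / M := by
  rw [one_le_div S.M_real]; exact_mod_cast S.M_le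

theorem a_le_h (S : Sizes a b c M ω m n ρ h) : a ≤ h :=
  (le_mul_of_one_le_right S.a_pos.le S.le_ratio).trans S.le_h

theorem h_pos (S : Sizes a b c M ω m n ρ h) : 0 < h := S.a_pos.trans_le S.a_le_h

theorem h_le_kPrime (S : Sizes a b c M ω m n ρ h) : h ≤ kPrime ω M ρ h :=
  S.h_long.trans (kLong_le_kPrime (by exact_mod_cast S.ω_pos) S.M_real
    (by exact_mod_cast S.ρ_pos) S.h_pos S.h_long)

theorem k_pos (S : Sizes a b c M ω m n ρ h) : 0 < kPrime ω M ρ h := S.h_pos.trans_le S.h_le_kPrime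

end Sizes

/-- The choice of the sizes of tiles and rectangles. -/
structure Tiling (M ω m n ρ w B nb kk : ℕ) : Prop where
  le_M : 256 ≤ M
  word : (m + n) ^ 16 ≤ 2 ^ w
  B_eq : B = M / 16
  nb_eq : nb = (m + B - 1) / B
  kk_eq : kk = width M (min ω (2 ^ w - 1)) nb ρ M

section
variable {a b c : ℝ} {M ω m n ρ w B nb kk : ℕ} {h : ℝ}

theorem Tiling.B_le (T : Tiling M ω m n ρ w B nb kk) : 16 * B ≤ M := by
  have := T.B_eq; omega

theorem Tiling.le_B (T : Tiling M ω m n ρ w B nb kk) : M ≤ 17 * B := by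
  have := T.B_eq; have := T.le_M; omega

theorem Tiling.nb_mul_le (T : Tiling M ω m n ρ w B nb kk) (hm : M ≤ m) : nb * B ≤ 2 * m := by
  have h1 : nb * B ≤ m + B - 1 := by rw [T.nb_eq]; exact Nat.div_mul_le_self _ _
  have := T.B_le
  omega

theorem Tiling.le_nb_mul (T : Tiling M ω m n ρ w B nb kk) : m ≤ nb * B := by
  have := T.le_B
  have := T.le_M
  have := Nat.lt_div_mul_add (a := m + B - 1) (b := B) (by omega)
  rw [← T.nb_eq] at this
  omega

theorem Tiling.kk_pos (T : Tiling M ω m n ρ w B nb kk) : 1 ≤ kk := by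
  rw [T.kk_eq]; exact width_pos _ _ _ _ _

theorem Tiling.le_nb (T : Tiling M ω m n ρ w B nb kk) (S : Sizes a b c M ω m n ρ h) :
    16 * ((m : ℝ) / M) ≤ nb := by
  have h1 : 16 * m ≤ nb * M := by
    calc 16 * m ≤ 16 * (nb * B) := Nat.mul_le_mul_left _ T.le_nb_mul
      _ = nb * (16 * B) := by ring
      _ ≤ _ := Nat.mul_le_mul_left _ T.B_le
  rw [← mul_div_assoc, div_le_iff₀ S.M_real]
  exact_mod_cast h1

theorem Tiling.nb_le (T : Tiling M ω m n ρ w B nb kk) (S : Sizes a b c M ω m n ρ h) :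
    (nb : ℝ) ≤ 34 * ((m : ℝ) / M) := by
  have h1 : nb * M ≤ 34 * m := by
    calc nb * M ≤ nb * (17 * B) := Nat.mul_le_mul_left _ T.le_B
      _ = 17 * (nb * B) := by ring
      _ ≤ 17 * (2 * m) := Nat.mul_le_mul_left _ (T.nb_mul_le S.M_le)
      _ = _ := by ring
  rw [← mul_div_assoc, le_div_iff₀ S.M_real]
  exact_mod_cast h1

theorem Tiling.nb_le_h (T : Tiling M ω m n ρ w B nb kk) (S : Sizes a b c M ω m n ρ h) :
    (nb : ℝ) ≤ 34 / a * h := by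
  refine (T.nb_le S).trans ?_
  rw [div_mul_eq_mul_div, le_div_iff₀ S.a_pos]
  have := S.le_h
  linarith

/-- The width of a rectangle is not too small. -/
theorem Tiling.le_kk (T : Tiling M ω m n ρ w B nb kk) (S : Sizes a b c M ω m n ρ h) :
    kPrime ω M ρ h ≤ 136 / a * kk := by
  have ha := S.a_pos
  have hh := S.h_pos
  have hM := S.M_real
  have hk : (1 : ℝ) ≤ kk := by exact_mod_cast T.kk_pos
  have ha1 : (1 : ℝ) ≤ 1 / a := by rw [one_le_div ha]; exact S.a_le
  have hρ : (0 : ℝ) < ρ := by exact_mod_cast S.ρ_pos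
  have hnb := T.nb_le_h S
  by_cases hkM : M < kk + 1
  · refine (min_le_right _ _).trans ?_
    have h1 : (M : ℝ) ≤ kk := by exact_mod_cast Nat.lt_succ_iff.1 hkM
    calc (M : ℝ) / h ≤ kk / a := by gcongr; exact S.a_le_h
      _ = 1 * (1 / a) * kk := by ring
      _ ≤ 136 * (1 / a) * kk := by gcongr; norm_num
      _ = _ := by ring
  -- By maximality of `kk` the next width violates one of the two conditions, and each violation
  -- bounds one of the two arguments of the minimum in `kPrime`.
  have hbad : ¬ GoodWidth M (min ω (2 ^ w - 1)) nb ρ (kk + 1) := by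
    intro hg
    have := le_width hg (Nat.not_lt.1 hkM)
    rw [← T.kk_eq] at this
    omega
  have h2k : ((kk + 1 : ℕ) : ℝ) ≤ 2 * kk := by push_cast; linarith
  by_cases h1 : (kk + 1) * nb ≤ M
  · have h2 : ω < (kk + 1) * nb * (kk + 1) * ρ := by
      by_contra h2
      refine hbad ⟨h1, le_min (Nat.not_lt.1 h2) ?_⟩
      -- Truncating `ω` to a word does not affect the test, because the tested product fits into a
      -- word.
      have h3 : (kk + 1) * nb * (kk + 1) * ρ ≤ M * M * M :=
        Nat.mul_le_mul (Nat.mul_le_mul h1 (Nat.not_lt.1 hkM)) S.ρ_le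
      have h4 : M * M * M < 2 ^ w := by
        have hMS : M < m + n := by have := S.M_le; have := S.m_le; have := S.M_pos; omega
        refine lt_of_lt_of_le ?_ T.word
        calc M * M * M = M ^ 3 := by ring
          _ < (m + n) ^ 3 := Nat.pow_lt_pow_left hMS (by norm_num)
          _ ≤ _ := Nat.pow_le_pow_right (by omega) (by norm_num)
      omega
    refine (min_le_left _ _).trans ?_
    refine Real.sqrt_le_iff.2 ⟨by positivity, ?_⟩
    rw [div_le_iff₀ (by positivity)]
    have h3 : (ω : ℝ) ≤ ((kk + 1 : ℕ) : ℝ) * nb * ((kk + 1 : ℕ) : ℝ) * ρ := by exact_mod_cast h2.le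
    -- The constant is `136 = 2 * 2 * 34`, from `kk + 1 ≤ 2 * kk` used twice and `nb ≤ 34 / a * h`.
    calc (ω : ℝ) ≤ (2 * kk) * (34 / a * h) * (2 * kk) * ρ := by
          refine h3.trans ?_
          gcongr
      _ = 1 * (136 * (1 / a)) * (kk : ℝ) ^ 2 * (h * ρ) := by ring
      _ ≤ (136 * (1 / a)) * (136 * (1 / a)) * (kk : ℝ) ^ 2 * (h * ρ) := by gcongr; linarith
      _ = _ := by ring
  · refine (min_le_right _ _).trans ?_
    rw [div_le_iff₀ hh]
    have h3 : (M : ℝ) ≤ ((kk + 1 : ℕ) : ℝ) * nb := by exact_mod_cast (Nat.not_le.1 h1).le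
    calc (M : ℝ) ≤ (2 * kk) * (34 / a * h) := by
          refine h3.trans ?_
          gcongr
      _ = 68 * (1 / a * kk * h) := by ring
      _ ≤ 136 * (1 / a * kk * h) := by gcongr; norm_num
      _ = _ := by ring

/-- The width of a rectangle is not too large. -/
theorem Tiling.kk_le (T : Tiling M ω m n ρ w B nb kk) (S : Sizes a b c M ω m n ρ h) :
    (kk : ℝ) ≤ (1 + b + 1 / a) * kPrime ω M ρ h := by
  have ha := S.a_pos
  have hb := S.b_pos
  have hh := S.h_pos
  have hk0 := S.k_pos
  have hρ : (0 : ℝ) < ρ := by exact_mod_cast S.ρ_pos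
  -- The default width `1` need not be good. It is still covered, as `1 ≤ h / a` and `h ≤ kPrime`.
  rcases width_good M (min ω (2 ^ w - 1)) nb ρ M with h1 | h1
  · rw [← T.kk_eq] at h1
    rw [h1]
    calc ((1 : ℕ) : ℝ) ≤ 1 / a * h := by
          rw [one_div_mul_eq_div, Nat.cast_one, one_le_div ha]; exact S.a_le_h
      _ ≤ (1 + b + 1 / a) * kPrime ω M ρ h := by
          gcongr
          · linarith
          · exact S.h_le_kPrime
  · rw [← T.kk_eq] at h1
    obtain ⟨h1, h2⟩ := h1
    have h2 := h2.trans (min_le_left _ _)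
    have hnb : h ≤ b * nb := by
      refine S.h_le.trans ?_
      have := T.le_nb S
      have := S.le_ratio
      gcongr
      linarith
    have g1 : (kk : ℝ) * nb ≤ M := by exact_mod_cast h1
    have g2 : (kk : ℝ) * nb * kk * ρ ≤ ω := by exact_mod_cast h2
    have hkk : (0 : ℝ) ≤ kk := Nat.cast_nonneg _
    have key : (kk : ℝ) / (1 + b) ≤ kPrime ω M ρ h := by
      refine le_min ?_ ?_
      · refine Real.le_sqrt_of_sq_le ?_
        rw [le_div_iff₀ (by positivity), div_pow, div_mul_eq_mul_div, div_le_iff₀ (by positivity)]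
        calc (kk : ℝ) ^ 2 * (h * ρ) ≤ (kk : ℝ) ^ 2 * ((b * nb) * ρ) := by gcongr
          _ = b * (kk * nb * kk * ρ) := by ring
          _ ≤ (1 + b) ^ 2 * ω := by
            gcongr
            nlinarith
          _ = _ := by ring
      · rw [le_div_iff₀ hh, div_mul_eq_mul_div, div_le_iff₀ (by positivity)]
        calc (kk : ℝ) * h ≤ kk * (b * nb) := by gcongr
          _ = b * (kk * nb) := by ring
          _ ≤ (1 + b) * M := by gcongr; linarith
          _ = _ := by ring
    rw [div_le_iff₀ (by positivity)] at key
    have ha1 : 0 < 1 / a := by positivity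
    calc (kk : ℝ) ≤ (1 + b) * kPrime ω M ρ h := by rwa [mul_comm]
      _ ≤ _ := mul_le_mul_of_nonneg_right (by linarith) hk0.le

/-- The number of bands is bounded by the width of a rectangle. -/
theorem Tiling.nb_le_kk (T : Tiling M ω m n ρ w B nb kk) (S : Sizes a b c M ω m n ρ h) :
    (nb : ℝ) ≤ 34 / a * (136 / a) * kk := by
  have ha := S.a_pos
  refine (T.nb_le_h S).trans ?_
  rw [mul_assoc]
  gcongr
  exact S.h_le_kPrime.trans (T.le_kk S)

/-- The number of evaluations of a tile in a rectangle. -/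
theorem Tiling.evals_le (T : Tiling M ω m n ρ w B nb kk) (S : Sizes a b c M ω m n ρ h) :
    (nb : ℝ) * (kk + nb) * (ρ * kPrime ω M ρ h) ≤
      (1 + 34 / a * (136 / a)) * (136 / a + 34 / a * (136 / a)) * (ω + ρ * kPrime ω M ρ h) := by
  have ha := S.a_pos
  have hk0 := S.k_pos
  have hnb := T.nb_le_kk S
  have hle := T.le_kk S
  set c3 : ℝ := 34 / a * (136 / a) with hc3
  have hc30 : 0 < c3 := by positivity
  have h1 : (nb : ℝ) * (kk + nb) * (ρ * kPrime ω M ρ h) ≤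
      nb * ((1 + c3) * kk) * (ρ * kPrime ω M ρ h) := by
    gcongr
    linarith
  refine h1.trans ?_
  have hω : (0 : ℝ) ≤ ω := Nat.cast_nonneg _
  have hρk : (0 : ℝ) ≤ ρ * kPrime ω M ρ h := by positivity
  -- For the default width `1` the number of bands is bounded by a constant, and the summand `ρ *
  -- kPrime` on the right pays. A good width satisfies `kk * nb * kk * ρ ≤ ω`, and the summand `ω`
  -- pays.
  rcases width_good M (min ω (2 ^ w - 1)) nb ρ M with h1 | h1
  · rw [← T.kk_eq] at h1
    rw [h1] at hnb ⊢
    rw [Nat.cast_one, mul_one] at *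
    calc (nb : ℝ) * (1 + c3) * (ρ * kPrime ω M ρ h) ≤ c3 * (1 + c3) * (ρ * kPrime ω M ρ h) := by gcongr
      _ = (1 + c3) * c3 * (ρ * kPrime ω M ρ h) := by ring
      _ ≤ (1 + c3) * (136 / a + c3) * (ω + ρ * kPrime ω M ρ h) := by
        gcongr
        · have : 0 < 136 / a := by positivity
          linarith
        · linarith
  · rw [← T.kk_eq] at h1
    have h2 := h1.2.trans (min_le_left _ _)
    have g2 : (kk : ℝ) * nb * kk * ρ ≤ ω := by exact_mod_cast h2
    calc (nb : ℝ) * ((1 + c3) * kk) * (ρ * kPrime ω M ρ h) ≤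
          nb * ((1 + c3) * kk) * (ρ * (136 / a * kk)) := by gcongr
      _ = (1 + c3) * (136 / a) * (kk * nb * kk * ρ) := by ring
      _ ≤ (1 + c3) * (136 / a + c3) * (ω + ρ * kPrime ω M ρ h) := by
        gcongr
        · linarith
        · linarith

/-- The number of rectangles. -/
theorem Tiling.rects_le (T : Tiling M ω m n ρ w B nb kk) (S : Sizes a b c M ω m n ρ h) :
    (((n + kk * B - 1) / (kk * B) : ℕ) : ℝ) * (kk * B) ≤ (1 + (1 + b + 1 / a) / c) * n := by
  have ha := S.a_pos
  have hb := S.b_pos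
  have hc := S.c_pos
  have hk0 := S.k_pos
  have h1 : ((n + kk * B - 1) / (kk * B)) * (kk * B) ≤ n + kk * B :=
    (Nat.div_mul_le_self _ _).trans (Nat.sub_le _ _)
  have h2 : (((n + kk * B - 1) / (kk * B) : ℕ) : ℝ) * (kk * B) ≤ n + kk * B := by exact_mod_cast h1
  have hB : (B : ℝ) ≤ M := by
    have := T.B_le
    exact_mod_cast (show B ≤ M by omega)
  have h3 : (kk : ℝ) * B ≤ (1 + b + 1 / a) / c * n := by
    calc (kk : ℝ) * B ≤ ((1 + b + 1 / a) * kPrime ω M ρ h) * M := by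
          gcongr
          exact T.kk_le S
      _ = (1 + b + 1 / a) / c * (c * (kPrime ω M ρ h * M)) := by field_simp
      _ ≤ _ := by
        gcongr
        exact S.le_n
  linarith

/-- The part of the cost for writes. -/
theorem Tiling.writes_le (T : Tiling M ω m n ρ w B nb kk) (S : Sizes a b c M ω m n ρ h) {g : ℝ}
    (hg0 : 0 ≤ g) (hg : g ≤ 17 * ω) :
    (((n + kk * B - 1) / (kk * B) : ℕ) : ℝ) * (nb * B * g) ≤
      (1 + (1 + b + 1 / a) / c) * (17 * (136 / a)) * 34 * (m * n * ω / (kPrime ω M ρ h * M)) := by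
  have ha := S.a_pos
  have hb := S.b_pos
  have hc := S.c_pos
  have hk0 := S.k_pos
  have hM := S.M_real
  have h1 := T.rects_le S
  set nr : ℝ := (((n + kk * B - 1) / (kk * B) : ℕ) : ℝ)
  have hnr0 : 0 ≤ nr := Nat.cast_nonneg _
  set C := 1 + (1 + b + 1 / a) / c
  have hMB : (M : ℝ) ≤ 17 * B := by exact_mod_cast T.le_B
  have hnb : (nb : ℝ) * B ≤ 2 * m := by exact_mod_cast T.nb_mul_le S.M_le
  rw [← mul_div_assoc, le_div_iff₀ (by positivity)]
  calc nr * (nb * B * g) * (kPrime ω M ρ h * M) ≤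
        nr * ((2 * m) * (17 * ω)) * ((136 / a * kk) * (17 * B)) := by
        gcongr
        exact T.le_kk S
    _ = (nr * (kk * B)) * (m * ω) * (17 * (136 / a)) * 34 := by ring
    _ ≤ (C * n) * (m * ω) * (17 * (136 / a)) * 34 := by gcongr
    _ = _ := by ring

end
end AsymDP

/-! ### Total work and I/O cost -/

namespace AsymDP

section
variable {a b c : ℝ} {M ω m n ρ w B nb kk : ℕ} {h : ℝ}

/-- Regrouping gives `nr * (kk * B)`, which is `O(n)`, times `nb * B`, which is `O(m)`, times `nb *
(kk + nb)`. The last factor is `O(1 + ω / (kPrime * M))` by `Tiling.evals_le` with `ρ = M`. -/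
theorem Tiling.work_le (T : Tiling M ω m n M w B nb kk) (S : Sizes a b c M ω m n M h) :
    (((n + kk * B - 1) / (kk * B) : ℕ) : ℝ) * (nb * nb * kk * (kk + nb) * (B * (B * 16 + 17))) ≤
      66 * (1 + (1 + b + 1 / a) / c) *
        ((1 + 34 / a * (136 / a)) * (136 / a + 34 / a * (136 / a))) *
          (m * n + m * n * ω / (kPrime ω M M h * M)) := by
  have ha := S.a_pos
  have hb := S.b_pos
  have hc := S.c_pos
  have hk0 := S.k_pos
  have hM := S.M_real
  have h1 := T.rects_le S
  have h2 := T.evals_le S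
  set nr : ℝ := (((n + kk * B - 1) / (kk * B) : ℕ) : ℝ)
  have hnr0 : 0 ≤ nr := Nat.cast_nonneg _
  set C := 1 + (1 + b + 1 / a) / c
  set D := (1 + 34 / a * (136 / a)) * (136 / a + 34 / a * (136 / a))
  have hB1 : (1 : ℝ) ≤ B := by
    have := T.le_B; have := T.le_M
    exact_mod_cast (show 1 ≤ B by omega)
  have hnb : (nb : ℝ) * B ≤ 2 * m := by exact_mod_cast T.nb_mul_le S.M_le
  have h3 : (nb : ℝ) * (kk + nb) ≤ D * (1 + ω / (kPrime ω M M h * M)) := by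
    rw [← le_div_iff₀ (by positivity)] at h2
    refine h2.trans (le_of_eq ?_)
    field_simp
    ring
  calc nr * (nb * nb * kk * (kk + nb) * (B * (B * 16 + 17))) ≤
        nr * (nb * nb * kk * (kk + nb) * (B * (B * 33))) := by
        gcongr
        linarith
    _ = 33 * (nr * (kk * B)) * (nb * B) * (nb * (kk + nb)) := by ring
    _ ≤ 33 * (C * n) * (2 * m) * (D * (1 + ω / (kPrime ω M M h * M))) := by gcongr
    _ = _ := by ring

/-- The same regrouping with one factor `B` less, so `nb = O(m / M)` takes the place of `nb * B =
O(m)`. -/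
theorem Tiling.reads_le (T : Tiling M ω m n 1 w B nb kk) (S : Sizes a b c M ω m n 1 h) :
    (((n + kk * B - 1) / (kk * B) : ℕ) : ℝ) * (nb * nb * kk * (kk + nb) * B) ≤
      34 * (1 + (1 + b + 1 / a) / c) *
        ((1 + 34 / a * (136 / a)) * (136 / a + 34 / a * (136 / a))) * (1 + 1 / a) *
          (m * n * ω / (kPrime ω M 1 h * M)) := by
  have ha := S.a_pos
  have hb := S.b_pos
  have hc := S.c_pos
  have hk0 := S.k_pos
  have hM := S.M_real
  have h1 := T.rects_le S
  have h2 := T.evals_le S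
  rw [Nat.cast_one] at hk0 h2
  rw [one_mul] at h2
  set nr : ℝ := (((n + kk * B - 1) / (kk * B) : ℕ) : ℝ)
  have hnr0 : 0 ≤ nr := Nat.cast_nonneg _
  set C := 1 + (1 + b + 1 / a) / c
  set D := (1 + 34 / a * (136 / a)) * (136 / a + 34 / a * (136 / a))
  have hω : (1 : ℝ) ≤ ω := by exact_mod_cast S.ω_pos
  -- The I/O bound has no separate term `m * n`, so the constant part of the number of evaluations
  -- must be absorbed into `ω / kPrime`.
  have hk : kPrime ω M 1 h ≤ 1 / a * ω := by
    refine (min_le_left _ _).trans (Real.sqrt_le_iff.2 ⟨by positivity, ?_⟩)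
    have h4 : (1 : ℝ) ≤ 1 / a * ω := by
      rw [one_div_mul_eq_div, one_le_div ha]
      exact S.a_le.trans hω
    calc (ω : ℝ) / (h * 1) ≤ ω / a := by rw [mul_one]; gcongr; exact S.a_le_h
      _ = 1 / a * ω * 1 := by ring
      _ ≤ 1 / a * ω * (1 / a * ω) := by gcongr
      _ = _ := by ring
  have h3 : (nb : ℝ) * (kk + nb) ≤ D * ((1 + 1 / a) * ω / kPrime ω M 1 h) := by
    rw [← le_div_iff₀ hk0] at h2
    refine h2.trans ?_
    rw [← mul_div_assoc]
    gcongr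
    linarith
  have hnb := T.nb_le S
  calc nr * (nb * nb * kk * (kk + nb) * B) = (nr * (kk * B)) * nb * (nb * (kk + nb)) := by ring
    _ ≤ (C * n) * (34 * (m / M)) * (D * ((1 + 1 / a) * ω / kPrime ω M 1 h)) := by gcongr
    _ = _ := by
      field_simp

/-- If the tiles do not fit into small memory, then all sizes but the length of the longer string
are bounded. -/
theorem Sizes.bounded (S : Sizes a b c M ω m n ρ h)
    (hs : M < 256 ∨ M / 16 * (M / 16) < m) :
    (m * m * n * ω : ℝ) ≤ ((256 + (289 / a) ^ 2) ^ 2 / a) ^ 2 *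
      (m * n * ω / (kPrime ω M ρ h * M)) := by
  have ha := S.a_pos
  have hk0 := S.k_pos
  have hM := S.M_real
  have hM1 : (1 : ℝ) ≤ M := by exact_mod_cast S.M_pos
  have hh := S.h_long.trans (min_le_right _ _)
  have h1 := S.le_h.trans hh
  set r := Real.sqrt M with hr
  have hr0 : 0 < r := Real.sqrt_pos.2 hM
  have hrr : r * r = M := Real.mul_self_sqrt hM.le
  rw [← mul_div_assoc, div_le_iff₀ hM] at h1
  set M0 : ℝ := 256 + (289 / a) ^ 2 with hM0
  have hMM0 : (M : ℝ) ≤ M0 := by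
    by_cases h256 : M < 256
    · have : (M : ℝ) ≤ 256 := by exact_mod_cast h256.le
      have : 0 ≤ (289 / a) ^ 2 := sq_nonneg _
      linarith
    · have h2 := hs.resolve_left h256
      -- Here `289 = 17 ^ 2` comes from `M ≤ 17 * (M / 16)`. Combined with `a * m ≤ √M * M`, a
      -- consequence of `h ≤ √M`, it gives `√M ≤ 289 / a`, so that `M`, `m` and `kPrime * M` are all
      -- bounded.
      have h3 : M * M ≤ 289 * m := by
        calc M * M ≤ (17 * (M / 16)) * (17 * (M / 16)) := Nat.mul_le_mul (by omega) (by omega)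
          _ = 289 * (M / 16 * (M / 16)) := by ring
          _ ≤ _ := Nat.mul_le_mul_left _ h2.le
      have h4 : (M : ℝ) * M ≤ 289 * m := by exact_mod_cast h3
      have h5 : r * a ≤ 289 := by
        have : (r * M) * (r * a) ≤ (r * M) * 289 := by
          calc (r * M) * (r * a) = a * ((r * r) * M) := by ring
            _ = a * (M * M) := by rw [hrr]
            _ ≤ a * (289 * m) := by gcongr
            _ = 289 * (a * m) := by ring
            _ ≤ 289 * (r * M) := by gcongr
            _ = _ := by ring
        exact le_of_mul_le_mul_left this (by positivity)
      rw [← le_div_iff₀ ha] at h5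
      calc (M : ℝ) = r ^ 2 := by rw [sq, hrr]
        _ ≤ (289 / a) ^ 2 := by gcongr
        _ ≤ M0 := by rw [hM0]; linarith
  have hm : (m : ℝ) ≤ M0 ^ 2 / a := by
    rw [le_div_iff₀ ha]
    have : r ≤ M := by rw [hr]; exact Real.sqrt_le_iff.2 ⟨hM.le, by nlinarith⟩
    calc (m : ℝ) * a = a * m := mul_comm _ _
      _ ≤ r * M := h1
      _ ≤ M0 * M0 := by gcongr; exact this.trans hMM0
      _ = _ := by ring
  have hkM : kPrime ω M ρ h * M ≤ M0 ^ 2 / a := by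
    have : kPrime ω M ρ h ≤ M / a :=
      (min_le_right _ _).trans (by gcongr; exact S.a_le_h)
    calc kPrime ω M ρ h * M ≤ M0 / a * M0 := by
          gcongr
          exact this.trans (by gcongr)
      _ = _ := by ring
  rw [← mul_div_assoc, le_div_iff₀ (by positivity)]
  calc (m * m * n * ω : ℝ) * (kPrime ω M ρ h * M) = m * (kPrime ω M ρ h * M) * (m * n * ω) := by ring
    _ ≤ M0 ^ 2 / a * (M0 ^ 2 / a) * (m * n * ω) := by gcongr
    _ = _ := by ring

end

/-- Work is the weighted cost with weights `1, 1, ω`. The constants `C1`, `C2` and `C3` belong to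
the evaluations, the writes and the variant in large memory. -/
theorem mainProgram_work (lcs : Bool) {a b c : ℝ} (ha : 0 < a) (hb : 0 < b)
    (hc : 0 < c) : ∃ C : ℝ, 0 < C ∧ ∀ (M ω w m n : ℕ) (h : ℝ) (x y : List ℕ),
      x.length = m → y.length = n → (m + n) ^ 16 ≤ 2 ^ w → (∀ z ∈ x ++ y, z < 2 ^ w) →
      Sizes a b c M ω m n M h →
      ∃ cost : Cost, Computes M ω w (mainProgram lcs false) (solution lcs) x y cost ∧
        (cost.work ω : ℝ) ≤ C * (m * n + m * n * ω / (kPrime ω M M h * M)) := by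
  set C1 := 66 * (1 + (1 + b + 1 / a) / c) *
    ((1 + 34 / a * (136 / a)) * (136 / a + 34 / a * (136 / a))) with hC1
  set C2 := (1 + (1 + b + 1 / a) / c) * (17 * (136 / a)) * 34 with hC2
  set C3 := ((256 + (289 / a) ^ 2) ^ 2 / a) ^ 2 with hC3
  have h1 : 0 < C1 := by positivity
  have h2 : 0 < C2 := by positivity
  have h3 : 0 < C3 := by positivity
  refine ⟨2000 * C1 + 12 * C2 + 200000 * C3, by positivity, ?_⟩
  rintro M ω w m n h x y rfl rfl hw hz S
  have hM := S.M_pos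
  have hk0 := S.k_pos
  have hMr := S.M_real
  have hR : (0 : ℝ) ≤ x.length * y.length * ω / (kPrime ω M M h * M) := by positivity
  have hmn : (0 : ℝ) ≤ (x.length : ℝ) * y.length := by positivity
  by_cases hs : 256 ≤ M ∧ x.length ≤ M / 16 * (M / 16)
  · obtain ⟨E, hE⟩ : ∃ E, E = envSmall M w (4 + x.length + y.length) 1 1 ω := ⟨_, rfl⟩
    obtain ⟨B, hB⟩ : ∃ B, B = M / 16 := ⟨_, rfl⟩
    obtain ⟨nb, hnb⟩ : ∃ nb, nb = (x.length + B - 1) / B := ⟨_, rfl⟩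
    obtain ⟨kk, hkk⟩ : ∃ kk, kk = width M (min ω (2 ^ w - 1)) nb M M := ⟨_, rfl⟩
    obtain ⟨cost, s, e, r, hcost⟩ := mainProgram_exec_small (ω := ω) (lcs := lcs) (io := false) hs.1
      S.M_le S.m_le hs.2 hw hz hB hnb hkk hE
    refine ⟨cost, ⟨s, e, r⟩, ?_⟩
    have T : Tiling M ω x.length y.length M w B nb kk := ⟨hs.1, hw, hB, hnb, hkk⟩
    have hA := T.work_le S
    have hW := T.writes_le S (g := 16 + ω) (by positivity) (by
      have : (1 : ℝ) ≤ ω := by exact_mod_cast S.ω_pos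
      linarith)
    have hμ : E.μ cost = cost.work ω := by
      rw [hE]
      simp only [Env.μ, envSmall, Cost.work, Cost.io]
      ring
    have hcs : E.cs = 16 := by rw [hE]; rfl
    have hcr : E.cr = 17 := by rw [hE]; rfl
    have hcw : E.cw = 16 + ω := by rw [hE]; rfl
    rw [hμ, hcs, hcr, hcw] at hcost
    rw [← hC1] at hA
    rw [← hC2] at hW
    have hcost := (Nat.cast_le (α := ℝ)).2 hcost
    set nr := (y.length + kk * B - 1) / (kk * B)
    set R : ℝ := x.length * y.length * ω / (kPrime ω M M h * M)
    push_cast at hcost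
    have h3R := mul_nonneg h3.le (add_nonneg hmn hR)
    have h2R := mul_nonneg h2.le hmn
    nlinarith only [hA, hW, hcost, h3R, h2R]
  · obtain ⟨E, hE⟩ : ∃ E, E = envSmall M w (4 + x.length + y.length) 1 1 ω := ⟨_, rfl⟩
    obtain ⟨cost, s, e, r, hcost⟩ := mainProgram_exec_large (ω := ω) (lcs := lcs) (io := false)
      (wS := 1) (wR := 1) (wW := ω) (E := E) le_rfl le_rfl S.ω_pos S.M_pos S.M_le S.m_le (by omega) hw hz
      (by rw [hE]; exact ⟨rfl, rfl, rfl⟩)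
    refine ⟨cost, ⟨s, e, r⟩, ?_⟩
    have hA := S.bounded (by omega)
    rw [← hC3] at hA
    have hμ : E.μ cost = cost.work ω := by
      rw [hE]
      simp only [Env.μ, envSmall, Cost.work, Cost.io]
      ring
    rw [hμ] at hcost
    have hcost := (Nat.cast_le (α := ℝ)).2 hcost
    push_cast at hcost
    set R : ℝ := x.length * y.length * ω / (kPrime ω M M h * M)
    have h1R := mul_nonneg h1.le (add_nonneg hmn hR)
    have h2R := mul_nonneg h2.le (add_nonneg hmn hR)
    have h3R := mul_nonneg h3.le hmn
    nlinarith only [hA, hcost, h1R, h2R, h3R]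

/-- I/O cost is the weighted cost with weights `0, 1, ω`. With small memory as scratch memory the
scratch steps are then free, and a corridor column costs a single read, apart from the left
boundary. -/
theorem mainProgram_io (lcs : Bool) {a b c : ℝ} (ha : 0 < a) (hb : 0 < b)
    (hc : 0 < c) : ∃ C : ℝ, 0 < C ∧ ∀ (M ω w m n : ℕ) (h : ℝ) (x y : List ℕ),
      x.length = m → y.length = n → (m + n) ^ 16 ≤ 2 ^ w → (∀ z ∈ x ++ y, z < 2 ^ w) →
      Sizes a b c M ω m n 1 h →
      ∃ cost : Cost, Computes M ω w (mainProgram lcs true) (solution lcs) x y cost ∧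
        (cost.io ω : ℝ) ≤ C * (m * n * ω / (kPrime ω M 1 h * M)) := by
  set C1 := 34 * (1 + (1 + b + 1 / a) / c) *
    ((1 + 34 / a * (136 / a)) * (136 / a + 34 / a * (136 / a))) * (1 + 1 / a) with hC1
  set C2 := (1 + (1 + b + 1 / a) / c) * (17 * (136 / a)) * 34 with hC2
  set C3 := ((256 + (289 / a) ^ 2) ^ 2 / a) ^ 2 with hC3
  have h1 : 0 < C1 := by positivity
  have h2 : 0 < C2 := by positivity
  have h3 : 0 < C3 := by positivity
  refine ⟨2000 * C1 + 12 * C2 + 200000 * C3, by positivity, ?_⟩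
  rintro M ω w m n h x y rfl rfl hw hz S
  have hM := S.M_pos
  have hk0 := S.k_pos
  rw [Nat.cast_one] at hk0
  have hMr := S.M_real
  have hR : (0 : ℝ) ≤ x.length * y.length * ω / (kPrime ω M 1 h * M) := by positivity
  by_cases hs : 256 ≤ M ∧ x.length ≤ M / 16 * (M / 16)
  · obtain ⟨E, hE⟩ : ∃ E, E = envSmall M w (4 + x.length + y.length) 0 1 ω := ⟨_, rfl⟩
    obtain ⟨B, hB⟩ : ∃ B, B = M / 16 := ⟨_, rfl⟩
    obtain ⟨nb, hnb⟩ : ∃ nb, nb = (x.length + B - 1) / B := ⟨_, rfl⟩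
    obtain ⟨kk, hkk⟩ : ∃ kk, kk = width M (min ω (2 ^ w - 1)) nb 1 M := ⟨_, rfl⟩
    obtain ⟨cost, s, e, r, hcost⟩ := mainProgram_exec_small (ω := ω) (lcs := lcs) (io := true) hs.1
      S.M_le S.m_le hs.2 hw hz hB hnb hkk hE
    refine ⟨cost, ⟨s, e, r⟩, ?_⟩
    have T : Tiling M ω x.length y.length 1 w B nb kk := ⟨hs.1, hw, hB, hnb, hkk⟩
    have hA := T.reads_le S
    have hW := T.writes_le S (g := ω) (by positivity) (by
      have : (0 : ℝ) ≤ ω := by positivity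
      linarith)
    have hμ : E.μ cost = cost.io ω := by
      rw [hE]
      simp only [Env.μ, envSmall, Cost.io]
      ring
    have hcs : E.cs = 0 := by rw [hE]; rfl
    have hcr : E.cr = 1 := by rw [hE]; rfl
    have hcw : E.cw = ω := by rw [hE]; exact Nat.zero_add ω
    rw [hμ, hcs, hcr, hcw] at hcost
    rw [← hC1] at hA
    rw [← hC2] at hW
    have hcost := (Nat.cast_le (α := ℝ)).2 hcost
    set nr := (y.length + kk * B - 1) / (kk * B)
    set R : ℝ := x.length * y.length * ω / (kPrime ω M 1 h * M)
    push_cast at hcost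
    have h3R := mul_nonneg h3.le hR
    rw [Nat.cast_one] at hW
    nlinarith only [hA, hW, hcost, h3R]
  · obtain ⟨E, hE⟩ : ∃ E, E = envSmall M w (4 + x.length + y.length) 0 1 ω := ⟨_, rfl⟩
    obtain ⟨cost, s, e, r, hcost⟩ := mainProgram_exec_large (ω := ω) (lcs := lcs) (io := true)
      (wS := 0) (wR := 1) (wW := ω) (E := E) le_rfl (Nat.zero_le _) S.ω_pos S.M_pos S.M_le S.m_le (by omega) hw hz
      (by rw [hE]; exact ⟨rfl, rfl, rfl⟩)
    refine ⟨cost, ⟨s, e, r⟩, ?_⟩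
    have hA := S.bounded (by omega)
    rw [← hC3] at hA
    have hμ : E.μ cost = cost.io ω := by
      rw [hE]
      simp only [Env.μ, envSmall, Cost.io]
      ring
    rw [hμ] at hcost
    have hcost := (Nat.cast_le (α := ℝ)).2 hcost
    push_cast at hcost
    set R : ℝ := x.length * y.length * ω / (kPrime ω M 1 h * M)
    have h1R := mul_nonneg h1.le hR
    have h2R := mul_nonneg h2.le hR
    rw [Nat.cast_one] at hA
    nlinarith only [hA, hcost, h1R, h2R]

/-- Lowering `a` weakens the hypothesis on `h`, so `a ≤ 1` may be assumed, which simplifies the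
constants. -/
theorem Sizes.of_min {a b c : ℝ} {M ω m n ρ : ℕ} {h : ℝ} (ha : 0 < a) (hb : 0 < b) (hc : 0 < c)
    (hM : 1 ≤ M) (hω : 1 ≤ ω) (hρ : 1 ≤ ρ) (hρM : ρ ≤ M) (hMm : M ≤ m) (hmn : m ≤ n)
    (h1 : a * (m / M) ≤ h) (h2 : h ≤ b * (m / M)) (h3 : h ≤ kLong ω M ρ)
    (h4 : c * (kPrime ω M ρ h * M) ≤ n) : Sizes (min a 1) b c M ω m n ρ h :=
  ⟨hM, hω, hρ, hρM, hMm, hmn, lt_min ha one_pos, min_le_right _ _, hb, hc,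
    (mul_le_mul_of_nonneg_right (min_le_left _ _) (by positivity)).trans h1, h2, h3, h4⟩

theorem exists_eq_solution {f : List ℕ → List ℕ → ℕ} (hf : f = lcsLength ∨ f = editDistance) :
    ∃ lcs, f = solution lcs := by
  rcases hf with rfl | rfl
  · exact ⟨true, by funext x y; exact (solution_true x y).symm⟩
  · exact ⟨false, by funext x y; exact (solution_false x y).symm⟩

end AsymDP

theorem mainTheorem10 :
    -- work
    (∀ f : List ℕ → List ℕ → ℕ, f = lcsLength ∨ f = editDistance →
      ∃ (P : Program) (κ : ℕ), ∀ a b c : ℝ, 0 < a → 0 < b → 0 < c → ∃ C : ℝ, 0 < C ∧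
        ∀ (M ω w m n : ℕ) (h : ℝ) (x y : List ℕ),
          1 ≤ M → 1 ≤ ω → x.length = m → y.length = n → M ≤ m → m ≤ n →
          (m + n) ^ κ ≤ 2 ^ w → (∀ z ∈ x ++ y, z < 2 ^ w) →
          a * (m / M) ≤ h → h ≤ b * (m / M) → h ≤ kT ω M → c * (kT' ω M h * M) ≤ n →
          ∃ cost : Cost, Computes M ω w P f x y cost ∧
            (cost.work ω : ℝ) ≤ C * (m * n + m * n * ω / (kT' ω M h * M))) ∧
    -- I/O cost
    (∀ f : List ℕ → List ℕ → ℕ, f = lcsLength ∨ f = editDistance →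
      ∃ (P : Program) (κ : ℕ), ∀ a b c : ℝ, 0 < a → 0 < b → 0 < c → ∃ C : ℝ, 0 < C ∧
        ∀ (M ω w m n : ℕ) (h : ℝ) (x y : List ℕ),
          1 ≤ M → 1 ≤ ω → x.length = m → y.length = n → M ≤ m → m ≤ n →
          (m + n) ^ κ ≤ 2 ^ w → (∀ z ∈ x ++ y, z < 2 ^ w) →
          a * (m / M) ≤ h → h ≤ b * (m / M) → h ≤ kQ ω M → c * (kQ' ω M h * M) ≤ n →
          ∃ cost : Cost, Computes M ω w P f x y cost ∧
            (cost.io ω : ℝ) ≤ C * (m * n * ω / (kQ' ω M h * M))) ∧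
    -- comparison with the parameters for long strings
    (∀ (M ω : ℕ) (h : ℝ), 1 ≤ M → 1 ≤ ω → 0 < h →
      (h ≤ kT ω M → kT ω M ≤ kT' ω M h) ∧ (h < kT ω M → kT ω M < kT' ω M h) ∧
      (h ≤ kQ ω M → kQ ω M ≤ kQ' ω M h) ∧ (h < kQ ω M → kQ ω M < kQ' ω M h)) := by
  refine ⟨fun f hf => ?_, fun f hf => ?_, fun M ω h hM hω hh => ?_⟩
  · obtain ⟨lcs, rfl⟩ := AsymDP.exists_eq_solution hf
    -- Program and exponent are fixed before `a`, `b` and `c`: only the analysis depends on these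
    -- constants.
    refine ⟨AsymDP.mainProgram lcs false, 16, fun a b c ha hb hc => ?_⟩
    obtain ⟨C, hC, H⟩ := AsymDP.mainProgram_work lcs (lt_min ha one_pos) hb hc
    refine ⟨C, hC, fun M ω w m n h x y hM hω hx hy hMm hmn hw hz h1 h2 h3 h4 => ?_⟩
    exact H M ω w m n h x y hx hy hw hz
      (.of_min ha hb hc hM hω hM le_rfl hMm hmn h1 h2 h3 h4)
  · obtain ⟨lcs, rfl⟩ := AsymDP.exists_eq_solution hf
    refine ⟨AsymDP.mainProgram lcs true, 16, fun a b c ha hb hc => ?_⟩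
    obtain ⟨C, hC, H⟩ := AsymDP.mainProgram_io lcs (lt_min ha one_pos) hb hc
    refine ⟨C, hC, fun M ω w m n h x y hM hω hx hy hMm hmn hw hz h1 h2 h3 h4 => ?_⟩
    rw [AsymDP.kQ'_eq] at h4 ⊢
    rw [AsymDP.kQ_eq] at h3
    exact H M ω w m n h x y hx hy hw hz
      (.of_min ha hb hc hM hω le_rfl hM hMm hmn h1 h2 (by rwa [Nat.cast_one])
        (by rwa [Nat.cast_one]))
  · have hM' : (0 : ℝ) < M := by exact_mod_cast hM
    have hω' : (0 : ℝ) < ω := by exact_mod_cast hω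
    rw [AsymDP.kT_eq, AsymDP.kT'_eq, AsymDP.kQ_eq, AsymDP.kQ'_eq]
    exact ⟨AsymDP.kLong_le_kPrime hω' hM' hM' hh, AsymDP.kLong_lt_kPrime hω' hM' hM' hh,
      AsymDP.kLong_le_kPrime hω' hM' one_pos hh, AsymDP.kLong_lt_kPrime hω' hM' one_pos hh⟩
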